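/- For $k \ge 0$ let $\mathfrak P_k$ denote the space of complex polynomials of degree at most $k$; an element $f \in \mathfrak P_6$, $f\neq 0$, has $6$ roots in $\mathbb{CP}^1$ counted with multiplicity, where $\infty$ is regarded as a root of multiplicity $6-\deg f$ (similarly, a non-zero $p\in\mathfrak P_2$ has two roots in $\mathbb{CP}^1$). Call $f$ *admissible* if $\deg f\in\{5,6\}$ and $f$ has no multiple roots. An *open disc* in $\mathbb{CP}^1$ is an image of the open unit disc of $\mathbb C$ under a Möbius transformation. Let $\mathfrak D=(D_1,D_2,D_3)$ be a triple of pairwise disjoint open discs in $\mathbb{CP}^1$. A non-zero $f\in\mathfrak P_6$ is *subordinate* to $\mathfrak D$ if each $D_j$ contains exactly two roots of $f$, counted with multiplicity. For $p,q,r\in\mathfrak P_2$ put $[p,q]=p'q-pq'$ and $$\Delta(p,q,r)=\det\begin{pmatrix}p_0&q_0&r_0\\p_1&q_1&r_1\\p_2&q_2&r_2\end{pmatrix},$$ where $p_i$ is the coefficient of $x^i$ in $p$. If $f$ is subordinate to $\mathfrak D$, write $f=p_1p_2p_3$ with $p_j\in\mathfrak P_2$ such that both roots of $p_j$ in $\mathbb{CP}^1$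 lie in $D_j$, and put $$H_{\mathfrak D}(f)=\frac{1}{4\Delta(p_1,p_2,p_3)}\,[p_2,p_3]\,[p_3,p_1]\,[p_1,p_2];$$ this does not depend on the choice of the decomposition. Let $\gamma_j$ be the boundary of $D_j$ with its standard orientation (with $D_j$ on the left). For a single-valued branch $\sqrt f$ of the square root of $f$ in a neighbourhood of $\mathbb{CP}^1\setminus(D_1\cup D_2\cup D_3)$ let $$\mathfrak W(f;\mathfrak D)=\begin{pmatrix}\int_{\gamma_1}\frac{dx}{\sqrt{f(x)}}&\int_{\gamma_2}\frac{dx}{\sqrt{f(x)}}&\int_{\gamma_3}\frac{dx}{\sqrt{f(x)}}\\[2pt]\int_{\gamma_1}\frac{x\,dx}{\sqrt{f(x)}}&\int_{\gamma_2}\frac{x\,dx}{\sqrt{f(x)}}&\int_{\gamma_3}\frac{x\,dx}{\sqrt{f(x)}}\end{pmatrix},$$ with the same branch in all six integrals. **Proposition.** Let $f$ be an admissible polynomial subordinate to $\mathfrak D=(D_1,D_2,D_3)$. Then both $f$ and $H_{\mathfrak D}(f)$ have a single-valued branch of the square root in a neighbourhood of $\mathbb{CP}^1\setminus(D_1\cup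 D_2\cup D_3)$, and for every choice of these branches $$\mathfrak W(f;\mathfrak D)=\pm\,\mathfrak W(H_{\mathfrak D}(f);\mathfrak D)$$ (with one common sign for the whole matrix). -/

import Mathlib

open scoped Polynomial MatrixGroups OnePoint

noncomputable section

namespace Richelot

/-! ### Discs in the Riemann sphere

The complex projective line is `OnePoint ℂ`, with Mathlib's action of `GL(2, ℂ)` by Möbius
transformations. -/

/-- The image of the open unit disc of `ℂ` under the Möbius transformation `g`. -/
def mobiusDisc (g : GL (Fin 2) ℂ) : Set (OnePoint ℂ) :=
  (fun z : ℂ => g • (z : OnePoint ℂ)) '' Metric.ball (0 : ℂ) 1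

/-- The affine expression `z ↦ (a z + b) / (c z + d)` of the Möbius transformation `g`
(meaningful where `c z + d ≠ 0`). -/
def mobius (g : GL (Fin 2) ℂ) (z : ℂ) : ℂ :=
  (g 0 0 * z + g 0 1) / (g 1 0 * z + g 1 1)

theorem coe_mobius (g : GL (Fin 2) ℂ) (z : ℂ) (hz : g 1 0 * z + g 1 1 ≠ 0) :
    ((mobius g z : ℂ) : OnePoint ℂ) = g • (z : OnePoint ℂ) := by
  rw [OnePoint.smul_some_eq_ite, if_neg hz, mobius]

/-- The integral `∫_γ F(x) dx` of a `1`-form over the boundary `γ` of the disc `mobiusDisc g`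
with its standard orientation (the disc lies to the left of `γ`). The curve is parametrized by
`θ ↦ g • exp(iθ)`, `θ ∈ [0, 2π]`, so this is the integral over the unit circle of the pull-back
`F(mobius g z) (mobius g)'(z) dz`. (If `∞ ∈ γ`, the single parameter value that is sent to `∞`
does not matter for the integral.) -/
def boundaryIntegral (g : GL (Fin 2) ℂ) (F : ℂ → ℂ) : ℂ :=
  ∮ z in C(0, 1), F (mobius g z) * deriv (mobius g) z

/-! ### Polynomials subordinate to a triple of discs -/

open scoped Classical in
/-- The number of roots in `D ⊆ ℂℙ¹`, with multiplicity, of a nonzero polynomial `f` of degree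
at most `n`, where `∞` is regarded as a root of multiplicity `n - deg f`. -/
def rootCount (n : ℕ) (f : ℂ[X]) (D : Set (OnePoint ℂ)) : ℕ :=
  (f.roots.filter (fun a : ℂ => (a : OnePoint ℂ) ∈ D)).card +
    if ∞ ∈ D then n - f.natDegree else 0

/-- `f` has degree `5` or `6` and no multiple roots. -/
def IsAdmissible (f : ℂ[X]) : Prop :=
  (f.natDegree = 5 ∨ f.natDegree = 6) ∧ f.roots.Nodup

/-- A nonzero polynomial `f` of degree at most `6` is subordinate to `D = (D₀, D₁, D₂)` if each
`D j` contains exactly two of its six roots in `ℂℙ¹`, counted with multiplicity. -/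
def IsSubordinate (D : Fin 3 → Set (OnePoint ℂ)) (f : ℂ[X]) : Prop :=
  f ≠ 0 ∧ f.natDegree ≤ 6 ∧ ∀ j, rootCount 6 f (D j) = 2

/-! ### The Richelot construction -/

/-- `[p, q] = p' q - p q'`. -/
def bracket (p q : ℂ[X]) : ℂ[X] :=
  Polynomial.derivative p * q - p * Polynomial.derivative q

/-- The determinant of the coefficients of three polynomials of degree at most `2`. -/
def delta (p q r : ℂ[X]) : ℂ :=
  Matrix.det !![p.coeff 0, q.coeff 0, r.coeff 0;
                p.coeff 1, q.coeff 1, r.coeff 1;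
                p.coeff 2, q.coeff 2, r.coeff 2]

/-- The result `[q, r] [r, p] [p, q] / (4 Δ(p, q, r))` of the Richelot construction. -/
def richelot (p q r : ℂ[X]) : ℂ[X] :=
  Polynomial.C (1 / (4 * delta p q r)) * (bracket q r * bracket r p * bracket p q)

/-- `f = p₀ p₁ p₂` where each `p j` is a nonzero polynomial of degree at most `2`, both of whose
roots in `ℂℙ¹` lie in `D j`. -/
def IsDecomposition (D : Fin 3 → Set (OnePoint ℂ)) (f : ℂ[X]) (p : Fin 3 → ℂ[X]) : Prop :=
  f = p 0 * p 1 * p 2 ∧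
    ∀ j, p j ≠ 0 ∧ (p j).natDegree ≤ 2 ∧ rootCount 2 (p j) (D j) = 2

open scoped Classical in
/-- The monic polynomial whose roots are the finite roots of `f` in `D`. -/
def discFactor (f : ℂ[X]) (D : Set (OnePoint ℂ)) : ℂ[X] :=
  ((f.roots.filter (fun a : ℂ => (a : OnePoint ℂ) ∈ D)).map
    (fun a => Polynomial.X - Polynomial.C a)).prod

/-- The polynomial `H_D(f)`: the Richelot construction for the decomposition of `f` into factors
whose roots lie in the respective discs. The theorems `isDecomposition_discFactor` and
`richelotStep_eq` show that this is such a decomposition and that any other one gives the same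
result. -/
def richelotStep (D : Fin 3 → Set (OnePoint ℂ)) (f : ℂ[X]) : ℂ[X] :=
  richelot (Polynomial.C f.leadingCoeff * discFactor f (D 0)) (discFactor f (D 1))
    (discFactor f (D 2))

theorem discFactor_ne_zero (f : ℂ[X]) (D : Set (OnePoint ℂ)) : discFactor f D ≠ 0 :=
  (Polynomial.monic_multiset_prod_of_monic _ _ fun a _ => Polynomial.monic_X_sub_C a).ne_zero

open scoped Classical in
theorem roots_discFactor (f : ℂ[X]) (D : Set (OnePoint ℂ)) :
    (discFactor f D).roots = f.roots.filter (fun a : ℂ => (a : OnePoint ℂ) ∈ D) :=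
  Polynomial.roots_multiset_prod_X_sub_C _

open scoped Classical in
theorem natDegree_discFactor (f : ℂ[X]) (D : Set (OnePoint ℂ)) :
    (discFactor f D).natDegree = (f.roots.filter (fun a : ℂ => (a : OnePoint ℂ) ∈ D)).card :=
  Polynomial.natDegree_multiset_prod_X_sub_C_eq_card _

theorem rootCount_discFactor {f : ℂ[X]} {D : Set (OnePoint ℂ)} (h : rootCount 6 f D = 2) :
    (discFactor f D).natDegree ≤ 2 ∧ rootCount 2 (discFactor f D) D = 2 := by
  classical
  rw [rootCount] at h
  constructor
  · rw [natDegree_discFactor]; omega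
  · rw [rootCount, natDegree_discFactor, roots_discFactor]
    rw [Multiset.filter_filter]
    simp only [and_self]
    split_ifs at h ⊢ <;> omega

theorem isDecomposition_discFactor {D : Fin 3 → Set (OnePoint ℂ)}
    (hD : Pairwise fun i j => Disjoint (D i) (D j)) {f : ℂ[X]} (hf : IsSubordinate D f) :
    IsDecomposition D f ![Polynomial.C f.leadingCoeff * discFactor f (D 0),
      discFactor f (D 1), discFactor f (D 2)] := by
  classical
  obtain ⟨h0, h6, h⟩ := hf
  have hlc : f.leadingCoeff ≠ 0 := Polynomial.leadingCoeff_ne_zero.mpr h0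
  have hcard : f.roots.card = f.natDegree :=
    (IsAlgClosed.splits f).natDegree_eq_card_roots.symm
  have key : ∀ i j (x : OnePoint ℂ), i ≠ j → x ∈ D i → x ∉ D j := fun i j x hij hx =>
    Set.disjoint_left.mp (hD hij) hx
  have hsum : f.roots.filter (fun a : ℂ => (a : OnePoint ℂ) ∈ D 0)
      + f.roots.filter (fun a : ℂ => (a : OnePoint ℂ) ∈ D 1)
      + f.roots.filter (fun a : ℂ => (a : OnePoint ℂ) ∈ D 2) = f.roots := by
    refine Multiset.eq_of_le_of_card_le ?_ ?_
    · rw [Multiset.le_iff_count]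
      intro a
      simp only [Multiset.count_add, Multiset.count_filter]
      have h01 := key 0 1 (a : OnePoint ℂ) (by decide)
      have h02 := key 0 2 (a : OnePoint ℂ) (by decide)
      have h12 := key 1 2 (a : OnePoint ℂ) (by decide)
      split_ifs <;> first | omega | (exfalso; tauto)
    · have a0 := h 0
      have a1 := h 1
      have a2 := h 2
      simp only [rootCount] at a0 a1 a2
      simp only [Multiset.card_add, hcard]
      have h01 := key 0 1 ∞ (by decide)
      have h02 := key 0 2 ∞ (by decide)
      have h12 := key 1 2 ∞ (by decide)
      split_ifs at a0 a1 a2 <;> first | omega | (exfalso; tauto)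
  refine ⟨?_, ?_⟩
  · have hfac := (IsAlgClosed.splits f).eq_prod_roots
    conv_lhs => rw [hfac, ← hsum]
    simp only [Multiset.map_add, Multiset.prod_add, discFactor, Matrix.cons_val]
    ring
  · intro j
    fin_cases j
    · refine ⟨mul_ne_zero (Polynomial.C_ne_zero.mpr hlc) (discFactor_ne_zero _ _), ?_, ?_⟩
      · simpa [Polynomial.natDegree_C_mul hlc] using (rootCount_discFactor (h 0)).1
      · simpa [rootCount, Polynomial.natDegree_C_mul hlc, Polynomial.roots_C_mul _ hlc] using
          (rootCount_discFactor (h 0)).2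
    · exact ⟨discFactor_ne_zero _ _, rootCount_discFactor (h 1)⟩
    · exact ⟨discFactor_ne_zero _ _, rootCount_discFactor (h 2)⟩

theorem bracket_C_mul (a b : ℂ) (p q : ℂ[X]) :
    bracket (Polynomial.C a * p) (Polynomial.C b * q) = Polynomial.C (a * b) * bracket p q := by
  simp only [bracket, Polynomial.derivative_C_mul, Polynomial.C_mul]
  ring

theorem delta_C_mul (a b c : ℂ) (p q r : ℂ[X]) :
    delta (Polynomial.C a * p) (Polynomial.C b * q) (Polynomial.C c * r)
      = a * b * c * delta p q r := by
  simp only [delta, Matrix.det_fin_three, Polynomial.coeff_C_mul, Matrix.of_apply,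
    Matrix.cons_val]
  ring

theorem richelot_C_mul (a b c : ℂ) (p q r : ℂ[X]) :
    richelot (Polynomial.C a * p) (Polynomial.C b * q) (Polynomial.C c * r)
      = Polynomial.C (a * b * c) * richelot p q r := by
  simp only [richelot, bracket_C_mul, delta_C_mul]
  have e : (1 / (4 * (a * b * c * delta p q r))) * ((b * c) * (c * a) * (a * b))
      = (a * b * c) * (1 / (4 * delta p q r)) := by
    by_cases hd : delta p q r = 0
    · simp [hd]
    · field_simp
  calc _ = Polynomial.C ((1 / (4 * (a * b * c * delta p q r))) * ((b * c) * (c * a) * (a * b)))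
        * (bracket q r * bracket r p * bracket p q) := by
        simp only [Polynomial.C_mul]; ring
    _ = _ := by rw [e]; simp only [Polynomial.C_mul]; ring

theorem richelotStep_eq {D : Fin 3 → Set (OnePoint ℂ)}
    (hD : Pairwise fun i j => Disjoint (D i) (D j)) {f : ℂ[X]} {p : Fin 3 → ℂ[X]}
    (hp : IsDecomposition D f p) : richelotStep D f = richelot (p 0) (p 1) (p 2) := by
  classical
  obtain ⟨rfl, h⟩ := hp
  have hne : ∀ j, p j ≠ 0 := fun j => (h j).1
  have hmem : ∀ j, ∀ a ∈ (p j).roots, (a : OnePoint ℂ) ∈ D j := by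
    intro j
    have hc : (p j).roots.card = (p j).natDegree :=
      (IsAlgClosed.splits (p j)).natDegree_eq_card_roots.symm
    have h2 := (h j).2.2
    have h1 := (h j).2.1
    rw [rootCount] at h2
    have hle := Multiset.card_le_card (Multiset.filter_le (fun a : ℂ => (a : OnePoint ℂ) ∈ D j)
      (p j).roots)
    have : (p j).roots.filter (fun a : ℂ => (a : OnePoint ℂ) ∈ D j) = (p j).roots := by
      refine Multiset.eq_of_le_of_card_le (Multiset.filter_le _ _) ?_
      split_ifs at h2 <;> omega
    exact Multiset.filter_eq_self.mp this
  have hnot : ∀ i j, i ≠ j → (p i).roots.filter (fun a : ℂ => (a : OnePoint ℂ) ∈ D j) = 0 :=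
    fun i j hij => Multiset.filter_eq_nil.mpr fun a ha =>
      Set.disjoint_left.mp (hD hij) (hmem i a ha)
  have hself : ∀ j, (p j).roots.filter (fun a : ℂ => (a : OnePoint ℂ) ∈ D j) = (p j).roots :=
    fun j => Multiset.filter_eq_self.mpr (hmem j)
  have hroots : (p 0 * p 1 * p 2).roots = (p 0).roots + (p 1).roots + (p 2).roots := by
    rw [Polynomial.roots_mul (mul_ne_zero (mul_ne_zero (hne 0) (hne 1)) (hne 2)),
      Polynomial.roots_mul (mul_ne_zero (hne 0) (hne 1))]
  have hd : ∀ j, p j = Polynomial.C (p j).leadingCoeff * discFactor (p 0 * p 1 * p 2) (D j) := by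
    intro j
    have hr : (p 0 * p 1 * p 2).roots.filter (fun a : ℂ => (a : OnePoint ℂ) ∈ D j)
        = (p j).roots := by
      rw [hroots, Multiset.filter_add, Multiset.filter_add]
      fin_cases j
      · simp [hself, hnot 1 0 (by decide), hnot 2 0 (by decide)]
      · simp [hself, hnot 0 1 (by decide), hnot 2 1 (by decide)]
      · simp [hself, hnot 0 2 (by decide), hnot 1 2 (by decide)]
    rw [discFactor, hr]
    exact (IsAlgClosed.splits (p j)).eq_prod_roots
  have hlc : ∀ j, (p j).leadingCoeff ≠ 0 := fun j => Polynomial.leadingCoeff_ne_zero.mpr (hne j)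
  set F := p 0 * p 1 * p 2 with hF
  have hl : F.leadingCoeff
      = (p 0).leadingCoeff * (p 1).leadingCoeff * (p 2).leadingCoeff := by
    rw [hF, Polynomial.leadingCoeff_mul, Polynomial.leadingCoeff_mul]
  have hl0 : F.leadingCoeff ≠ 0 := by
    rw [hl]; exact mul_ne_zero (mul_ne_zero (hlc 0) (hlc 1)) (hlc 2)
  have e1 : richelot (p 0) (p 1) (p 2) = Polynomial.C F.leadingCoeff
      * richelot (discFactor F (D 0)) (discFactor F (D 1)) (discFactor F (D 2)) := by
    rw [hl, ← richelot_C_mul, ← hd 0, ← hd 1, ← hd 2]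
  have e2 := richelot_C_mul F.leadingCoeff 1 1
    (discFactor F (D 0)) (discFactor F (D 1)) (discFactor F (D 2))
  rw [e1, richelotStep]
  simpa using e2

/-! ### The period matrix -/

/-- `s` is a single-valued branch of `√f` in a neighbourhood `U` of `ℂℙ¹ \ (D₀ ∪ D₁ ∪ D₂)`:
at the finite points of `U` it is holomorphic with `s² = f`. (If `∞ ∈ U`, then `s` is
automatically meromorphic at `∞`, since `s² = f`.) -/
def IsSqrtBranch (D : Fin 3 → Set (OnePoint ℂ)) (f : ℂ[X]) (s : ℂ → ℂ) : Prop :=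
  ∃ U : Set (OnePoint ℂ), IsOpen U ∧ (⋃ j, D j)ᶜ ⊆ U ∧
    DifferentiableOn ℂ s {x : ℂ | (x : OnePoint ℂ) ∈ U} ∧
    ∀ x : ℂ, (x : OnePoint ℂ) ∈ U → s x ^ 2 = f.eval x

/-- The `2 × 3` matrix of the integrals of `dx / s` (first row) and `x dx / s` (second row) over
the positively oriented boundaries of the discs `mobiusDisc (g j)`. For a branch `s` of `√f` this
is `𝔚(f; D)`, `D j = mobiusDisc (g j)`, with this choice of the branch. -/
def periodMatrix (g : Fin 3 → GL (Fin 2) ℂ) (s : ℂ → ℂ) : Matrix (Fin 2) (Fin 3) ℂ :=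
  Matrix.of fun k j => boundaryIntegral (g j) fun x => x ^ (k : ℕ) / s x

end Richelot

end

/-!
The branches of `√f` and `√H` are compared through the quotient `f / H`, which for a decomposition
`f = p q r` is a Möbius invariant rational function `ratio p q r` of degree `0` in each factor. The
proof has two independent halves.

*The quotient has a canonical square root.* Outside of three disjoint discs containing the zeros
of `p`, `q`, `r`, the value of `f / H` is never in `(-∞, 0]`, and `Δ ≠ 0`
(`BinQuad.ratio_mem_slitPlane`). Both facts come from Grace's theorem for quadratic forms: a pair
of points that is harmonic to a pair of points in a disc has a point in this disc. A linear
relation among the three forms would make one pair harmonic to three pairs in disjoint discs, and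
a negative value of `f / H` produces such a relation for pairs of points moved inside the discs.
So the principal branch of `√(f / H)` exists on the whole complement of the discs. A branch of `√f`
is written down explicitly there (`BinQuad.exists_branches`), and its quotient by `√(f / H)` is a
branch of `√H`. For arbitrary branches `s` and `t` the function `s / (t √(f / H))` is `±1`, with one
sign on all three boundary circles because these lie in a connected subset of the complement
(`BinQuad.exists_sign`).

*The periods around one disc agree.* In a coordinate `z` in which the disc is the unit disc, let
the zeros of `p` be `t w₁`, `t w₂` and let `t` vary. The periods of `√f` and of `√f / √(f / H)`
around the unit circle are holomorphic in `t` for `|t| < R` with some `R > 1`, so it suffices to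
treat small `t` (`BinQuad.period_eq`). For these, Richelot's correspondence is explicit. In a
coordinate `[x : y]` in which `q` and `r` are even, the point `[x : y]` is sent to
`[x (n + s) : y (n - s)]`, where `s` and `n` are the square roots of `p` at `[x : y]` and at
`[-x : y]` (`BinQuad.jac_diag_eval`). On a small circle this is a perturbation of `z ↦ 2 z`, it
pulls the differentials of `√H` back to those of `√f` up to differentials holomorphic inside the
circle, and the circle and its image are homotopic (`circleIntegral_comp_of_near_double`).
-/

noncomputable section

namespace Richelot

/-! ### Discs as cones of Hermitian forms -/

/-- The Hermitian form `|m₀₀ x + m₀₁ y|² - |m₁₀ x + m₁₁ y|²` on `ℂ²`. The points `[x : y]` of the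
Riemann sphere at which it is negative form an open disc when `m` is invertible. -/
def hform (m : Matrix (Fin 2) (Fin 2) ℂ) (x y : ℂ) : ℝ :=
  ‖m 0 0 * x + m 0 1 * y‖ ^ 2 - ‖m 1 0 * x + m 1 1 * y‖ ^ 2

theorem hform_smul (m : Matrix (Fin 2) (Fin 2) ℂ) (k x y : ℂ) :
    hform m (k * x) (k * y) = ‖k‖ ^ 2 * hform m x y := by
  simp only [hform]
  rw [show m 0 0 * (k * x) + m 0 1 * (k * y) = k * (m 0 0 * x + m 0 1 * y) by ring,
    show m 1 0 * (k * x) + m 1 1 * (k * y) = k * (m 1 0 * x + m 1 1 * y) by ring,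
    norm_mul, norm_mul]
  ring

theorem hform_zero (m : Matrix (Fin 2) (Fin 2) ℂ) : hform m 0 0 = 0 := by
  simp [hform]

theorem hform_mul_matrix (m g : Matrix (Fin 2) (Fin 2) ℂ) (x y : ℂ) :
    hform (m * g) x y = hform m (g 0 0 * x + g 0 1 * y) (g 1 0 * x + g 1 1 * y) := by
  simp only [hform, Matrix.mul_apply, Fin.sum_univ_two]
  congr 3 <;> ring

theorem continuous_hform (m : Matrix (Fin 2) (Fin 2) ℂ) :
    Continuous fun v : ℂ × ℂ => hform m v.1 v.2 := by
  unfold hform; fun_prop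

theorem normSq_convex_comb (s : ℝ) (u v : ℂ) :
    ‖(s : ℂ) * u + (1 - s) * v‖ ^ 2
      = s * ‖u‖ ^ 2 + (1 - s) * ‖v‖ ^ 2 - s * (1 - s) * ‖u - v‖ ^ 2 := by
  simp only [← Complex.normSq_eq_norm_sq, Complex.normSq_apply]
  simp
  ring

theorem hform_convex_comb (m : Matrix (Fin 2) (Fin 2) ℂ) (s : ℝ) (x y x' y' : ℂ) :
    hform m (s * x + (1 - s) * x') (s * y + (1 - s) * y')
      = s * hform m x y + (1 - s) * hform m x' y' - s * (1 - s) * hform m (x - x') (y - y') := by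
  have h1 := normSq_convex_comb s (m 0 0 * x + m 0 1 * y) (m 0 0 * x' + m 0 1 * y')
  have h2 := normSq_convex_comb s (m 1 0 * x + m 1 1 * y) (m 1 0 * x' + m 1 1 * y')
  simp only [hform]
  rw [show m 0 0 * (s * x + (1 - s) * x') + m 0 1 * (s * y + (1 - s) * y')
      = s * (m 0 0 * x + m 0 1 * y) + (1 - s) * (m 0 0 * x' + m 0 1 * y') by ring,
    show m 1 0 * (s * x + (1 - s) * x') + m 1 1 * (s * y + (1 - s) * y')
      = s * (m 1 0 * x + m 1 1 * y) + (1 - s) * (m 1 0 * x' + m 1 1 * y') by ring, h1, h2,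
    show m 0 0 * (x - x') + m 0 1 * (y - y')
      = (m 0 0 * x + m 0 1 * y) - (m 0 0 * x' + m 0 1 * y') by ring,
    show m 1 0 * (x - x') + m 1 1 * (y - y')
      = (m 1 0 * x + m 1 1 * y) - (m 1 0 * x' + m 1 1 * y') by ring]
  ring

/-- A disc is convex in any affine chart whose point at infinity lies outside the disc. -/
theorem hform_neg_of_convex_comb {m : Matrix (Fin 2) (Fin 2) ℂ} {s : ℝ} {x y x' y' : ℂ}
    (h0 : 0 ≤ s) (h1 : s ≤ 1) (h : hform m x y < 0) (h' : hform m x' y' < 0)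
    (hd : 0 ≤ hform m (x - x') (y - y')) :
    hform m (s * x + (1 - s) * x') (s * y + (1 - s) * y') < 0 := by
  rw [hform_convex_comb]
  have h3 : 0 ≤ s * (1 - s) * hform m (x - x') (y - y') :=
    mul_nonneg (mul_nonneg h0 (by linarith)) hd
  rcases h0.eq_or_lt with rfl | hs
  · simp; linarith
  · have := mul_neg_of_pos_of_neg hs h
    have := mul_nonneg (by linarith : 0 ≤ 1 - s) (by linarith : 0 ≤ -hform m x' y')
    linarith

/-- Two proportional vectors, the second nonzero. -/
theorem exists_smul_of_cross_eq_zero {x y x' y' : ℂ} (h : x * y' - x' * y = 0)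
    (h' : x' ≠ 0 ∨ y' ≠ 0) : ∃ k, x = k * x' ∧ y = k * y' := by
  rcases h' with h' | h'
  · refine ⟨x / x', by field_simp, ?_⟩
    field_simp; linear_combination -h
  · refine ⟨y / y', ?_, by field_simp⟩
    field_simp; linear_combination h

theorem cross_ne_zero_of_hform {m : Matrix (Fin 2) (Fin 2) ℂ} {x y x' y' : ℂ}
    (h : hform m x y < 0) (h' : 0 ≤ hform m x' y') (hne : x' ≠ 0 ∨ y' ≠ 0) :
    x * y' - x' * y ≠ 0 := by
  intro h0
  obtain ⟨k, rfl, rfl⟩ := exists_smul_of_cross_eq_zero h0 hne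
  rw [hform_smul] at h
  nlinarith [sq_nonneg ‖k‖, mul_nonneg (sq_nonneg ‖k‖) h']

/-- Grace's theorem for quadratic forms: if the pair of points `ξ, η` is harmonic to a pair of
points of a disc, then the disc contains `ξ` or `η`. -/
theorem hform_neg_of_harmonic {m : Matrix (Fin 2) (Fin 2) ℂ} {x y x' y' ξ₁ ξ₂ η₁ η₂ : ℂ}
    (h : hform m x y < 0) (h' : hform m x' y' < 0) (hξ : ξ₁ ≠ 0 ∨ ξ₂ ≠ 0) (hη : η₁ ≠ 0 ∨ η₂ ≠ 0)
    (H : (x * ξ₂ - ξ₁ * y) * (x' * η₂ - η₁ * y') + (x' * ξ₂ - ξ₁ * y') * (x * η₂ - η₁ * y) = 0) :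
    hform m ξ₁ ξ₂ < 0 ∨ hform m η₁ η₂ < 0 := by
  by_contra! hcon
  obtain ⟨hξ0, hη0⟩ := hcon
  have c1 := cross_ne_zero_of_hform h hη0 hη
  have c2 := cross_ne_zero_of_hform h' hη0 hη
  set k := (x * η₂ - η₁ * y)⁻¹ with hk
  set k' := (x' * η₂ - η₁ * y')⁻¹ with hk'
  have hk0 : k ≠ 0 := inv_ne_zero c1
  have hk0' : k' ≠ 0 := inv_ne_zero c2
  have e1 : k * (x * η₂ - η₁ * y) = 1 := inv_mul_cancel₀ c1
  have e2 : k' * (x' * η₂ - η₁ * y') = 1 := inv_mul_cancel₀ c2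
  have hd : 0 ≤ hform m (k * x - k' * x') (k * y - k' * y') := by
    obtain ⟨j, hj1, hj2⟩ := exists_smul_of_cross_eq_zero (x := k * x - k' * x')
      (y := k * y - k' * y') (x' := η₁) (y' := η₂) (by linear_combination e1 - e2) hη
    rw [hj1, hj2, hform_smul]; positivity
  have n1 : hform m (k * x) (k * y) < 0 := by
    rw [hform_smul]; exact mul_neg_of_pos_of_neg (by positivity) h
  have n2 : hform m (k' * x') (k' * y') < 0 := by
    rw [hform_smul]; exact mul_neg_of_pos_of_neg (by positivity) h'
  have n3 := hform_neg_of_convex_comb (s := 1 / 2) (by norm_num) (by norm_num) n1 n2 hd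
  have := cross_ne_zero_of_hform n3 hξ0 hξ
  apply this
  push_cast
  linear_combination (1 / 2) * k * k' * H - (1 / 2) * (k * (x * ξ₂ - ξ₁ * y)) * e2
    - (1 / 2) * (k' * (x' * ξ₂ - ξ₁ * y')) * e1

/-! ### Binary quadratic forms -/

/-- The binary quadratic form `a x² + b x y + c y²`. A polynomial of degree at most `2` is such a
form evaluated at `y = 1`, and its roots in `ℂℙ¹` are the zeros of the form. -/
@[ext] structure BinQuad where
  /-- the coefficient of `x²` -/
  a : ℂ
  /-- the coefficient of `x y` -/
  b : ℂ
  /-- the coefficient of `y²` -/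
  c : ℂ

namespace BinQuad

/-- The value of a quadratic form at a vector. -/
def eval (p : BinQuad) (x y : ℂ) : ℂ := p.a * x ^ 2 + p.b * (x * y) + p.c * y ^ 2

/-- The form `k · p`. -/
def scale (k : ℂ) (p : BinQuad) : BinQuad := ⟨k * p.a, k * p.b, k * p.c⟩

/-- The form with zeros at the points `[x : y]` and `[x' : y']`. -/
def ofRoots (x y x' y' : ℂ) : BinQuad := ⟨y * y', -(x * y' + x' * y), x * x'⟩

/-- The homogeneous version of the bracket `[p, q] = p' q - p q'`. -/
def jac (p q : BinQuad) : BinQuad :=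
  ⟨p.a * q.b - p.b * q.a, 2 * (p.a * q.c - p.c * q.a), p.b * q.c - p.c * q.b⟩

/-- The determinant of the coefficients of three forms. -/
def det (p q r : BinQuad) : ℂ :=
  p.c * (q.b * r.a - r.b * q.a) - q.c * (p.b * r.a - r.b * p.a) + r.c * (p.b * q.a - q.b * p.a)

/-- The form `(x, y) ↦ p (m (x, y))`. -/
def comp (p : BinQuad) (m : Matrix (Fin 2) (Fin 2) ℂ) : BinQuad :=
  ⟨p.a * m 0 0 ^ 2 + p.b * (m 0 0 * m 1 0) + p.c * m 1 0 ^ 2,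
    2 * p.a * (m 0 0 * m 0 1) + p.b * (m 0 0 * m 1 1 + m 0 1 * m 1 0) + 2 * p.c * (m 1 0 * m 1 1),
    p.a * m 0 1 ^ 2 + p.b * (m 0 1 * m 1 1) + p.c * m 1 1 ^ 2⟩

/-- The quotient `f / H` of the sextic form `f = p q r` by its Richelot transform
`H = [q, r] [r, p] [p, q] / (4 Δ)`, as a function on `ℂ² ∖ {0}`. It is homogeneous of degree `0`
in the vector and in each of the three forms. -/
def ratio (p q r : BinQuad) (x y : ℂ) : ℂ :=
  4 * det p q r * (p.eval x y * q.eval x y * r.eval x y) /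
    ((jac q r).eval x y * (jac r p).eval x y * (jac p q).eval x y)

theorem eval_ofRoots (x y x' y' u v : ℂ) :
    (ofRoots x y x' y').eval u v = (x * v - u * y) * (x' * v - u * y') := by
  simp only [eval, ofRoots]; ring

theorem eval_scale (k : ℂ) (p : BinQuad) (x y : ℂ) : (scale k p).eval x y = k * p.eval x y := by
  simp only [eval, scale]; ring

theorem eval_smul_smul (p : BinQuad) (k x y : ℂ) : p.eval (k * x) (k * y) = k ^ 2 * p.eval x y := by
  simp only [eval]; ring

theorem scale_ofRoots (k k' x y x' y' : ℂ) :
    scale (k * k') (ofRoots x y x' y') = ofRoots (k * x) (k * y) (k' * x') (k' * y') := by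
  ext <;> simp only [scale, ofRoots] <;> ring

theorem jac_scale (k l : ℂ) (p q : BinQuad) :
    jac (scale k p) (scale l q) = scale (k * l) (jac p q) := by
  ext <;> simp only [scale, jac] <;> ring

theorem det_scale (k l n : ℂ) (p q r : BinQuad) :
    det (scale k p) (scale l q) (scale n r) = k * l * n * det p q r := by
  simp only [scale, det]; ring

theorem eval_comp (p : BinQuad) (m : Matrix (Fin 2) (Fin 2) ℂ) (x y : ℂ) :
    (p.comp m).eval x y = p.eval (m 0 0 * x + m 0 1 * y) (m 1 0 * x + m 1 1 * y) := by
  simp only [eval, comp]; ring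

theorem jac_comp (p q : BinQuad) (m : Matrix (Fin 2) (Fin 2) ℂ) :
    jac (p.comp m) (q.comp m) = scale (m 0 0 * m 1 1 - m 0 1 * m 1 0) ((jac p q).comp m) := by
  ext <;> simp only [scale, jac, comp] <;> ring

theorem det_comp (p q r : BinQuad) (m : Matrix (Fin 2) (Fin 2) ℂ) :
    det (p.comp m) (q.comp m) (r.comp m)
      = (m 0 0 * m 1 1 - m 0 1 * m 1 0) ^ 3 * det p q r := by
  simp only [det, comp]; ring

theorem comp_ofRoots (m : Matrix (Fin 2) (Fin 2) ℂ) (x y x' y' : ℂ) :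
    (ofRoots (m 0 0 * x + m 0 1 * y) (m 1 0 * x + m 1 1 * y)
      (m 0 0 * x' + m 0 1 * y') (m 1 0 * x' + m 1 1 * y')).comp m
      = scale ((m 0 0 * m 1 1 - m 0 1 * m 1 0) ^ 2) (ofRoots x y x' y') := by
  ext <;> simp only [scale, ofRoots, comp] <;> ring

theorem det_rotate (p q r : BinQuad) : det q r p = det p q r := by
  simp only [det]; ring

theorem ratio_rotate (p q r : BinQuad) (x y : ℂ) : ratio q r p x y = ratio p q r x y := by
  simp only [ratio, det_rotate p q r]; congr 1 <;> ring

theorem ratio_scale {k l n : ℂ} (hk : k ≠ 0) (hl : l ≠ 0) (hn : n ≠ 0) (p q r : BinQuad) (x y : ℂ) :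
    ratio (scale k p) (scale l q) (scale n r) x y = ratio p q r x y := by
  simp only [ratio, jac_scale, det_scale, eval_scale]
  rw [← mul_div_mul_left (4 * det p q r * _) _
    (mul_ne_zero (mul_ne_zero (pow_ne_zero 2 hk) (pow_ne_zero 2 hl)) (pow_ne_zero 2 hn))]
  congr 1 <;> ring

theorem ratio_comp {m : Matrix (Fin 2) (Fin 2) ℂ} (hm : m 0 0 * m 1 1 - m 0 1 * m 1 0 ≠ 0)
    (p q r : BinQuad) (x y : ℂ) :
    ratio (p.comp m) (q.comp m) (r.comp m) x y
      = ratio p q r (m 0 0 * x + m 0 1 * y) (m 1 0 * x + m 1 1 * y) := by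
  simp only [ratio, jac_comp, det_comp, eval_scale, eval_comp]
  rw [← mul_div_mul_left (4 * det p q r * _) _ (pow_ne_zero 3 hm)]
  congr 1 <;> ring

theorem ratio_smul_smul {k : ℂ} (hk : k ≠ 0) (p q r : BinQuad) (x y : ℂ) :
    ratio p q r (k * x) (k * y) = ratio p q r x y := by
  simp only [ratio, eval_smul_smul]
  rw [← mul_div_mul_left (4 * det p q r * (p.eval x y * q.eval x y * r.eval x y)) _
    (pow_ne_zero 6 hk)]
  congr 1 <;> ring

/-- The linear functionals on quadratic forms are the polarizations with pairs of points. -/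
theorem exists_pair_of_functional {q₀ q₁ q₂ : ℂ} (h : q₀ ≠ 0 ∨ q₁ ≠ 0 ∨ q₂ ≠ 0) :
    ∃ ξ₁ ξ₂ η₁ η₂ : ℂ, (ξ₁ ≠ 0 ∨ ξ₂ ≠ 0) ∧ (η₁ ≠ 0 ∨ η₂ ≠ 0) ∧
      ∀ x y x' y' : ℂ,
        q₀ * (ofRoots x y x' y').c + q₁ * (ofRoots x y x' y').b + q₂ * (ofRoots x y x' y').a = 0 →
        (x * ξ₂ - ξ₁ * y) * (x' * η₂ - η₁ * y') + (x' * ξ₂ - ξ₁ * y') * (x * η₂ - η₁ * y) = 0 := by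
  by_cases h0 : q₀ = 0
  · subst h0
    refine ⟨1, 0, q₂, 2 * q₁, Or.inl one_ne_zero, ?_, ?_⟩
    · rcases h with h | h | h
      · exact absurd rfl h
      · exact Or.inr (by simpa using h)
      · exact Or.inl h
    · intro x y x' y' hh
      simp only [ofRoots] at hh
      linear_combination 2 * hh
  · obtain ⟨d, hd⟩ := IsAlgClosed.exists_pow_nat_eq (q₁ ^ 2 - q₀ * q₂) two_pos
    refine ⟨(q₁ + d) / q₀, 1, (q₁ - d) / q₀, 1, Or.inr one_ne_zero, Or.inr one_ne_zero, ?_⟩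
    intro x y x' y' hh
    simp only [ofRoots] at hh
    field_simp
    linear_combination 2 * q₀ * hh - 2 * y * y' * hd


/-- If three pairs of points lie in three pairwise disjoint discs, then no nonzero functional kills
the three quadratic forms with these zeros: by `hform_neg_of_harmonic` one of the two points
attached to the functional would lie in two of the discs. -/
theorem det_ofRoots_ne_zero {m : Fin 3 → Matrix (Fin 2) (Fin 2) ℂ}
    (hm : ∀ i j, i ≠ j → ∀ x y, hform (m i) x y < 0 → 0 ≤ hform (m j) x y)
    {x y x' y' : Fin 3 → ℂ} (h : ∀ i, hform (m i) (x i) (y i) < 0)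
    (h' : ∀ i, hform (m i) (x' i) (y' i) < 0) :
    det (ofRoots (x 0) (y 0) (x' 0) (y' 0)) (ofRoots (x 1) (y 1) (x' 1) (y' 1))
      (ofRoots (x 2) (y 2) (x' 2) (y' 2)) ≠ 0 := by
  intro h0
  set P : Fin 3 → BinQuad := fun i => ofRoots (x i) (y i) (x' i) (y' i) with hP
  have hdet : (!![(P 0).c, (P 1).c, (P 2).c; (P 0).b, (P 1).b, (P 2).b;
      (P 0).a, (P 1).a, (P 2).a] : Matrix (Fin 3) (Fin 3) ℂ).det = 0 := by
    rw [Matrix.det_fin_three, ← h0]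
    simp [det, hP]
    ring
  obtain ⟨v, hv, hv0⟩ := Matrix.exists_vecMul_eq_zero_iff.mpr hdet
  have hne : v 0 ≠ 0 ∨ v 1 ≠ 0 ∨ v 2 ≠ 0 := by
    by_contra! hcon
    exact hv (funext fun i => by fin_cases i <;> simp [hcon])
  obtain ⟨ξ₁, ξ₂, η₁, η₂, hξ, hη, H⟩ := exists_pair_of_functional hne
  have key : ∀ i, hform (m i) ξ₁ ξ₂ < 0 ∨ hform (m i) η₁ η₂ < 0 := by
    intro i
    refine hform_neg_of_harmonic (h i) (h' i) hξ hη (H _ _ _ _ ?_)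
    have := congrFun hv0 i
    simp only [Matrix.vecMul, dotProduct, Fin.sum_univ_three] at this
    fin_cases i <;> simpa [hP] using this
  have ex : ∀ i j, i ≠ j → ∀ x y, hform (m i) x y < 0 → ¬ hform (m j) x y < 0 :=
    fun i j hij x y hx => not_lt.mpr (hm i j hij x y hx)
  have e01 := ex 0 1 (by decide)
  have e02 := ex 0 2 (by decide)
  have e12 := ex 1 2 (by decide)
  rcases key 0 with k0 | k0 <;> rcases key 1 with k1 | k1 <;> rcases key 2 with k2 | k2
  · exact e01 _ _ k0 k1
  · exact e01 _ _ k0 k1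
  · exact e02 _ _ k0 k2
  · exact e12 _ _ k1 k2
  · exact e12 _ _ k1 k2
  · exact e02 _ _ k0 k2
  · exact e01 _ _ k0 k1
  · exact e01 _ _ k0 k1

/-- The bracket in the affine chart in which `[X : Y]` is the point at infinity and `a` is the
coordinate of `[e₁ + a X : e₂ + a Y]`. -/
theorem jac_chart {X Y e₁ e₂ : ℂ} (he : e₁ * Y - e₂ * X = 1) (a b a' b' : ℂ) :
    (jac (ofRoots (e₁ + a * X) (e₂ + a * Y) (e₁ + b * X) (e₂ + b * Y))
      (ofRoots (e₁ + a' * X) (e₂ + a' * Y) (e₁ + b' * X) (e₂ + b' * Y))).eval X Y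
      = a' + b' - (a + b) := by
  have : a' + b' - (a + b) = (e₁ * Y - e₂ * X) ^ 3 * (a' + b' - (a + b)) := by rw [he]; ring
  rw [this]
  simp only [jac, ofRoots, eval]
  ring

theorem det_chart {X Y e₁ e₂ : ℂ} (he : e₁ * Y - e₂ * X = 1) (a b a' b' a'' b'' : ℂ) :
    det (ofRoots (e₁ + a * X) (e₂ + a * Y) (e₁ + b * X) (e₂ + b * Y))
      (ofRoots (e₁ + a' * X) (e₂ + a' * Y) (e₁ + b' * X) (e₂ + b' * Y))
      (ofRoots (e₁ + a'' * X) (e₂ + a'' * Y) (e₁ + b'' * X) (e₂ + b'' * Y))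
      = a * b * ((a' + b') - (a'' + b'')) + a' * b' * ((a'' + b'') - (a + b))
        + a'' * b'' * ((a + b) - (a' + b')) := by
  have : a * b * ((a' + b') - (a'' + b'')) + a' * b' * ((a'' + b'') - (a + b))
        + a'' * b'' * ((a + b) - (a' + b')) = (e₁ * Y - e₂ * X) ^ 3 *
        (a * b * ((a' + b') - (a'' + b'')) + a' * b' * ((a'' + b'') - (a + b))
        + a'' * b'' * ((a + b) - (a' + b'))) := by rw [he]; ring
  rw [this]
  simp only [det, ofRoots]
  ring

theorem eval_chart {X Y e₁ e₂ : ℂ} (he : e₁ * Y - e₂ * X = 1) (a b : ℂ) :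
    (ofRoots (e₁ + a * X) (e₂ + a * Y) (e₁ + b * X) (e₂ + b * Y)).eval X Y = 1 := by
  rw [eval_ofRoots, show (e₁ + a * X) * Y - X * (e₂ + a * Y) = 1 by linear_combination he,
    show (e₁ + b * X) * Y - X * (e₂ + b * Y) = 1 by linear_combination he, one_mul]

/-- The quotient `f / H` does not take values in `(-∞, 0]` outside the discs. In the chart with the
given point at infinity, let `mᵢ ± dᵢ` be the pairs of roots. If `f / H = -l` with `l ≥ 0`, then the
determinant of the forms with roots `mᵢ ± (1 + l)^(-1/2) dᵢ` vanishes, although these roots lie in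
the same (convex) discs. -/
theorem ratio_chart_mem_slitPlane {m : Fin 3 → Matrix (Fin 2) (Fin 2) ℂ}
    (hm : ∀ i j, i ≠ j → ∀ x y, hform (m i) x y < 0 → 0 ≤ hform (m j) x y)
    {X Y e₁ e₂ : ℂ} (he : e₁ * Y - e₂ * X = 1) (hX : ∀ i, 0 ≤ hform (m i) X Y) {a b : Fin 3 → ℂ}
    (ha : ∀ i, hform (m i) (e₁ + a i * X) (e₂ + a i * Y) < 0)
    (hb : ∀ i, hform (m i) (e₁ + b i * X) (e₂ + b i * Y) < 0) :
    (∀ i j, i ≠ j → a i + b i - (a j + b j) ≠ 0) ∧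
    4 * (a 0 * b 0 * ((a 1 + b 1) - (a 2 + b 2)) + a 1 * b 1 * ((a 2 + b 2) - (a 0 + b 0))
        + a 2 * b 2 * ((a 0 + b 0) - (a 1 + b 1))) /
      ((a 2 + b 2 - (a 1 + b 1)) * (a 0 + b 0 - (a 2 + b 2)) * (a 1 + b 1 - (a 0 + b 0)))
      ∈ Complex.slitPlane := by
  have comb : ∀ (s : ℝ), 0 ≤ s → s ≤ 1 → ∀ i,
      hform (m i) (e₁ + (s * a i + (1 - s) * b i) * X) (e₂ + (s * a i + (1 - s) * b i) * Y) < 0 := by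
    intro s h0 h1 i
    have := hform_neg_of_convex_comb (s := s) h0 h1 (ha i) (hb i) (by
      rw [show e₁ + a i * X - (e₁ + b i * X) = (a i - b i) * X by ring,
        show e₂ + a i * Y - (e₂ + b i * Y) = (a i - b i) * Y by ring, hform_smul]
      exact mul_nonneg (sq_nonneg _) (hX i))
    rw [show (s : ℂ) * (e₁ + a i * X) + (1 - s) * (e₁ + b i * X)
        = e₁ + (s * a i + (1 - s) * b i) * X by ring,
      show (s : ℂ) * (e₂ + a i * Y) + (1 - s) * (e₂ + b i * Y)
        = e₂ + (s * a i + (1 - s) * b i) * Y by ring] at this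
    exact this
  have hne : ∀ i j, i ≠ j → a i + b i - (a j + b j) ≠ 0 := by
    intro i j hij h0
    have hi := comb (1 / 2) (by norm_num) (by norm_num) i
    have hj := comb (1 / 2) (by norm_num) (by norm_num) j
    have : ((1 / 2 : ℝ) : ℂ) * a i + (1 - ((1 / 2 : ℝ) : ℂ)) * b i
        = ((1 / 2 : ℝ) : ℂ) * a j + (1 - ((1 / 2 : ℝ) : ℂ)) * b j := by
      push_cast; linear_combination h0 / 2
    rw [this] at hi
    exact absurd (hm i j hij _ _ hi) (not_le.mpr hj)
  refine ⟨hne, ?_⟩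
  have h21 := hne 2 1 (by decide)
  have h02 := hne 0 2 (by decide)
  have h10 := hne 1 0 (by decide)
  rw [Complex.mem_slitPlane_iff]
  by_contra! hcon
  obtain ⟨hre, him⟩ := hcon
  set ρ := 4 * (a 0 * b 0 * ((a 1 + b 1) - (a 2 + b 2)) + a 1 * b 1 * ((a 2 + b 2) - (a 0 + b 0))
        + a 2 * b 2 * ((a 0 + b 0) - (a 1 + b 1))) /
      ((a 2 + b 2 - (a 1 + b 1)) * (a 0 + b 0 - (a 2 + b 2)) * (a 1 + b 1 - (a 0 + b 0))) with hρ
  obtain ⟨l, hl, hρl⟩ : ∃ l : ℝ, 0 ≤ l ∧ ρ = -(l : ℂ) :=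
    ⟨-ρ.re, by linarith, Complex.ext (by simp) (by simp [him])⟩
  set k : ℝ := Real.sqrt (1 / (1 + l)) with hk
  have hk0 : 0 ≤ k := Real.sqrt_nonneg _
  have hk2 : k ^ 2 * (1 + l) = 1 := by
    rw [hk, Real.sq_sqrt (by positivity)]; field_simp
  have hk1 : k ≤ 1 := by nlinarith
  have hk2' : (k : ℂ) ^ 2 * (1 + l) = 1 := by exact_mod_cast hk2
  have hD := det_ofRoots_ne_zero hm (comb ((1 + k) / 2) (by linarith) (by linarith))
    (comb ((1 - k) / 2) (by linarith) (by linarith))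
  apply hD
  rw [det_chart he]
  have hρ' : 4 * (a 0 * b 0 * ((a 1 + b 1) - (a 2 + b 2)) + a 1 * b 1 * ((a 2 + b 2) - (a 0 + b 0))
        + a 2 * b 2 * ((a 0 + b 0) - (a 1 + b 1))) + l *
      ((a 2 + b 2 - (a 1 + b 1)) * (a 0 + b 0 - (a 2 + b 2)) * (a 1 + b 1 - (a 0 + b 0))) = 0 := by
    rw [hρ, div_eq_iff (mul_ne_zero (mul_ne_zero h21 h02) h10)] at hρl
    linear_combination hρl
  push_cast
  linear_combination (k : ℂ) ^ 2 / 4 * hρ' - (1 / 4) * hk2' *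
      ((a 2 + b 2 - (a 1 + b 1)) * (a 0 + b 0 - (a 2 + b 2)) * (a 1 + b 1 - (a 0 + b 0)))

/-- Three forms whose zeros lie in three pairwise disjoint discs: at a point outside the discs the
brackets do not vanish and `f / H` is not in `(-∞, 0]`. -/
theorem ratio_mem_slitPlane {m : Fin 3 → Matrix (Fin 2) (Fin 2) ℂ}
    (hm : ∀ i j, i ≠ j → ∀ x y, hform (m i) x y < 0 → 0 ≤ hform (m j) x y)
    {x y x' y' : Fin 3 → ℂ} (h : ∀ i, hform (m i) (x i) (y i) < 0)
    (h' : ∀ i, hform (m i) (x' i) (y' i) < 0) {X Y : ℂ} (hXY : X ≠ 0 ∨ Y ≠ 0)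
    (hX : ∀ i, 0 ≤ hform (m i) X Y) {P : Fin 3 → BinQuad} {k : Fin 3 → ℂ} (hk : ∀ i, k i ≠ 0)
    (hP : ∀ i, P i = scale (k i) (ofRoots (x i) (y i) (x' i) (y' i))) :
    (∀ i, (P i).eval X Y ≠ 0) ∧ (jac (P 1) (P 2)).eval X Y ≠ 0 ∧ (jac (P 2) (P 0)).eval X Y ≠ 0 ∧
      (jac (P 0) (P 1)).eval X Y ≠ 0 ∧ det (P 0) (P 1) (P 2) ≠ 0 ∧
      ratio (P 0) (P 1) (P 2) X Y ∈ Complex.slitPlane := by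
  obtain ⟨e₁, e₂, he⟩ : ∃ e₁ e₂ : ℂ, e₁ * Y - e₂ * X = 1 := by
    rcases hXY with hX0 | hY0
    · exact ⟨0, -1 / X, by field_simp; ring⟩
    · exact ⟨1 / Y, 0, by field_simp; ring⟩
  have chart : ∀ i (x y : ℂ), hform (m i) x y < 0 → ∃ l a : ℂ, l ≠ 0 ∧
      x = l * (e₁ + a * X) ∧ y = l * (e₂ + a * Y) ∧ hform (m i) (e₁ + a * X) (e₂ + a * Y) < 0 := by
    intro i x y hxy
    obtain ⟨c, hcd⟩ : ∃ c, c = x * Y - X * y := ⟨_, rfl⟩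
    have hc : c ≠ 0 := hcd ▸ cross_ne_zero_of_hform hxy (hX i) hXY
    obtain ⟨a, ha1, ha2⟩ := exists_smul_of_cross_eq_zero
      (x := x / c - e₁) (y := y / c - e₂) (x' := X) (y' := Y)
      (by field_simp; linear_combination -c * he - hcd) hXY
    have hx : x = c * (e₁ + a * X) := by
      rw [← ha1]; field_simp; ring
    have hy : y = c * (e₂ + a * Y) := by
      rw [← ha2]; field_simp; ring
    refine ⟨c, a, hc, hx, hy, ?_⟩
    have h1 : hform (m i) x y = ‖c‖ ^ 2 * hform (m i) (e₁ + a * X) (e₂ + a * Y) := by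
      rw [← hform_smul, ← hx, ← hy]
    by_contra! h2
    exact absurd (mul_nonneg (sq_nonneg ‖c‖) h2) (not_le.mpr (h1 ▸ hxy))
  choose l a hl hxa hya hna using fun i => chart i _ _ (h i)
  choose l' b hl' hxb hyb hnb using fun i => chart i _ _ (h' i)
  have hP' : ∀ i, P i = scale (k i * (l i * l' i)) (ofRoots (e₁ + a i * X) (e₂ + a i * Y)
      (e₁ + b i * X) (e₂ + b i * Y)) := by
    intro i
    have := scale_ofRoots (l i) (l' i) (e₁ + a i * X) (e₂ + a i * Y) (e₁ + b i * X) (e₂ + b i * Y)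
    rw [← hxa i, ← hya i, ← hxb i, ← hyb i] at this
    rw [hP i, ← this]
    ext <;> simp only [scale] <;> ring
  have hc : ∀ i, k i * (l i * l' i) ≠ 0 := fun i =>
    mul_ne_zero (hk i) (mul_ne_zero (hl i) (hl' i))
  obtain ⟨hne, hs⟩ := ratio_chart_mem_slitPlane hm he hX hna hnb
  have hd := det_ofRoots_ne_zero hm hna hnb
  have hev : ∀ i, (P i).eval X Y = k i * (l i * l' i) := fun i => by
    rw [hP' i, eval_scale, eval_chart he, mul_one]
  have hjac : ∀ i j, (jac (P i) (P j)).eval X Y = k i * (l i * l' i) * (k j * (l j * l' j)) *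
      (a j + b j - (a i + b i)) := fun i j => by
    rw [hP' i, hP' j, jac_scale, eval_scale, jac_chart he]
  have hj0 : ∀ i j, i ≠ j → (jac (P i) (P j)).eval X Y ≠ 0 := fun i j hij => by
    rw [hjac]; exact mul_ne_zero (mul_ne_zero (hc _) (hc _)) (hne j i hij.symm)
  refine ⟨fun i => hev i ▸ hc i, hj0 _ _ (by decide), hj0 _ _ (by decide), hj0 _ _ (by decide),
    ?_, ?_⟩
  · rw [hP' 0, hP' 1, hP' 2, det_scale]
    exact mul_ne_zero (mul_ne_zero (mul_ne_zero (hc _) (hc _)) (hc _))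
      hd
  · rw [hP' 0, hP' 1, hP' 2, ratio_scale (hc 0) (hc 1) (hc 2), ratio]
    simp only [eval_chart he, jac_chart he, det_chart he, mul_one]
    exact hs

end BinQuad

/-! ### Circle integrals depending on a parameter -/

open Metric MeasureTheory in
/-- A circle integral that depends holomorphically on a parameter is differentiated under the
integral sign. The dominating constant comes from the Cauchy estimate. -/
theorem hasDerivAt_circleIntegral {F : ℂ → ℂ → ℂ} {U : Set ℂ} (hU : IsOpen U) {c : ℂ} {R : ℝ}
    (hR : 0 ≤ R) (hc : ContinuousOn (Function.uncurry F) (U ×ˢ sphere c R))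
    (hd : ∀ z ∈ sphere c R, DifferentiableOn ℂ (fun t => F t z) U) {t₀ : ℂ} (ht₀ : t₀ ∈ U) :
    HasDerivAt (fun t => ∮ z in C(c, R), F t z)
      (∮ z in C(c, R), deriv (fun t => F t z) t₀) t₀ := by
  obtain ⟨ε, hε, hεU⟩ : ∃ ε > 0, closedBall t₀ (2 * ε) ⊆ U := by
    obtain ⟨δ, hδ, h⟩ := Metric.nhds_basis_closedBall.mem_iff.mp (hU.mem_nhds ht₀)
    exact ⟨δ / 2, by positivity, by rwa [mul_div_cancel₀ _ two_ne_zero]⟩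
  have hmem : ∀ θ, circleMap c R θ ∈ sphere c R := fun θ => circleMap_mem_sphere c hR θ
  set G : ℂ → ℝ → ℂ := fun t θ => deriv (circleMap c R) θ • F t (circleMap c R θ) with hG
  have hcont : ∀ t ∈ U, Continuous (G t) := by
    intro t ht
    have h1 : Continuous fun θ => F t (circleMap c R θ) :=
      hc.comp_continuous (f := fun θ : ℝ => (t, circleMap c R θ)) (by fun_prop)
        fun θ => ⟨ht, hmem θ⟩
    have h2 : Continuous (deriv (circleMap c R)) := by
      rw [show deriv (circleMap c R) = fun θ => circleMap 0 R θ * Complex.I from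
        funext fun θ => deriv_circleMap c R θ]
      fun_prop
    exact h2.smul h1
  obtain ⟨C, hC⟩ := ((isCompact_closedBall t₀ (2 * ε)).prod (isCompact_sphere c R)
    ).exists_bound_of_continuousOn (hc.mono (Set.prod_mono hεU subset_rfl))
  have hball : ∀ t ∈ ball t₀ ε, ∀ z ∈ sphere c R, ‖deriv (fun t => F t z) t‖ ≤ C / ε := by
    intro t ht z hz
    have hsub : closedBall t ε ⊆ closedBall t₀ (2 * ε) :=
      closedBall_subset_closedBall' (by rw [mem_ball] at ht; linarith)
    refine Complex.norm_deriv_le_of_forall_mem_sphere_norm_le hε ?_ fun w hw =>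
      hC (w, z) ⟨hsub (sphere_subset_closedBall hw), hz⟩
    refine ((hd z hz).mono ?_).diffContOnCl
    rw [closure_ball _ hε.ne']
    exact hsub.trans hεU
  have hballU : ball t₀ ε ⊆ U := (ball_subset_closedBall.trans
    (closedBall_subset_closedBall (by linarith))).trans hεU
  have hderiv : ∀ θ, ∀ t ∈ U, HasDerivAt (fun t => G t θ)
      (deriv (circleMap c R) θ • deriv (fun t => F t (circleMap c R θ)) t) t := fun θ t ht =>
    (((hd _ (hmem θ)).differentiableAt (hU.mem_nhds ht)).hasDerivAt).const_smul
      (deriv (circleMap c R) θ)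
  have key := intervalIntegral.hasDerivAt_integral_of_dominated_loc_of_deriv_le (μ := volume)
    (a := 0) (b := 2 * Real.pi) (F := G) (x₀ := t₀) (s := ball t₀ ε) (bound := fun _ => R * (C / ε))
    (F' := fun t θ => deriv (circleMap c R) θ • deriv (fun t => F t (circleMap c R θ)) t)
    (ball_mem_nhds _ hε) ?_ ((hcont t₀ ht₀).intervalIntegrable _ _) ?_ ?_
    intervalIntegrable_const ?_
  · exact key.2
  · filter_upwards [hU.mem_nhds ht₀] with t ht
    exact (hcont t ht).aestronglyMeasurable
  -- The derivative is measurable as a limit of difference quotients.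
  · set u : ℕ → ℂ := fun n => t₀ + ε * (1 / ((n : ℂ) + 1)) with hu
    have hn1 : ∀ n : ℕ, (n : ℂ) + 1 ≠ 0 := fun n => Nat.cast_add_one_ne_zero n
    have hu0 : Filter.Tendsto u Filter.atTop (nhdsWithin t₀ {t₀}ᶜ) := by
      refine tendsto_nhdsWithin_iff.mpr ⟨?_, Filter.Eventually.of_forall fun n => ?_⟩
      · have := ((tendsto_one_div_add_atTop_nhds_zero_nat (𝕜 := ℂ)).const_mul (ε : ℂ)).const_add t₀
        simpa [hu] using this
      · simp [hu, hε.ne', hn1 n]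
    have huU : ∀ n, u n ∈ U := fun n => hεU <| by
      have h1 : ‖(n : ℂ) + 1‖ = n + 1 := by
        rw [← Nat.cast_succ, Complex.norm_natCast]; push_cast; rfl
      simp only [hu, mem_closedBall, dist_self_add_left, norm_mul, norm_div, norm_one, h1,
        Complex.norm_real, Real.norm_eq_abs, abs_of_pos hε]
      have : 1 / ((n : ℝ) + 1) ≤ 1 := by
        rw [div_le_one (by positivity)]; linarith [(Nat.cast_nonneg n : (0 : ℝ) ≤ n)]
      nlinarith
    refine aestronglyMeasurable_of_tendsto_ae Filter.atTop
      (f := fun n θ => (u n - t₀)⁻¹ • (G (u n) θ - G t₀ θ)) (fun n => ?_) ?_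
    · have hn : Continuous fun θ => (u n - t₀)⁻¹ • (G (u n) θ - G t₀ θ) :=
        ((hcont _ (huU n)).sub (hcont _ ht₀)).const_smul ((u n - t₀)⁻¹)
      exact hn.aestronglyMeasurable
    · refine Filter.Eventually.of_forall fun θ => ?_
      have := (hasDerivAt_iff_tendsto_slope.mp (hderiv θ t₀ ht₀)).comp hu0
      simpa [slope, Function.comp_def] using this
  · refine Filter.Eventually.of_forall fun θ _ t ht => ?_
    rw [norm_smul]
    refine mul_le_mul (by simp [deriv_circleMap, abs_of_nonneg hR])
      (hball t ht _ (hmem θ)) (norm_nonneg _) hR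
  · exact Filter.Eventually.of_forall fun θ _ t ht => hderiv θ t (hballU ht)

/-- A circle integral of a form pulled back by a map close to `z ↦ 2 z` is the integral of this
form over the doubled circle: the linear homotopy between the two maps changes the integrand by a
derivative. -/
theorem circleIntegral_comp_of_near_double {Φ φ : ℂ → ℂ} {ρ : ℝ} (hρ : 0 < ρ)
    (hΦ : DifferentiableOn ℂ Φ {w | ρ < ‖w‖ ∧ ‖w‖ < 3 * ρ}) {V : Set ℂ} (hV : IsOpen V)
    (hSV : Metric.sphere 0 ρ ⊆ V) (hφ : DifferentiableOn ℂ φ V)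
    (hnear : ∀ z ∈ Metric.sphere (0 : ℂ) ρ, ‖φ z - 2 * z‖ < ρ) :
    (∮ z in C(0, ρ), Φ (φ z) * deriv φ z) = ∮ z in C(0, 2 * ρ), Φ z := by
  set A : Set ℂ := {w | ρ < ‖w‖ ∧ ‖w‖ < 3 * ρ} with hA
  have hAo : IsOpen A :=
    (isOpen_lt continuous_const continuous_norm).inter (isOpen_lt continuous_norm continuous_const)
  obtain ⟨M, hM0, hMρ, hM⟩ : ∃ M : ℝ, 0 ≤ M ∧ M < ρ ∧
      ∀ z ∈ Metric.sphere (0 : ℂ) ρ, ‖φ z - 2 * z‖ ≤ M := by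
    have hcont : ContinuousOn (fun z => ‖φ z - 2 * z‖) (Metric.sphere (0 : ℂ) ρ) :=
      ((hφ.continuousOn.mono hSV).sub (by fun_prop)).norm
    obtain ⟨z, hz, hmax⟩ := (isCompact_sphere (0 : ℂ) ρ).exists_isMaxOn
      ⟨(ρ : ℂ), by simp [hρ.le]⟩ hcont
    exact ⟨_, norm_nonneg _, hnear z hz, fun w hw => hmax hw⟩
  set r : ℝ := 2 * ρ / (M + ρ) with hr
  have hr1 : 1 < r := by rw [hr, lt_div_iff₀ (by linarith)]; linarith
  have hrM : r * M < ρ := by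
    rw [hr, div_mul_eq_mul_div, div_lt_iff₀ (by linarith)]; nlinarith
  set h : ℂ → ℂ → ℂ := fun s z => 2 * z + s * (φ z - 2 * z) with hh
  have hmaps : ∀ s ∈ Metric.ball (0 : ℂ) r, ∀ z ∈ Metric.sphere (0 : ℂ) ρ, h s z ∈ A := by
    intro s hs z hz
    have hs' : ‖s‖ < r := by simpa using hs
    have hz' : ‖z‖ = ρ := by simpa using hz
    have h1 : ‖s * (φ z - 2 * z)‖ < ρ := by
      rw [norm_mul]
      nlinarith [hM z hz, norm_nonneg s, norm_nonneg (φ z - 2 * z)]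
    have h2 : ‖2 * z‖ = 2 * ρ := by simp [hz']
    have h3 := norm_add_le (2 * z) (s * (φ z - 2 * z))
    have h4 := norm_sub_le (h s z) (s * (φ z - 2 * z))
    have h5 : h s z - s * (φ z - 2 * z) = 2 * z := by simp only [hh]; ring
    rw [h5, h2] at h4
    rw [h2] at h3
    exact ⟨by linarith, by simp only [hh]; linarith⟩
  set F : ℂ → ℂ → ℂ := fun s z => Φ (h s z) * (2 + s * (deriv φ z - 2)) with hF
  have hφ' : ContinuousOn (deriv φ) V := (hφ.deriv hV).continuousOn
  have hFc : ContinuousOn (Function.uncurry F) (Metric.ball 0 r ×ˢ Metric.sphere 0 ρ) := by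
    have c1 : ContinuousOn (fun x : ℂ × ℂ => φ x.2) (Metric.ball 0 r ×ˢ Metric.sphere 0 ρ) :=
      hφ.continuousOn.comp continuousOn_snd fun x hx => hSV hx.2
    have c2 : ContinuousOn (fun x : ℂ × ℂ => deriv φ x.2)
        (Metric.ball 0 r ×ˢ Metric.sphere 0 ρ) :=
      hφ'.comp continuousOn_snd fun x hx => hSV hx.2
    refine ContinuousOn.mul (hΦ.continuousOn.comp (f := fun x : ℂ × ℂ => h x.1 x.2) ?_
      fun x hx => hmaps _ hx.1 _ hx.2) ?_
    · exact (continuousOn_const.mul continuousOn_snd).add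
        (continuousOn_fst.mul (c1.sub (continuousOn_const.mul continuousOn_snd)))
    · exact continuousOn_const.add (continuousOn_fst.mul (c2.sub continuousOn_const))
  have hFd : ∀ z ∈ Metric.sphere (0 : ℂ) ρ, ∀ s ∈ Metric.ball (0 : ℂ) r, HasDerivAt (fun s => F s z)
      (deriv Φ (h s z) * (φ z - 2 * z) * (2 + s * (deriv φ z - 2)) +
        Φ (h s z) * (deriv φ z - 2)) s := by
    intro z hz s hs
    have d1 : HasDerivAt (fun s => h s z) (φ z - 2 * z) s :=
      (((hasDerivAt_id s).mul_const (φ z - 2 * z)).const_add (2 * z)).congr_deriv (one_mul _)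
    have d2 : HasDerivAt Φ (deriv Φ (h s z)) (h s z) :=
      ((hΦ _ (hmaps s hs z hz)).differentiableAt (hAo.mem_nhds (hmaps s hs z hz))).hasDerivAt
    have d3 : HasDerivAt (fun s : ℂ => 2 + s * (deriv φ z - 2)) (deriv φ z - 2) s := by
      simpa using ((hasDerivAt_id s).mul_const (deriv φ z - 2)).const_add 2
    exact (d2.comp s d1).mul d3
  have hK : ∀ s ∈ Metric.ball (0 : ℂ) r,
      HasDerivAt (fun s => ∮ z in C(0, ρ), F s z) 0 s := by
    intro s hs
    have := hasDerivAt_circleIntegral Metric.isOpen_ball hρ.le hFc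
      (fun z hz s hs => (hFd z hz s hs).differentiableAt.differentiableWithinAt) hs
    convert this using 1
    symm
    refine circleIntegral.integral_eq_zero_of_hasDerivWithinAt' (f := fun z => Φ (h s z) *
      (φ z - 2 * z)) fun z hz => HasDerivAt.hasDerivWithinAt ?_
    rw [abs_of_pos hρ] at hz
    rw [(hFd z hz s hs).deriv]
    have d0 : HasDerivAt φ (deriv φ z) z :=
      ((hφ z (hSV hz)).differentiableAt (hV.mem_nhds (hSV hz))).hasDerivAt
    have d1 : HasDerivAt (fun z => φ z - 2 * z) (deriv φ z - 2) z :=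
      (d0.sub ((hasDerivAt_id z).const_mul 2)).congr_deriv (by ring)
    have d1' : HasDerivAt (fun z => h s z) (2 + s * (deriv φ z - 2)) z :=
      (((hasDerivAt_id z).const_mul 2).add (d1.const_mul s)).congr_deriv (by ring)
    have d2 : HasDerivAt Φ (deriv Φ (h s z)) (h s z) :=
      ((hΦ _ (hmaps s hs z hz)).differentiableAt (hAo.mem_nhds (hmaps s hs z hz))).hasDerivAt
    exact ((d2.comp z d1').mul d1).congr_deriv (by simp only [Function.comp_apply]; ring)
  have hconst := Metric.isOpen_ball.is_const_of_deriv_eq_zero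
    (convex_ball (0 : ℂ) r).isPreconnected
    (fun s hs => (hK s hs).differentiableAt.differentiableWithinAt)
    (fun s hs => (hK s hs).deriv) (x := 0) (y := 1) (by simp; linarith) (by simpa using hr1)
  have e1 : (∮ z in C(0, ρ), F 1 z) = ∮ z in C(0, ρ), Φ (φ z) * deriv φ z := by
    simp only [hF, hh]
    congr 1
    funext z
    ring_nf
  have e0 : (∮ z in C(0, ρ), F 0 z) = ∮ z in C(0, 2 * ρ), Φ z := by
    simp only [circleIntegral, hF, hh]
    congr 1
    funext θ
    simp only [deriv_circleMap, circleMap, smul_eq_mul]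
    push_cast
    ring_nf
  rw [← e1, ← e0]
  exact hconst.symm

/-! ### Branches of square roots -/

/-- The principal branch of the complex square root. -/
def csqrt (z : ℂ) : ℂ := z ^ (2⁻¹ : ℂ)

theorem csqrt_sq (z : ℂ) : csqrt z ^ 2 = z := by
  exact Complex.cpow_nat_inv_pow z two_ne_zero

theorem csqrt_one : csqrt 1 = 1 := by simp [csqrt]

theorem csqrt_sq_of_re_pos {z : ℂ} (h : 0 < z.re) : csqrt (z ^ 2) = z :=
  Complex.sq_cpow_two_inv h

theorem csqrt_ne_zero {z : ℂ} (h : z ≠ 0) : csqrt z ≠ 0 := fun h0 =>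
  h (by rw [← csqrt_sq z, h0]; simp)

theorem differentiableAt_csqrt {z : ℂ} (h : z ∈ Complex.slitPlane) :
    DifferentiableAt ℂ csqrt z := by
  unfold csqrt
  exact differentiableAt_id.cpow (differentiableAt_const _) h

theorem one_sub_div_mem_slitPlane {w z : ℂ} (h : ‖w‖ < ‖z‖) :
    1 - w / z ∈ Complex.slitPlane := by
  left
  have h1 : ‖w / z‖ < 1 := by
    rw [norm_div, div_lt_one ((norm_nonneg w).trans_lt h)]; exact h
  have h2 := Complex.re_le_norm (w / z)
  simp only [Complex.sub_re, Complex.one_re]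
  linarith

theorem differentiableAt_div {f g : ℂ × ℂ → ℂ} {x : ℂ × ℂ} (hf : DifferentiableAt ℂ f x)
    (hg : DifferentiableAt ℂ g x) (h : g x ≠ 0) : DifferentiableAt ℂ (fun x => f x / g x) x := by
  simp only [div_eq_mul_inv]
  exact hf.mul (hg.inv h)

/-- The branch of `√((z - w₁) (z - w₂))` for `|z| > |w₁|, |w₂|` that is asymptotic to `z`. -/
def rootBranch (w₁ w₂ z : ℂ) : ℂ := z * (csqrt (1 - w₁ / z) * csqrt (1 - w₂ / z))

theorem rootBranch_sq {w₁ w₂ z : ℂ} (hz : z ≠ 0) :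
    rootBranch w₁ w₂ z ^ 2 = (z - w₁) * (z - w₂) := by
  rw [rootBranch, mul_pow, mul_pow, csqrt_sq, csqrt_sq]
  field_simp

theorem rootBranch_zero_zero (z : ℂ) : rootBranch 0 0 z = z := by
  simp [rootBranch, csqrt_one]

theorem rootBranch_ne_zero {w₁ w₂ z : ℂ} (h₁ : ‖w₁‖ < ‖z‖) (h₂ : ‖w₂‖ < ‖z‖) :
    rootBranch w₁ w₂ z ≠ 0 := by
  have hz : z ≠ 0 := norm_pos_iff.mp ((norm_nonneg w₁).trans_lt h₁)
  exact mul_ne_zero hz (mul_ne_zero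
    (csqrt_ne_zero (Complex.slitPlane_ne_zero (one_sub_div_mem_slitPlane h₁)))
    (csqrt_ne_zero (Complex.slitPlane_ne_zero (one_sub_div_mem_slitPlane h₂))))

theorem differentiableAt_rootBranch {w₁ w₂ : ℂ} {x : ℂ × ℂ} (h₁ : ‖x.1 * w₁‖ < ‖x.2‖)
    (h₂ : ‖x.1 * w₂‖ < ‖x.2‖) :
    DifferentiableAt ℂ (fun x : ℂ × ℂ => rootBranch (x.1 * w₁) (x.1 * w₂) x.2) x := by
  have hz : x.2 ≠ 0 := norm_pos_iff.mp ((norm_nonneg _).trans_lt h₁)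
  have key : ∀ w : ℂ, ‖x.1 * w‖ < ‖x.2‖ →
      DifferentiableAt ℂ (fun x : ℂ × ℂ => csqrt (1 - x.1 * w / x.2)) x := by
    intro w hw
    have hd : DifferentiableAt ℂ (fun x : ℂ × ℂ => 1 - x.1 * w / x.2) x :=
      (differentiableAt_div (differentiableAt_fst.mul_const w) differentiableAt_snd hz).const_sub 1
    exact (differentiableAt_csqrt (one_sub_div_mem_slitPlane hw)).comp x hd
  exact differentiableAt_snd.mul ((key w₁ h₁).mul (key w₂ h₂))

namespace BinQuad

theorem differentiableAt_ratio (w₁ w₂ : ℂ) (q r : BinQuad) {x : ℂ × ℂ}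
    (h₁ : (jac q r).eval x.2 1 ≠ 0)
    (h₂ : (jac r (ofRoots (x.1 * w₁) 1 (x.1 * w₂) 1)).eval x.2 1 ≠ 0)
    (h₃ : (jac (ofRoots (x.1 * w₁) 1 (x.1 * w₂) 1) q).eval x.2 1 ≠ 0) :
    DifferentiableAt ℂ
      (fun x : ℂ × ℂ => ratio (ofRoots (x.1 * w₁) 1 (x.1 * w₂) 1) q r x.2 1) x := by
  have h : (fun x : ℂ × ℂ => (jac q r).eval x.2 1 *
      (jac r (ofRoots (x.1 * w₁) 1 (x.1 * w₂) 1)).eval x.2 1 *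
      (jac (ofRoots (x.1 * w₁) 1 (x.1 * w₂) 1) q).eval x.2 1) x ≠ 0 :=
    mul_ne_zero (mul_ne_zero h₁ h₂) h₃
  unfold ratio
  refine differentiableAt_div ?_ ?_ h
  · simp only [det, eval, ofRoots]; fun_prop
  · simp only [jac, eval, ofRoots]; fun_prop

/-! ### The algebraic correspondence

In coordinates in which `q` and `r` are even, a point `[x : y]` together with values `s`, `n` of
`√(p (x, y))` and `√(p (-x, y))` is sent to `[x (n + s) : y (n - s)]`. -/

theorem jac_diag_eval {A B C a₂ c₂ a₃ c₃ x y s n : ℂ}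
    (hs : s ^ 2 = A * x ^ 2 + B * (x * y) + C * y ^ 2)
    (hn : n ^ 2 = A * x ^ 2 - B * (x * y) + C * y ^ 2) :
    (jac ⟨a₂, 0, c₂⟩ ⟨a₃, 0, c₃⟩).eval (x * (n + s)) (y * (n - s)) *
      (jac ⟨a₃, 0, c₃⟩ ⟨A, B, C⟩).eval (x * (n + s)) (y * (n - s)) *
      (jac ⟨A, B, C⟩ ⟨a₂, 0, c₂⟩).eval (x * (n + s)) (y * (n - s))
    = 4 * det ⟨A, B, C⟩ ⟨a₂, 0, c₂⟩ ⟨a₃, 0, c₃⟩ *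
      ((2 * B * (x * y) * (A * x ^ 2 - C * y ^ 2 + s * n)) ^ 2 *
        (eval ⟨a₂, 0, c₂⟩ x y * eval ⟨a₃, 0, c₃⟩ x y)) := by
  set E := A * x ^ 2 - C * y ^ 2 + s * n with hE
  have e1 : (jac ⟨a₂, 0, c₂⟩ ⟨a₃, 0, c₃⟩).eval (x * (n + s)) (y * (n - s))
      = 2 * (a₂ * c₃ - a₃ * c₂) * (-2 * B * (x * y) ^ 2) := by
    simp only [jac, eval]
    linear_combination 2 * (a₂ * c₃ - a₃ * c₂) * (x * y) * (hn - hs)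
  have e2 : (jac ⟨a₃, 0, c₃⟩ ⟨A, B, C⟩).eval (x * (n + s)) (y * (n - s))
      = 2 * B * E * eval ⟨a₃, 0, c₃⟩ x y := by
    simp only [jac, eval, hE]
    linear_combination (a₃ * B * x ^ 2 - B * c₃ * y ^ 2) * (hn + hs)
      + 2 * (a₃ * C - A * c₃) * (x * y) * (hn - hs)
  have e3 : (jac ⟨A, B, C⟩ ⟨a₂, 0, c₂⟩).eval (x * (n + s)) (y * (n - s))
      = -(2 * B * E * eval ⟨a₂, 0, c₂⟩ x y) := by
    simp only [jac, eval, hE]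
    linear_combination -(a₂ * B * x ^ 2 - B * c₂ * y ^ 2) * (hn + hs)
      - 2 * (a₂ * C - A * c₂) * (x * y) * (hn - hs)
  rw [e1, e2, e3]
  simp only [det]
  ring


/-- The coordinates of `p` in the basis `β², α β, α²`, where `α = ν x + y` and `β = μ x + y`. -/
def diag (μ ν : ℂ) (p : BinQuad) : BinQuad :=
  ⟨(p.a - p.b * ν + p.c * ν ^ 2) / (μ - ν) ^ 2,
    -(2 * p.a - p.b * (μ + ν) + 2 * p.c * (μ * ν)) / (μ - ν) ^ 2,
    (p.a - p.b * μ + p.c * μ ^ 2) / (μ - ν) ^ 2⟩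

theorem diag_comp {μ ν : ℂ} (h : μ - ν ≠ 0) (p : BinQuad) :
    (diag μ ν p).comp !![μ, 1; ν, 1] = p := by
  ext <;> simp [comp, diag] <;> field_simp <;> ring

theorem diag_eval {μ ν : ℂ} (h : μ - ν ≠ 0) (p : BinQuad) (z : ℂ) :
    (diag μ ν p).eval (μ * z + 1) (ν * z + 1) = p.eval z 1 := by
  conv_rhs => rw [← diag_comp h p]
  simp [eval_comp]

/-- The value of `p` at the partner of `[x : y]` under the involution with fixed points
`[1 : -μ]` and `[1 : -ν]`. -/
def partner (μ ν : ℂ) (p : BinQuad) (z : ℂ) : ℂ :=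
  (diag μ ν p).a * (μ * z + 1) ^ 2 - (diag μ ν p).b * ((μ * z + 1) * (ν * z + 1))
    + (diag μ ν p).c * (ν * z + 1) ^ 2

/-- The denominator of `corr`. -/
def corrDen (μ ν s n z : ℂ) : ℂ := μ * ((ν * z + 1) * (n - s)) - ν * ((μ * z + 1) * (n + s))

/-- The point `Z` that corresponds to a point `z` with values `s` and `n` of `√p` at `z` and at its
partner: `β(Z) : α(Z) = β(z) (n + s) : α(z) (n - s)`. -/
def corr (μ ν s n z : ℂ) : ℂ :=
  ((μ * z + 1) * (n + s) - (ν * z + 1) * (n - s)) / corrDen μ ν s n z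

/-- The factor `-2 B (μ - ν)³ α β (A β² - C α² + s n)` that compares `√f` at `z` with `√H` at the
corresponding point. -/
def corrFactor (μ ν : ℂ) (p : BinQuad) (s n z : ℂ) : ℂ :=
  -2 * (diag μ ν p).b * (μ - ν) ^ 3 * ((μ * z + 1) * (ν * z + 1)) *
    ((diag μ ν p).a * (μ * z + 1) ^ 2 - (diag μ ν p).c * (ν * z + 1) ^ 2 + s * n)

theorem corr_alpha {μ ν s n z : ℂ} (h : corrDen μ ν s n z ≠ 0) :
    ν * corr μ ν s n z + 1 = (μ - ν) / corrDen μ ν s n z * ((ν * z + 1) * (n - s)) := by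
  rw [corr]; field_simp; simp only [corrDen]; ring

theorem corr_beta {μ ν s n z : ℂ} (h : corrDen μ ν s n z ≠ 0) :
    μ * corr μ ν s n z + 1 = (μ - ν) / corrDen μ ν s n z * ((μ * z + 1) * (n + s)) := by
  rw [corr]; field_simp; simp only [corrDen]; ring

/-- The correspondence takes the square root of `H` at the image point to `√f` at the given point, up
to an explicit factor. -/
theorem jac_corr {μ ν : ℂ} (hW : μ - ν ≠ 0) {p q r : BinQuad} (hq : (diag μ ν q).b = 0)
    (hr : (diag μ ν r).b = 0) {z s n : ℂ} (hs : s ^ 2 = p.eval z 1) (hn : n ^ 2 = partner μ ν p z)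
    (hd : corrDen μ ν s n z ≠ 0) :
    ((jac q r).eval (corr μ ν s n z) 1 * (jac r p).eval (corr μ ν s n z) 1 *
      (jac p q).eval (corr μ ν s n z) 1) * corrDen μ ν s n z ^ 6
    = 4 * det p q r * (corrFactor μ ν p s n z ^ 2 * (q.eval z 1 * r.eval z 1)) := by
  have hjac : ∀ p q : BinQuad, (jac p q).eval (corr μ ν s n z) 1 * corrDen μ ν s n z ^ 2
      = (μ - ν) ^ 3 * (jac (diag μ ν p) (diag μ ν q)).eval ((μ * z + 1) * (n + s))
        ((ν * z + 1) * (n - s)) := by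
    intro p q
    conv_lhs => rw [← diag_comp hW p, ← diag_comp hW q, jac_comp, eval_scale, eval_comp]
    simp only [Matrix.of_apply, Matrix.cons_val, mul_one, one_mul]
    rw [corr_alpha hd, corr_beta hd, eval_smul_smul]
    field_simp
  have hdet : det p q r = (μ - ν) ^ 3 * det (diag μ ν p) (diag μ ν q) (diag μ ν r) := by
    conv_lhs => rw [← diag_comp hW p, ← diag_comp hW q, ← diag_comp hW r, det_comp]
    simp
  have hs' : s ^ 2 = (diag μ ν p).a * (μ * z + 1) ^ 2 + (diag μ ν p).b * ((μ * z + 1) * (ν * z + 1))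
    + (diag μ ν p).c * (ν * z + 1) ^ 2 := by rw [hs, ← diag_eval hW]; rfl
  have key := jac_diag_eval (a₂ := (diag μ ν q).a) (c₂ := (diag μ ν q).c) (a₃ := (diag μ ν r).a)
    (c₃ := (diag μ ν r).c) hs' hn
  have eq2 : diag μ ν q = ⟨(diag μ ν q).a, 0, (diag μ ν q).c⟩ := by ext <;> simp [hq]
  have er : diag μ ν r = ⟨(diag μ ν r).a, 0, (diag μ ν r).c⟩ := by ext <;> simp [hr]
  have ep : diag μ ν p = ⟨(diag μ ν p).a, (diag μ ν p).b, (diag μ ν p).c⟩ := rfl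
  rw [← eq2, ← er, ← ep, diag_eval hW, diag_eval hW] at key
  calc _ = ((jac q r).eval (corr μ ν s n z) 1 * corrDen μ ν s n z ^ 2) *
        ((jac r p).eval (corr μ ν s n z) 1 * corrDen μ ν s n z ^ 2) *
        ((jac p q).eval (corr μ ν s n z) 1 * corrDen μ ν s n z ^ 2) := by ring
    _ = (μ - ν) ^ 9 * ((jac (diag μ ν q) (diag μ ν r)).eval ((μ * z + 1) * (n + s))
        ((ν * z + 1) * (n - s)) * (jac (diag μ ν r) (diag μ ν p)).eval ((μ * z + 1) * (n + s))
        ((ν * z + 1) * (n - s)) * (jac (diag μ ν p) (diag μ ν q)).eval ((μ * z + 1) * (n + s))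
        ((ν * z + 1) * (n - s))) := by rw [hjac, hjac, hjac]; ring
    _ = _ := by rw [key, hdet, corrFactor]; ring

/-- The derivative of `corr` along branches `s`, `n` of the two square roots. -/
theorem hasDerivAt_corr {μ ν : ℂ} (hW : μ - ν ≠ 0) {p : BinQuad} {s n : ℂ → ℂ} {z : ℂ}
    (hsd : DifferentiableAt ℂ s z) (hnd : DifferentiableAt ℂ n z)
    (hs : ∀ᶠ w in nhds z, s w ^ 2 = p.eval w 1) (hn : ∀ᶠ w in nhds z, n w ^ 2 = partner μ ν p w)
    (hd : corrDen μ ν (s z) (n z) z ≠ 0) (hs0 : s z ≠ 0) (hn0 : n z ≠ 0) :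
    HasDerivAt (fun w => corr μ ν (s w) (n w) w)
      (corrFactor μ ν p (s z) (n z) z /
        ((μ - ν) * (s z * n z) * corrDen μ ν (s z) (n z) z ^ 2)) z := by
  obtain ⟨s', hs'⟩ : ∃ s', HasDerivAt s s' z := ⟨_, hsd.hasDerivAt⟩
  obtain ⟨n', hn'⟩ : ∃ n', HasDerivAt n n' z := ⟨_, hnd.hasDerivAt⟩
  have dα : HasDerivAt (fun w : ℂ => ν * w + 1) ν z :=
    (((hasDerivAt_id z).const_mul ν).add_const 1).congr_deriv (mul_one ν)
  have dβ : HasDerivAt (fun w : ℂ => μ * w + 1) μ z :=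
    (((hasDerivAt_id z).const_mul μ).add_const 1).congr_deriv (mul_one μ)
  set A := (diag μ ν p).a with hA
  set B := (diag μ ν p).b with hB
  set C := (diag μ ν p).c with hC
  have es : 2 * s z * s' = A * (2 * (μ * z + 1) * μ) + B * (μ * (ν * z + 1) + (μ * z + 1) * ν)
      + C * (2 * (ν * z + 1) * ν) := by
    have h1 : HasDerivAt (fun w => s w ^ 2) (2 * s z * s') z :=
      (hs'.pow 2).congr_deriv (by simp)
    have h2 : HasDerivAt (fun w => A * (μ * w + 1) ^ 2 + B * ((μ * w + 1) * (ν * w + 1))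
        + C * (ν * w + 1) ^ 2) (A * (2 * (μ * z + 1) * μ) +
        B * (μ * (ν * z + 1) + (μ * z + 1) * ν) + C * (2 * (ν * z + 1) * ν)) z :=
      ((((dβ.pow 2).const_mul A).add ((dβ.mul dα).const_mul B)).add
        ((dα.pow 2).const_mul C)).congr_deriv (by simp)
    refine h1.unique (h2.congr_of_eventuallyEq ?_)
    filter_upwards [hs] with w hw
    rw [hw, ← diag_eval hW]; rfl
  have en : 2 * n z * n' = A * (2 * (μ * z + 1) * μ) - B * (μ * (ν * z + 1) + (μ * z + 1) * ν)
      + C * (2 * (ν * z + 1) * ν) := by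
    have h1 : HasDerivAt (fun w => n w ^ 2) (2 * n z * n') z :=
      (hn'.pow 2).congr_deriv (by simp)
    have h2 : HasDerivAt (fun w => A * (μ * w + 1) ^ 2 - B * ((μ * w + 1) * (ν * w + 1))
        + C * (ν * w + 1) ^ 2) (A * (2 * (μ * z + 1) * μ) -
        B * (μ * (ν * z + 1) + (μ * z + 1) * ν) + C * (2 * (ν * z + 1) * ν)) z :=
      ((((dβ.pow 2).const_mul A).sub ((dβ.mul dα).const_mul B)).add
        ((dα.pow 2).const_mul C)).congr_deriv (by simp)
    refine h1.unique (h2.congr_of_eventuallyEq ?_)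
    filter_upwards [hn] with w hw
    rw [hw]; rfl
  have hs2 : s z ^ 2 = A * (μ * z + 1) ^ 2 + B * ((μ * z + 1) * (ν * z + 1))
      + C * (ν * z + 1) ^ 2 := by rw [hs.self_of_nhds, ← diag_eval hW]; rfl
  have hn2 : n z ^ 2 = A * (μ * z + 1) ^ 2 - B * ((μ * z + 1) * (ν * z + 1))
      + C * (ν * z + 1) ^ 2 := hn.self_of_nhds
  have d1 := dβ.mul (hn'.add hs')
  have d0 := dα.mul (hn'.sub hs')
  have dd : HasDerivAt (fun w => corrDen μ ν (s w) (n w) w)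
      (μ * (ν * (n z - s z) + (ν * z + 1) * (n' - s')) -
        ν * (μ * (n z + s z) + (μ * z + 1) * (n' + s'))) z :=
    (d0.const_mul μ).sub (d1.const_mul ν)
  have hcorr := (d1.sub d0).div dd hd
  refine hcorr.congr_deriv ?_
  rw [div_eq_div_iff (pow_ne_zero 2 hd)
    (mul_ne_zero (mul_ne_zero hW (mul_ne_zero hs0 hn0)) (pow_ne_zero 2 hd))]
  simp only [Pi.sub_apply, Pi.add_apply, Pi.mul_apply, corrFactor, ← hA, ← hB, ← hC]
  -- The Wronskian of numerator and denominator, multiplied by `s n`.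
  have key : ((μ * (n z + s z) + (μ * z + 1) * (n' + s')) * ((ν * z + 1) * (n z - s z)) -
      ((μ * z + 1) * (n z + s z)) * (ν * (n z - s z) + (ν * z + 1) * (n' - s'))) * (s z * n z)
      = -2 * B * (μ - ν) * ((μ * z + 1) * (ν * z + 1)) *
        (A * (μ * z + 1) ^ 2 - C * (ν * z + 1) ^ 2 + s z * n z) := by
    have e1 : (μ * (n z + s z) + (μ * z + 1) * (n' + s')) * ((ν * z + 1) * (n z - s z)) -
      ((μ * z + 1) * (n z + s z)) * (ν * (n z - s z) + (ν * z + 1) * (n' - s'))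
      = (μ - ν) * (n z ^ 2 - s z ^ 2) +
        2 * ((μ * z + 1) * (ν * z + 1)) * (s' * n z - s z * n') := by ring
    have e2 : 2 * ((s' * n z - s z * n') * (s z * n z))
        = (2 * s z * s') * n z ^ 2 - (2 * n z * n') * s z ^ 2 := by ring
    rw [es, en, hs2, hn2] at e2
    rw [e1, hs2, hn2]
    linear_combination ((μ * z + 1) * (ν * z + 1)) * e2
  have e3 : ((μ * (n z + s z) + (μ * z + 1) * (n' + s')) -
      (ν * (n z - s z) + (ν * z + 1) * (n' - s'))) * corrDen μ ν (s z) (n z) z -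
      ((μ * z + 1) * (n z + s z) - (ν * z + 1) * (n z - s z)) *
      (μ * (ν * (n z - s z) + (ν * z + 1) * (n' - s')) -
        ν * (μ * (n z + s z) + (μ * z + 1) * (n' + s')))
      = (μ - ν) * ((μ * (n z + s z) + (μ * z + 1) * (n' + s')) * ((ν * z + 1) * (n z - s z)) -
      ((μ * z + 1) * (n z + s z)) * (ν * (n z - s z) + (ν * z + 1) * (n' - s'))) := by
    simp only [corrDen]; ring
  rw [e3]
  linear_combination (μ - ν) ^ 2 * corrDen μ ν (s z) (n z) z ^ 2 * key


/-! ### Equality of the periods over the unit circle -/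

/-- The conditions on two forms `q`, `r` under which the periods over the unit circle are compared:
they and the relevant brackets have no zeros where the branches are needed, for all choices
`p = (z - v₁) (z - v₂)` of the third form with zeros inside the circle through `z`. -/
structure IsOuterPair (q r : BinQuad) : Prop where
  left_ne_zero : ∀ z : ℂ, ‖z‖ ≤ 1 → q.eval z 1 ≠ 0
  right_ne_zero : ∀ z : ℂ, ‖z‖ ≤ 1 → r.eval z 1 ≠ 0
  ratio_mem : ∀ v₁ v₂ z : ℂ, ‖v₁‖ < ‖z‖ → ‖v₂‖ < ‖z‖ → ‖z‖ ≤ 1 →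
    (jac q r).eval z 1 ≠ 0 ∧ (jac r (ofRoots v₁ 1 v₂ 1)).eval z 1 ≠ 0 ∧
      (jac (ofRoots v₁ 1 v₂ 1) q).eval z 1 ≠ 0 ∧ det (ofRoots v₁ 1 v₂ 1) q r ≠ 0 ∧
      ratio (ofRoots v₁ 1 v₂ 1) q r z 1 ∈ Complex.slitPlane
  disc_ne_zero : (jac q r).b ^ 2 - 4 * ((jac q r).a * (jac q r).c) ≠ 0

theorem IsOuterPair.jac_c_ne_zero {q r : BinQuad} (h : IsOuterPair q r) : (jac q r).c ≠ 0 := by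
  have := (h.ratio_mem 0 0 1 (by simp) (by simp) (by simp)).2.2.2.1
  intro h0
  apply this
  simp only [det, ofRoots, jac] at h0 ⊢
  linear_combination -h0

/-- The two fixed points of the involution attached to `q` and `r`. -/
theorem IsOuterPair.exists_diag {q r : BinQuad} (h : IsOuterPair q r) :
    ∃ μ ν : ℂ, μ - ν ≠ 0 ∧ (diag μ ν q).b = 0 ∧ (diag μ ν r).b = 0 := by
  have hc := h.jac_c_ne_zero
  obtain ⟨d, hd⟩ := IsAlgClosed.exists_pow_nat_eq
    ((jac q r).b ^ 2 - 4 * ((jac q r).a * (jac q r).c)) two_pos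
  have hd0 : d ≠ 0 := fun h0 => h.disc_ne_zero (by rw [← hd, h0]; simp)
  refine ⟨((jac q r).b + d) / (2 * (jac q r).c), ((jac q r).b - d) / (2 * (jac q r).c), ?_, ?_, ?_⟩
  · rw [← sub_div]
    exact div_ne_zero (by ring_nf; simpa using hd0) (mul_ne_zero two_ne_zero hc)
  all_goals
    simp only [diag]
    refine div_eq_zero_iff.mpr (Or.inl ?_)
    field_simp
    simp only [jac] at hd ⊢
    first
    | linear_combination q.c * hd
    | linear_combination r.c * hd

/-- The form `(z - t w₁) (z - t w₂)`. -/
def shrunk (w₁ w₂ t : ℂ) : BinQuad := ofRoots (t * w₁) 1 (t * w₂) 1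

theorem eval_shrunk (w₁ w₂ t z : ℂ) :
    (shrunk w₁ w₂ t).eval z 1 = (z - t * w₁) * (z - t * w₂) := by
  rw [shrunk, eval_ofRoots]; ring

theorem shrunk_zero (w₁ w₂ : ℂ) : shrunk w₁ w₂ 0 = ⟨1, 0, 0⟩ := by
  ext <;> simp [shrunk, ofRoots]

/-- The branch of the square root of `shrunk w₁ w₂ t` outside of its zeros. -/
def shrunkRoot (w₁ w₂ : ℂ) (x : ℂ × ℂ) : ℂ := rootBranch (x.1 * w₁) (x.1 * w₂) x.2

/-- The branch near `(0, 0)` of the square root of `partner μ ν (shrunk w₁ w₂ t) z`. -/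
def partnerRoot (μ ν w₁ w₂ : ℂ) (x : ℂ × ℂ) : ℂ :=
  2 / (μ - ν) * csqrt ((μ - ν) ^ 2 / 4 * partner μ ν (shrunk w₁ w₂ x.1) x.2)

/-- The denominator of `corr` for these branches. -/
def shrunkDen (μ ν w₁ w₂ : ℂ) (x : ℂ × ℂ) : ℂ :=
  corrDen μ ν (shrunkRoot w₁ w₂ x) (partnerRoot μ ν w₁ w₂ x) x.2

/-- The corresponding point for these branches. -/
def shrunkCorr (μ ν w₁ w₂ : ℂ) (x : ℂ × ℂ) : ℂ :=
  corr μ ν (shrunkRoot w₁ w₂ x) (partnerRoot μ ν w₁ w₂ x) x.2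

/-- The quotient `f / H` for `p = shrunk w₁ w₂ t`. -/
def shrunkRatio (w₁ w₂ : ℂ) (q r : BinQuad) (x : ℂ × ℂ) : ℂ :=
  ratio (shrunk w₁ w₂ x.1) q r x.2 1

/-- The quotient of the two branches of `√H` at the corresponding point, which is `1` or `-1`. -/
def branchSign (μ ν w₁ w₂ : ℂ) (q r : BinQuad) (σ : ℂ → ℂ) (x : ℂ × ℂ) : ℂ :=
  shrunkDen μ ν w₁ w₂ x ^ 3 *
      (shrunkRoot w₁ w₂ (x.1, shrunkCorr μ ν w₁ w₂ x) * σ (shrunkCorr μ ν w₁ w₂ x)) /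
    (csqrt (shrunkRatio w₁ w₂ q r (x.1, shrunkCorr μ ν w₁ w₂ x)) *
      (corrFactor μ ν (shrunk w₁ w₂ x.1) (shrunkRoot w₁ w₂ x) (partnerRoot μ ν w₁ w₂ x) x.2 *
        σ x.2))

theorem partnerRoot_sq {μ ν : ℂ} (hW : μ - ν ≠ 0) (w₁ w₂ : ℂ) (x : ℂ × ℂ) :
    partnerRoot μ ν w₁ w₂ x ^ 2 = partner μ ν (shrunk w₁ w₂ x.1) x.2 := by
  rw [partnerRoot, mul_pow, csqrt_sq]; field_simp; norm_num

theorem differentiable_partner (μ ν w₁ w₂ : ℂ) :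
    Differentiable ℂ fun x : ℂ × ℂ => partner μ ν (shrunk w₁ w₂ x.1) x.2 := by
  simp only [partner, diag, shrunk, ofRoots, div_eq_mul_inv]
  fun_prop

theorem differentiableAt_partnerRoot {μ ν w₁ w₂ : ℂ} {x : ℂ × ℂ}
    (h : (μ - ν) ^ 2 / 4 * partner μ ν (shrunk w₁ w₂ x.1) x.2 ∈ Complex.slitPlane) :
    DifferentiableAt ℂ (partnerRoot μ ν w₁ w₂) x := by
  have h1 : DifferentiableAt ℂ
      (fun x : ℂ × ℂ => (μ - ν) ^ 2 / 4 * partner μ ν (shrunk w₁ w₂ x.1) x.2) x :=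
    (differentiable_partner μ ν w₁ w₂ x).const_mul _
  exact ((differentiableAt_csqrt h).comp x h1).const_mul _

theorem differentiableAt_shrunkRatio {q r : BinQuad} (h : IsOuterPair q r) {w₁ w₂ : ℂ} {x : ℂ × ℂ}
    (h₁ : ‖x.1 * w₁‖ < ‖x.2‖) (h₂ : ‖x.1 * w₂‖ < ‖x.2‖) (hx : ‖x.2‖ ≤ 1) :
    DifferentiableAt ℂ (shrunkRatio w₁ w₂ q r) x := by
  obtain ⟨a, b, c, -, -⟩ := h.ratio_mem _ _ _ h₁ h₂ hx
  exact differentiableAt_ratio w₁ w₂ q r a b c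

theorem shrunkRatio_mem {q r : BinQuad} (h : IsOuterPair q r) {w₁ w₂ : ℂ} {x : ℂ × ℂ}
    (h₁ : ‖x.1 * w₁‖ < ‖x.2‖) (h₂ : ‖x.1 * w₂‖ < ‖x.2‖) (hx : ‖x.2‖ ≤ 1) :
    shrunkRatio w₁ w₂ q r x ∈ Complex.slitPlane :=
  (h.ratio_mem _ _ _ h₁ h₂ hx).2.2.2.2

/-! ### The double zero `t = 0` -/

theorem partner_shrunk_zero {μ ν : ℂ} (hW : μ - ν ≠ 0) (w₁ w₂ z : ℂ) :
    (μ - ν) ^ 2 / 4 * partner μ ν (shrunk w₁ w₂ 0) z = (1 + (μ + ν) / 2 * z) ^ 2 := by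
  rw [shrunk_zero]; simp only [partner, diag]; field_simp; ring

theorem partnerRoot_zero {μ ν : ℂ} (hW : μ - ν ≠ 0) (w₁ w₂ : ℂ) {z : ℂ}
    (hz : 0 < (1 + (μ + ν) / 2 * z).re) :
    partnerRoot μ ν w₁ w₂ (0, z) = (2 + (μ + ν) * z) / (μ - ν) := by
  rw [partnerRoot, partner_shrunk_zero hW, csqrt_sq_of_re_pos hz]; field_simp

theorem shrunkRoot_zero (w₁ w₂ z : ℂ) : shrunkRoot w₁ w₂ (0, z) = z := by
  simp [shrunkRoot, rootBranch_zero_zero]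

theorem shrunkDen_zero {μ ν : ℂ} (hW : μ - ν ≠ 0) (w₁ w₂ : ℂ) {z : ℂ}
    (hz : 0 < (1 + (μ + ν) / 2 * z).re) :
    shrunkDen μ ν w₁ w₂ (0, z) = 2 * (1 - μ * ν * z ^ 2) := by
  rw [shrunkDen, partnerRoot_zero hW _ _ hz, shrunkRoot_zero, corrDen]; field_simp; ring

theorem shrunkCorr_zero {μ ν : ℂ} (hW : μ - ν ≠ 0) (w₁ w₂ : ℂ) {z : ℂ}
    (hz : 0 < (1 + (μ + ν) / 2 * z).re) :
    shrunkCorr μ ν w₁ w₂ (0, z) = z * ((2 + (μ + ν) * z) / (1 - μ * ν * z ^ 2)) := by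
  have h := shrunkDen_zero hW w₁ w₂ hz
  rw [shrunkDen] at h
  rw [shrunkCorr, corr, h, partnerRoot_zero hW _ _ hz, shrunkRoot_zero]
  simp only
  field_simp
  ring

theorem corrFactor_zero {μ ν : ℂ} (hW : μ - ν ≠ 0) (w₁ w₂ : ℂ) {z : ℂ}
    (hz : 0 < (1 + (μ + ν) / 2 * z).re) :
    corrFactor μ ν (shrunk w₁ w₂ 0) (shrunkRoot w₁ w₂ (0, z)) (partnerRoot μ ν w₁ w₂ (0, z)) z
      = 8 * z * ((μ * z + 1) * (ν * z + 1) * (2 + (μ + ν) * z)) := by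
  rw [partnerRoot_zero hW _ _ hz, shrunkRoot_zero, shrunk_zero]
  simp only [corrFactor, diag]
  field_simp
  ring

/-- The value of `shrunkRatio` at `(0, z)`, with a factor `z²` cancelled. -/
def ratioLimit (q r : BinQuad) (z : ℂ) : ℂ :=
  4 * (jac q r).c * (q.eval z 1 * r.eval z 1) /
    ((jac q r).eval z 1 * ((r.b * z + 2 * r.c) * (q.b * z + 2 * q.c)))

theorem shrunkRatio_zero (w₁ w₂ : ℂ) (q r : BinQuad) {z : ℂ} (hz : z ≠ 0) :
    shrunkRatio w₁ w₂ q r (0, z) = ratioLimit q r z := by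
  rw [shrunkRatio, ratioLimit, shrunk_zero, ratio]
  rw [← mul_div_mul_left (4 * (jac q r).c * _) _ (neg_ne_zero.mpr (pow_ne_zero 2 hz))]
  congr 1 <;> simp only [det, jac, eval] <;> ring

theorem ratioLimit_zero {q r : BinQuad} (h : IsOuterPair q r) : ratioLimit q r 0 = 1 := by
  have hq := h.left_ne_zero 0 (by simp)
  have hr := h.right_ne_zero 0 (by simp)
  have hc := h.jac_c_ne_zero
  simp only [eval] at hq hr
  simp only [ratioLimit, eval]
  simp at hq hr ⊢
  field_simp
  norm_num

theorem continuousAt_ratioLimit {q r : BinQuad} (h : IsOuterPair q r) :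
    ContinuousAt (ratioLimit q r) 0 := by
  have hq := h.left_ne_zero 0 (by simp)
  have hr := h.right_ne_zero 0 (by simp)
  have hc := h.jac_c_ne_zero
  simp only [eval] at hq hr
  simp at hq hr
  unfold ratioLimit eval
  refine ContinuousAt.div (by fun_prop) (by fun_prop) ?_
  simp [hq, hr, hc]

/-- For `t = 0`, where `p = z²`, the corresponding point is asymptotic to `2 z` as `z → 0`, and
`branchSign` tends to `1`. -/
theorem eventually_branchSign {μ ν : ℂ} (hW : μ - ν ≠ 0) {q r : BinQuad} (h : IsOuterPair q r)
    {σ : ℂ → ℂ} (hσ : ContinuousAt σ 0) (hσ0 : σ 0 ≠ 0) (w₁ w₂ : ℂ) :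
    ∀ᶠ z in nhdsWithin (0 : ℂ) {0}ᶜ, 0 < (1 + (μ + ν) / 2 * z).re ∧ 1 - μ * ν * z ^ 2 ≠ 0 ∧
      ‖shrunkCorr μ ν w₁ w₂ (0, z) - 2 * z‖ < ‖z‖ ∧
      ‖branchSign μ ν w₁ w₂ q r σ (0, z) - 1‖ < 1 := by
  have e1 : ∀ᶠ z in nhds (0 : ℂ), 0 < (1 + (μ + ν) / 2 * z).re := by
    have : ContinuousAt (fun z : ℂ => (1 + (μ + ν) / 2 * z).re) 0 := by fun_prop
    exact this.eventually (lt_mem_nhds (by simp))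
  have e2 : ∀ᶠ z in nhds (0 : ℂ), 1 - μ * ν * z ^ 2 ≠ 0 := by
    have : ContinuousAt (fun z : ℂ => 1 - μ * ν * z ^ 2) 0 := by fun_prop
    exact this.eventually_ne (by simp)
  set m : ℂ → ℂ := fun z => (2 + (μ + ν) * z) / (1 - μ * ν * z ^ 2) with hm
  have hmc : ContinuousAt m 0 := ContinuousAt.div (by fun_prop) (by fun_prop) (by simp)
  have hm0 : m 0 = 2 := by simp [hm]
  have e3 : ∀ᶠ z in nhds (0 : ℂ), ‖m z - 2‖ < 1 := by
    have : ContinuousAt (fun z => ‖m z - 2‖) 0 := (hmc.sub continuousAt_const).norm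
    exact this.eventually (gt_mem_nhds (by simp [hm0]))
  have hzm : ContinuousAt (fun z => z * m z) 0 := continuousAt_id.mul hmc
  have hcs : ContinuousAt csqrt 1 := (differentiableAt_csqrt (by simp)).continuousAt
  set G : ℂ → ℂ := fun z => (1 - μ * ν * z ^ 2) ^ 3 * (m z * σ (z * m z)) /
    (csqrt (ratioLimit q r (z * m z)) *
      ((μ * z + 1) * (ν * z + 1) * (2 + (μ + ν) * z) * σ z)) with hG
  have hG0 : G 0 = 1 := by
    simp only [hG, zero_mul, hm0, ratioLimit_zero h, csqrt_one]
    field_simp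
    simp
  have hGc : ContinuousAt G 0 := by
    have c1 : ContinuousAt (fun z => σ (z * m z)) 0 :=
      ContinuousAt.comp_of_eq hσ hzm (by simp)
    have c2 : ContinuousAt (fun z => ratioLimit q r (z * m z)) 0 :=
      ContinuousAt.comp_of_eq (continuousAt_ratioLimit h) hzm (by simp)
    have c3 : ContinuousAt (fun z => csqrt (ratioLimit q r (z * m z))) 0 :=
      ContinuousAt.comp_of_eq hcs c2 (by simp [ratioLimit_zero h])
    refine ContinuousAt.div ?_ ?_ ?_
    · exact ContinuousAt.mul (by fun_prop) (hmc.mul c1)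
    · exact c3.mul (ContinuousAt.mul (by fun_prop) hσ)
    · simp [ratioLimit_zero h, csqrt_one, hσ0]
  have e4 : ∀ᶠ z in nhds (0 : ℂ), ‖G z - 1‖ < 1 := by
    have : ContinuousAt (fun z => ‖G z - 1‖) 0 := (hGc.sub continuousAt_const).norm
    exact this.eventually (gt_mem_nhds (by simp [hG0]))
  filter_upwards [nhdsWithin_le_nhds e1, nhdsWithin_le_nhds e2, nhdsWithin_le_nhds e3,
    nhdsWithin_le_nhds e4, self_mem_nhdsWithin] with z h1 h2 h3 h4 h5
  have hz : z ≠ 0 := h5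
  have hZ := shrunkCorr_zero hW w₁ w₂ h1
  refine ⟨h1, h2, ?_, ?_⟩
  · rw [hZ, show z * ((2 + (μ + ν) * z) / (1 - μ * ν * z ^ 2)) - 2 * z = z * (m z - 2) by
      simp only [hm]; ring, norm_mul]
    have := norm_pos_iff.mpr hz
    nlinarith
  · have hm0 : m z ≠ 0 := by
      intro h0
      rw [h0] at h3
      norm_num at h3
    have : branchSign μ ν w₁ w₂ q r σ (0, z) = G z := by
      simp only [branchSign]
      rw [hZ, corrFactor_zero hW w₁ w₂ h1, shrunkDen_zero hW w₁ w₂ h1, shrunkRoot_zero,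
        shrunkRatio_zero _ _ _ _ (mul_ne_zero hz hm0)]
      simp only [hG]
      rw [← mul_div_mul_left ((1 - μ * ν * z ^ 2) ^ 3 * _) _
        (mul_ne_zero (by norm_num : (8 : ℂ) ≠ 0) hz)]
      congr 1 <;> ring
    rw [this]; exact h4


theorem circleIntegral_eq_of_annulus {f : ℂ → ℂ} {ρ : ℝ} (hρ : 0 < ρ) (hρ1 : ρ ≤ 1)
    (h : ∀ z, ρ ≤ ‖z‖ → ‖z‖ ≤ 1 → DifferentiableAt ℂ f z) :
    (∮ z in C(0, 1), f z) = ∮ z in C(0, ρ), f z := by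
  refine Complex.circleIntegral_eq_of_differentiable_on_annulus_off_countable hρ hρ1
    Set.countable_empty (fun z hz => ?_) fun z hz => ?_
  · simp only [Set.mem_sdiff, Metric.mem_closedBall, Metric.mem_ball, dist_zero_right, not_lt] at hz
    exact (h z hz.2 hz.1).continuousAt.continuousWithinAt
  · simp only [Set.mem_sdiff, Metric.mem_closedBall, Metric.mem_ball, dist_zero_right, not_le] at hz
    exact h z hz.1.2.le hz.1.1.le

theorem continuousAt_div {f g : ℂ × ℂ → ℂ} {x : ℂ × ℂ} (hf : ContinuousAt f x)
    (hg : ContinuousAt g x) (h : g x ≠ 0) : ContinuousAt (fun x => f x / g x) x := hf.div hg h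

/-- For small `t` the conditions of the limit `t = 0` persist on a small circle. -/
theorem eventually_near_double {μ ν : ℂ} (hW : μ - ν ≠ 0) {q r : BinQuad} (h : IsOuterPair q r)
    {σ : ℂ → ℂ} (hσ : ∀ z, ‖z‖ ≤ 1 → ContinuousAt σ z)
    (hσ2 : ∀ z, ‖z‖ ≤ 1 → σ z ^ 2 = q.eval z 1 * r.eval z 1) (w₁ w₂ : ℂ) :
    ∃ ρ : ℝ, 0 < ρ ∧ 3 * ρ ≤ 1 ∧ ∀ᶠ t in nhds (0 : ℂ), ‖t * w₁‖ < ρ ∧ ‖t * w₂‖ < ρ ∧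
      (∀ z ∈ Metric.closedBall (0 : ℂ) ρ,
        (μ - ν) ^ 2 / 4 * partner μ ν (shrunk w₁ w₂ t) z ∈ Complex.slitPlane) ∧
      ∀ z ∈ Metric.sphere (0 : ℂ) ρ, shrunkDen μ ν w₁ w₂ (t, z) ≠ 0 ∧
        ‖shrunkCorr μ ν w₁ w₂ (t, z) - 2 * z‖ < ρ ∧
        ‖branchSign μ ν w₁ w₂ q r σ (t, z) - 1‖ < 1 := by
  have hσ0 : ∀ z, ‖z‖ ≤ 1 → σ z ≠ 0 := fun z hz h0 => by
    have := hσ2 z hz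
    rw [h0] at this
    exact mul_ne_zero (h.left_ne_zero z hz) (h.right_ne_zero z hz) (by simpa using this.symm)
  have hev := eventually_branchSign hW h (hσ 0 (by simp)) (hσ0 0 (by simp)) w₁ w₂
  obtain ⟨δ, hδ, hball⟩ := Metric.mem_nhdsWithin_iff.mp hev
  set ρ : ℝ := min (δ / 2) (1 / 3) with hρd
  have hρ : 0 < ρ := by positivity
  have hρδ : ρ < δ := (min_le_left _ _).trans_lt (by linarith)
  have hρ3 : ρ ≤ 1 / 3 := min_le_right _ _
  have hP : ∀ z : ℂ, z ≠ 0 → ‖z‖ ≤ ρ → 0 < (1 + (μ + ν) / 2 * z).re ∧ 1 - μ * ν * z ^ 2 ≠ 0 ∧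
      ‖shrunkCorr μ ν w₁ w₂ (0, z) - 2 * z‖ < ‖z‖ ∧
      ‖branchSign μ ν w₁ w₂ q r σ (0, z) - 1‖ < 1 := fun z hz hzρ =>
    hball ⟨by simpa using hzρ.trans_lt hρδ, hz⟩
  have hsmall : ∀ w : ℂ, ∀ᶠ t in nhds (0 : ℂ), ‖t * w‖ < ρ := by
    intro w
    have : ContinuousAt (fun t : ℂ => ‖t * w‖) 0 := by fun_prop
    exact this.eventually (gt_mem_nhds (by simpa using hρ))
  refine ⟨ρ, hρ, by linarith, ?_⟩
  have hre : ∀ z : ℂ, ‖z‖ ≤ ρ → 0 < (1 + (μ + ν) / 2 * z).re := by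
    intro z hz
    by_cases h0 : z = 0
    · simp [h0]
    · exact (hP z h0 hz).1
  have hslit : ∀ z : ℂ, ‖z‖ ≤ ρ →
      (μ - ν) ^ 2 / 4 * partner μ ν (shrunk w₁ w₂ 0) z ∈ Complex.slitPlane := by
    intro z hz
    have h1 := hre z hz
    rw [partner_shrunk_zero hW, Complex.mem_slitPlane_iff]
    set u := 1 + (μ + ν) / 2 * z with hu
    by_cases him : u.im = 0
    · left
      rw [pow_two, Complex.mul_re, him]
      nlinarith
    · right
      rw [pow_two, Complex.mul_im]
      intro h0
      have : u.re * u.im = 0 := by linarith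
      rcases mul_eq_zero.mp this with h2 | h2
      · exact h1.ne' h2
      · exact him h2
  refine (hsmall w₁).and ((hsmall w₂).and (Filter.Eventually.and ?_ ?_))
  · refine (isCompact_closedBall (0 : ℂ) ρ).eventually_forall_of_forall_eventually fun z hz => ?_
    have hc : ContinuousAt (fun x : ℂ × ℂ =>
        (μ - ν) ^ 2 / 4 * partner μ ν (shrunk w₁ w₂ x.1) x.2) (0, z) :=
      ((differentiable_partner μ ν w₁ w₂).continuous.const_mul _).continuousAt
    exact hc.eventually (Complex.isOpen_slitPlane.mem_nhds (hslit z (by simpa using hz)))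
  · refine (isCompact_sphere (0 : ℂ) ρ).eventually_forall_of_forall_eventually fun z hz => ?_
    have hzρ : ‖z‖ = ρ := by simpa using hz
    have hz0 : z ≠ 0 := norm_pos_iff.mp (hzρ ▸ hρ)
    obtain ⟨h1, h2, h3, h4⟩ := hP z hz0 hzρ.le
    have hsR : ContinuousAt (shrunkRoot w₁ w₂) (0, z) :=
      (differentiableAt_rootBranch (x := (0, z)) (by simpa using hz0)
        (by simpa using hz0)).continuousAt
    have hnR : ContinuousAt (partnerRoot μ ν w₁ w₂) (0, z) :=
      (differentiableAt_partnerRoot (x := (0, z)) (hslit z hzρ.le)).continuousAt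
    have hden : ContinuousAt (shrunkDen μ ν w₁ w₂) (0, z) := by
      unfold shrunkDen corrDen; fun_prop
    have hden0 : shrunkDen μ ν w₁ w₂ (0, z) ≠ 0 := by
      rw [shrunkDen_zero hW _ _ h1]; exact mul_ne_zero two_ne_zero h2
    have hcorr : ContinuousAt (shrunkCorr μ ν w₁ w₂) (0, z) :=
      continuousAt_div (by fun_prop) hden hden0
    set Z := shrunkCorr μ ν w₁ w₂ (0, z) with hZ
    have hZn : ‖Z - 2 * z‖ < ρ := hzρ ▸ h3
    have h2z : ‖2 * z‖ = 2 * ρ := by simp [hzρ]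
    have hZ1 : ‖Z‖ ≤ 1 := by
      have := norm_add_le (Z - 2 * z) (2 * z)
      rw [sub_add_cancel] at this
      linarith
    have hZ0 : Z ≠ 0 := by
      intro h0
      rw [h0, zero_sub, norm_neg, h2z] at hZn
      linarith
    have hpair : ContinuousAt (fun x : ℂ × ℂ => (x.1, shrunkCorr μ ν w₁ w₂ x)) (0, z) :=
      continuousAt_fst.prodMk hcorr
    have k1 : ContinuousAt (fun x : ℂ × ℂ => shrunkRoot w₁ w₂ (x.1, shrunkCorr μ ν w₁ w₂ x))
        (0, z) :=
      ContinuousAt.comp_of_eq (differentiableAt_rootBranch (w₁ := w₁) (w₂ := w₂) (x := (0, Z))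
        (by simpa using hZ0) (by simpa using hZ0)).continuousAt hpair rfl
    have k2 : ContinuousAt (fun x : ℂ × ℂ => σ (shrunkCorr μ ν w₁ w₂ x)) (0, z) :=
      ContinuousAt.comp_of_eq (hσ Z hZ1) hcorr rfl
    have k3 : ContinuousAt
        (fun x : ℂ × ℂ => shrunkRatio w₁ w₂ q r (x.1, shrunkCorr μ ν w₁ w₂ x)) (0, z) :=
      ContinuousAt.comp_of_eq (differentiableAt_shrunkRatio h (w₁ := w₁) (w₂ := w₂) (x := (0, Z))
        (by simpa using hZ0) (by simpa using hZ0) hZ1).continuousAt hpair rfl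
    have hmem : shrunkRatio w₁ w₂ q r (0, Z) ∈ Complex.slitPlane :=
      shrunkRatio_mem h (by simpa using hZ0) (by simpa using hZ0) hZ1
    have k4 : ContinuousAt
        (fun x : ℂ × ℂ => csqrt (shrunkRatio w₁ w₂ q r (x.1, shrunkCorr μ ν w₁ w₂ x))) (0, z) :=
      ContinuousAt.comp_of_eq (differentiableAt_csqrt hmem).continuousAt k3 rfl
    have k5 : ContinuousAt (fun x : ℂ × ℂ => corrFactor μ ν (shrunk w₁ w₂ x.1)
        (shrunkRoot w₁ w₂ x) (partnerRoot μ ν w₁ w₂ x) x.2) (0, z) := by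
      simp only [corrFactor, diag, shrunk, ofRoots, div_eq_mul_inv]
      fun_prop
    have k6 : ContinuousAt (fun x : ℂ × ℂ => σ x.2) (0, z) :=
      ContinuousAt.comp_of_eq (hσ z (by linarith)) continuousAt_snd rfl
    have hsign : ContinuousAt (branchSign μ ν w₁ w₂ q r σ) (0, z) := by
      refine continuousAt_div ((hden.pow 3).mul (k1.mul k2)) (k4.mul (k5.mul k6)) ?_
      intro h0
      simp only [branchSign] at h4
      simp only at h0
      rw [h0, div_zero] at h4
      norm_num at h4
    refine (hden.eventually_ne hden0).and (Filter.Eventually.and ?_ ?_)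
    · have : ContinuousAt (fun x : ℂ × ℂ => ‖shrunkCorr μ ν w₁ w₂ x - 2 * x.2‖) (0, z) := by
        fun_prop
      exact this.eventually (gt_mem_nhds hZn)
    · have : ContinuousAt (fun x : ℂ × ℂ => ‖branchSign μ ν w₁ w₂ q r σ x - 1‖) (0, z) := by
        fun_prop
      exact this.eventually (gt_mem_nhds h4)


/-- The integrand of the period of `f` over the unit circle. -/
def periodF (w₁ w₂ : ℂ) (σ : ℂ → ℂ) (l₀ l₁ : ℂ) (x : ℂ × ℂ) : ℂ :=
  (l₀ + l₁ * x.2) / (shrunkRoot w₁ w₂ x * σ x.2)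

/-- The integrand of the period of `H` over the unit circle, for the branch `√f / √(f / H)` of
`√H`. -/
def periodH (w₁ w₂ : ℂ) (q r : BinQuad) (σ : ℂ → ℂ) (l₀ l₁ : ℂ) (x : ℂ × ℂ) : ℂ :=
  periodF w₁ w₂ σ l₀ l₁ x * csqrt (shrunkRatio w₁ w₂ q r x)

theorem differentiableAt_periodF {w₁ w₂ : ℂ} {σ : ℂ → ℂ} {x : ℂ × ℂ}
    (hσ : DifferentiableAt ℂ σ x.2) (hσ0 : σ x.2 ≠ 0) (h₁ : ‖x.1 * w₁‖ < ‖x.2‖)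
    (h₂ : ‖x.1 * w₂‖ < ‖x.2‖) (l₀ l₁ : ℂ) : DifferentiableAt ℂ (periodF w₁ w₂ σ l₀ l₁) x := by
  refine differentiableAt_div (by fun_prop) ((differentiableAt_rootBranch h₁ h₂).mul ?_)
    (mul_ne_zero (rootBranch_ne_zero h₁ h₂) hσ0)
  exact hσ.comp x differentiableAt_snd

theorem differentiableAt_periodH {w₁ w₂ : ℂ} {q r : BinQuad} (h : IsOuterPair q r) {σ : ℂ → ℂ}
    {x : ℂ × ℂ} (hσ : DifferentiableAt ℂ σ x.2) (hσ0 : σ x.2 ≠ 0) (h₁ : ‖x.1 * w₁‖ < ‖x.2‖)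
    (h₂ : ‖x.1 * w₂‖ < ‖x.2‖) (hx : ‖x.2‖ ≤ 1) (l₀ l₁ : ℂ) :
    DifferentiableAt ℂ (periodH w₁ w₂ q r σ l₀ l₁) x :=
  (differentiableAt_periodF hσ hσ0 h₁ h₂ l₀ l₁).mul
    ((differentiableAt_csqrt (shrunkRatio_mem h h₁ h₂ hx)).comp x
      (differentiableAt_shrunkRatio h h₁ h₂ hx))

theorem differentiableAt_slice {F : ℂ × ℂ → ℂ} {t z : ℂ} (h : DifferentiableAt ℂ F (t, z)) :
    DifferentiableAt ℂ (fun z => F (t, z)) z :=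
  h.comp z ((differentiableAt_const t).prodMk differentiableAt_id)

/-- Near its limit `1`, the sign `branchSign` is equal to `1`. -/
theorem eq_one_of_branchSign {μ ν : ℂ} (hW : μ - ν ≠ 0) {q r : BinQuad} (h : IsOuterPair q r)
    (hq : (diag μ ν q).b = 0) (hr : (diag μ ν r).b = 0) {σ : ℂ → ℂ}
    (hσ2 : ∀ z, ‖z‖ ≤ 1 → σ z ^ 2 = q.eval z 1 * r.eval z 1) {w₁ w₂ t z : ℂ} (hz : ‖z‖ ≤ 1)
    (hz0 : z ≠ 0) (hd : shrunkDen μ ν w₁ w₂ (t, z) ≠ 0)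
    (h₁ : ‖t * w₁‖ < ‖shrunkCorr μ ν w₁ w₂ (t, z)‖) (h₂ : ‖t * w₂‖ < ‖shrunkCorr μ ν w₁ w₂ (t, z)‖)
    (hZ : ‖shrunkCorr μ ν w₁ w₂ (t, z)‖ ≤ 1)
    (hs : ‖branchSign μ ν w₁ w₂ q r σ (t, z) - 1‖ < 1) :
    branchSign μ ν w₁ w₂ q r σ (t, z) = 1 := by
  set D := branchSign μ ν w₁ w₂ q r σ (t, z) with hD
  have hD2 : D ^ 2 = 1 := by
    have key := jac_corr hW hq hr (p := shrunk w₁ w₂ t) (z := z) (s := shrunkRoot w₁ w₂ (t, z))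
      (n := partnerRoot μ ν w₁ w₂ (t, z)) (by
        rw [eval_shrunk]; exact rootBranch_sq hz0) (partnerRoot_sq hW w₁ w₂ (t, z)) hd
    set Z := shrunkCorr μ ν w₁ w₂ (t, z) with hZd
    have hZd' : corr μ ν (shrunkRoot w₁ w₂ (t, z)) (partnerRoot μ ν w₁ w₂ (t, z)) z = Z := rfl
    have hdd : corrDen μ ν (shrunkRoot w₁ w₂ (t, z)) (partnerRoot μ ν w₁ w₂ (t, z)) z
      = shrunkDen μ ν w₁ w₂ (t, z) := rfl
    rw [hZd', hdd] at key
    obtain ⟨j1, j2, j3, hdet, hsl⟩ := h.ratio_mem _ _ _ h₁ h₂ hZ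
    have hZ0 : Z ≠ 0 := norm_pos_iff.mp ((norm_nonneg _).trans_lt h₁)
    have hrat0 : shrunkRatio w₁ w₂ q r (t, Z) ≠ 0 := Complex.slitPlane_ne_zero hsl
    have hF0 : corrFactor μ ν (shrunk w₁ w₂ t) (shrunkRoot w₁ w₂ (t, z))
        (partnerRoot μ ν w₁ w₂ (t, z)) z ≠ 0 := by
      intro h0
      rw [h0] at key
      exact mul_ne_zero (mul_ne_zero (mul_ne_zero j1 j2) j3) (pow_ne_zero 6 hd)
        (by rw [show jac r (ofRoots (t * w₁) 1 (t * w₂) 1) = jac r (shrunk w₁ w₂ t) from rfl,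
          show jac (ofRoots (t * w₁) 1 (t * w₂) 1) q = jac (shrunk w₁ w₂ t) q from rfl, key]
            ring)
    have hσz : σ z ^ 2 ≠ 0 := by
      rw [hσ2 z hz]; exact mul_ne_zero (h.left_ne_zero z hz) (h.right_ne_zero z hz)
    have hrat : shrunkRatio w₁ w₂ q r (t, Z) * ((jac q r).eval Z 1 *
        (jac r (shrunk w₁ w₂ t)).eval Z 1 * (jac (shrunk w₁ w₂ t) q).eval Z 1)
        = 4 * det (shrunk w₁ w₂ t) q r *
          ((shrunk w₁ w₂ t).eval Z 1 * q.eval Z 1 * r.eval Z 1) :=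
      div_mul_cancel₀ _ (mul_ne_zero (mul_ne_zero j1 j2) j3)
    have hroot : shrunkRoot w₁ w₂ (t, Z) ^ 2 = (shrunk w₁ w₂ t).eval Z 1 := by
      rw [eval_shrunk]; exact rootBranch_sq hZ0
    rw [hD, branchSign]
    simp only [← hZd]
    rw [div_pow, mul_pow, mul_pow, mul_pow, mul_pow, csqrt_sq, hroot, hσ2 Z hZ,
      div_eq_one_iff_eq (mul_ne_zero hrat0 (mul_ne_zero (pow_ne_zero 2 hF0) hσz))]
    have hdet' : det (shrunk w₁ w₂ t) q r ≠ 0 := hdet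
    refine mul_left_cancel₀ (mul_ne_zero (by norm_num : (4 : ℂ) ≠ 0) hdet') ?_
    rw [hσ2 z hz]
    linear_combination -(shrunkDen μ ν w₁ w₂ (t, z) ^ 6) * hrat +
      shrunkRatio w₁ w₂ q r (t, Z) * key
  rcases sq_eq_one_iff.mp hD2 with h1 | h1
  · exact h1
  · rw [h1] at hs; norm_num at hs

/-- The periods agree when two zeros of `f` are close to each other. -/
theorem eventually_period_eq {q r : BinQuad} (h : IsOuterPair q r) {σ : ℂ → ℂ}
    (hσ : ∀ z, ‖z‖ ≤ 1 → DifferentiableAt ℂ σ z)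
    (hσ2 : ∀ z, ‖z‖ ≤ 1 → σ z ^ 2 = q.eval z 1 * r.eval z 1) (w₁ w₂ l₀ l₁ : ℂ) :
    ∀ᶠ t in nhds (0 : ℂ), (∮ z in C(0, 1), periodF w₁ w₂ σ l₀ l₁ (t, z))
      = ∮ z in C(0, 1), periodH w₁ w₂ q r σ l₀ l₁ (t, z) := by
  obtain ⟨μ, ν, hW, hq, hr⟩ := h.exists_diag
  have hσ0 : ∀ z, ‖z‖ ≤ 1 → σ z ≠ 0 := fun z hz h0 => by
    have := hσ2 z hz
    rw [h0] at this
    exact mul_ne_zero (h.left_ne_zero z hz) (h.right_ne_zero z hz) (by simpa using this.symm)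
  obtain ⟨ρ, hρ, hρ3, hev⟩ :=
    eventually_near_double hW h (fun z hz => (hσ z hz).continuousAt) hσ2 w₁ w₂
  filter_upwards [hev] with t ht
  obtain ⟨h₁, h₂, hslit, hsph⟩ := ht
  -- The numerator `l₀ + l₁ z` in the basis `α = ν z + 1`, `β = μ z + 1`.
  obtain ⟨m₀, m₁, hm⟩ : ∃ m₀ m₁ : ℂ, ∀ z, l₀ + l₁ * z = m₀ * (ν * z + 1) + m₁ * (μ * z + 1) :=
    ⟨(μ * l₀ - l₁) / (μ - ν), (l₁ - ν * l₀) / (μ - ν), fun z => by field_simp; ring⟩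
  set s : ℂ → ℂ := fun z => shrunkRoot w₁ w₂ (t, z) with hs
  set n : ℂ → ℂ := fun z => partnerRoot μ ν w₁ w₂ (t, z) with hn
  have hsd : ∀ z, ρ ≤ ‖z‖ → DifferentiableAt ℂ s z := fun z hz =>
    differentiableAt_slice (differentiableAt_rootBranch (x := (t, z)) (h₁.trans_le hz)
      (h₂.trans_le hz))
  have hs0 : ∀ z, ρ ≤ ‖z‖ → s z ≠ 0 := fun z hz =>
    rootBranch_ne_zero (h₁.trans_le hz) (h₂.trans_le hz)
  have hnd : ∀ z, ‖z‖ ≤ ρ → DifferentiableAt ℂ n z := fun z hz =>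
    differentiableAt_slice (differentiableAt_partnerRoot (x := (t, z))
      (hslit z (by simpa using hz)))
  have hn0 : ∀ z, ‖z‖ ≤ ρ → n z ≠ 0 := fun z hz =>
    mul_ne_zero (div_ne_zero two_ne_zero hW)
      (csqrt_ne_zero (Complex.slitPlane_ne_zero (hslit z (by simpa using hz))))
  have hF : ∀ z, ρ ≤ ‖z‖ → ‖z‖ ≤ 1 →
      DifferentiableAt ℂ (fun z => periodF w₁ w₂ σ l₀ l₁ (t, z)) z := fun z hz hz1 =>
    differentiableAt_slice (differentiableAt_periodF (x := (t, z)) (hσ z hz1) (hσ0 z hz1)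
      (h₁.trans_le hz) (h₂.trans_le hz) l₀ l₁)
  have hH : ∀ z, ρ ≤ ‖z‖ → ‖z‖ ≤ 1 →
      DifferentiableAt ℂ (fun z => periodH w₁ w₂ q r σ l₀ l₁ (t, z)) z := fun z hz hz1 =>
    differentiableAt_slice (differentiableAt_periodH h (x := (t, z)) (hσ z hz1) (hσ0 z hz1)
      (h₁.trans_le hz) (h₂.trans_le hz) hz1 l₀ l₁)
  -- The period of the partner branch vanishes by Cauchy's theorem.
  set g : ℂ → ℂ := fun z => (m₀ * (ν * z + 1) - m₁ * (μ * z + 1)) / (n z * σ z) with hg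
  have hgd : ∀ z, ‖z‖ ≤ ρ → DifferentiableAt ℂ g z := fun z hz =>
    DifferentiableAt.div (by fun_prop) ((hnd z hz).mul (hσ z (by linarith)))
      (mul_ne_zero (hn0 z hz) (hσ0 z (by linarith)))
  have hg0 : (∮ z in C(0, ρ), g z) = 0 :=
    Complex.circleIntegral_eq_zero_of_differentiable_on_off_countable hρ.le Set.countable_empty
      (fun z hz => (hgd z (by simpa using hz)).continuousAt.continuousWithinAt)
      fun z hz => hgd z (by simpa using (Metric.ball_subset_closedBall hz.1))
  set φ : ℂ → ℂ := fun z => shrunkCorr μ ν w₁ w₂ (t, z) with hφ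
  have hφd : ∀ z, ‖z‖ = ρ → HasDerivAt φ (corrFactor μ ν (shrunk w₁ w₂ t) (s z) (n z) z /
      ((μ - ν) * (s z * n z) * shrunkDen μ ν w₁ w₂ (t, z) ^ 2)) z := by
    intro z hz
    have hz0 : z ≠ 0 := norm_pos_iff.mp (hz ▸ hρ)
    refine hasDerivAt_corr hW (hsd z hz.ge) (hnd z hz.le) ?_ ?_ (hsph z (by simpa using hz)).1
      (hs0 z hz.ge) (hn0 z hz.le)
    · filter_upwards [isOpen_ne.mem_nhds hz0] with w hw
      rw [eval_shrunk]; exact rootBranch_sq hw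
    · exact Filter.Eventually.of_forall fun w => partnerRoot_sq hW w₁ w₂ (t, w)
  have hid : ∀ z ∈ Metric.sphere (0 : ℂ) ρ, periodF w₁ w₂ σ l₀ l₁ (t, z) - g z
      = periodH w₁ w₂ q r σ l₀ l₁ (t, φ z) * deriv φ z := by
    intro z hz
    obtain ⟨hd, hnear, hsg⟩ := hsph z hz
    have hz' : ‖z‖ = ρ := by simpa using hz
    have hz0 : z ≠ 0 := norm_pos_iff.mp (hz' ▸ hρ)
    have h2z : ‖2 * z‖ = 2 * ρ := by simp [hz']
    have hφ1 : ‖φ z‖ ≤ 1 := by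
      have := norm_add_le (φ z - 2 * z) (2 * z)
      rw [sub_add_cancel] at this
      linarith
    have hφρ : ρ < ‖φ z‖ := by
      have := norm_sub_norm_le (2 * z) (2 * z - φ z)
      rw [sub_sub_cancel, norm_sub_rev] at this
      linarith
    have hone := eq_one_of_branchSign hW h hq hr hσ2 (by linarith : ‖z‖ ≤ 1) hz0 hd
      (h₁.trans hφρ) (h₂.trans hφρ) hφ1 hsg
    have hsφ : s (φ z) ≠ 0 := hs0 _ hφρ.le
    have hσφ : σ (φ z) ≠ 0 := hσ0 _ hφ1
    have hsz := hs0 z hz'.ge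
    have hnz := hn0 z hz'.le
    have hσz := hσ0 z (by linarith)
    set d := shrunkDen μ ν w₁ w₂ (t, z) with hdd
    set f := corrFactor μ ν (shrunk w₁ w₂ t) (s z) (n z) z with hf
    set c := csqrt (shrunkRatio w₁ w₂ q r (t, φ z)) with hc
    have hone' : d ^ 3 * (s (φ z) * σ (φ z)) / (c * (f * σ z)) = 1 := hone
    have hne : c * (f * σ z) ≠ 0 := by
      intro h0
      rw [h0, div_zero] at hone'
      exact zero_ne_one hone'
    rw [div_eq_one_iff_eq hne] at hone'
    have hα : ν * φ z + 1 = (μ - ν) / d * ((ν * z + 1) * (n z - s z)) := corr_alpha hd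
    have hβ : μ * φ z + 1 = (μ - ν) / d * ((μ * z + 1) * (n z + s z)) := corr_beta hd
    rw [(hφd z hz').deriv, periodH, periodF, periodF]
    simp only
    rw [hm, hm, hα, hβ]
    change (m₀ * (ν * z + 1) + m₁ * (μ * z + 1)) / (s z * σ z) -
        (m₀ * (ν * z + 1) - m₁ * (μ * z + 1)) / (n z * σ z) =
      (m₀ * ((μ - ν) / d * ((ν * z + 1) * (n z - s z))) +
        m₁ * ((μ - ν) / d * ((μ * z + 1) * (n z + s z)))) / (s (φ z) * σ (φ z)) * c *
        (f / ((μ - ν) * (s z * n z) * d ^ 2))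
    have e1 : (m₀ * ((μ - ν) / d * ((ν * z + 1) * (n z - s z))) +
        m₁ * ((μ - ν) / d * ((μ * z + 1) * (n z + s z)))) / (s (φ z) * σ (φ z)) * c *
        (f / ((μ - ν) * (s z * n z) * d ^ 2))
      = (m₀ * ((ν * z + 1) * (n z - s z)) + m₁ * ((μ * z + 1) * (n z + s z))) *
        (c * (f * σ z)) / (d ^ 3 * (s (φ z) * σ (φ z)) * (s z * n z * σ z)) := by
      field_simp
    rw [e1, hone']
    obtain ⟨hc0, hfσ⟩ := mul_ne_zero_iff.mp hne
    have hf0 := (mul_ne_zero_iff.mp hfσ).1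
    field_simp
    ring
  set V : Set ℂ := {z | ‖t * w₁‖ < ‖z‖ ∧ ‖t * w₂‖ < ‖z‖} ∩
    {z | (μ - ν) ^ 2 / 4 * partner μ ν (shrunk w₁ w₂ t) z ∈ Complex.slitPlane} with hVd
  have hVo : IsOpen V := by
    refine IsOpen.inter ((isOpen_lt continuous_const continuous_norm).inter
      (isOpen_lt continuous_const continuous_norm)) ?_
    refine Complex.isOpen_slitPlane.preimage ?_
    exact ((differentiable_partner μ ν w₁ w₂).continuous.comp
      (continuous_const.prodMk continuous_id)).const_mul _
  have hVs : ∀ z ∈ V, DifferentiableAt ℂ s z := fun z hz =>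
    differentiableAt_slice (differentiableAt_rootBranch (x := (t, z)) hz.1.1 hz.1.2)
  have hVn : ∀ z ∈ V, DifferentiableAt ℂ n z := fun z hz =>
    differentiableAt_slice (differentiableAt_partnerRoot (x := (t, z)) hz.2)
  have hVden : ∀ z ∈ V, DifferentiableAt ℂ (fun z => shrunkDen μ ν w₁ w₂ (t, z)) z := by
    intro z hz
    have a := hVs z hz
    have b := hVn z hz
    change DifferentiableAt ℂ (fun z => μ * ((ν * z + 1) * (n z - s z)) -
      ν * ((μ * z + 1) * (n z + s z))) z
    fun_prop
  have hVφ : ∀ z ∈ V ∩ (fun z => shrunkDen μ ν w₁ w₂ (t, z)) ⁻¹' {0}ᶜ,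
      DifferentiableAt ℂ φ z := by
    intro z hz
    have a := hVs z hz.1
    have b := hVn z hz.1
    refine DifferentiableAt.div (c := fun z => (μ * z + 1) * (n z + s z) -
      (ν * z + 1) * (n z - s z)) (by fun_prop) (hVden z hz.1) hz.2
  have hhom := circleIntegral_comp_of_near_double
    (Φ := fun z => periodH w₁ w₂ q r σ l₀ l₁ (t, z)) (φ := φ) hρ
    (fun z hz => (hH z hz.1.le (hz.2.le.trans hρ3)).differentiableWithinAt)
    (V := V ∩ (fun z => shrunkDen μ ν w₁ w₂ (t, z)) ⁻¹' {0}ᶜ)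
    (ContinuousOn.isOpen_inter_preimage
      (fun z hz => (hVden z hz).continuousAt.continuousWithinAt) hVo isOpen_compl_singleton)
    (fun z hz => by
      have hz' : ‖z‖ = ρ := by simpa using hz
      exact ⟨⟨⟨h₁.trans_eq hz'.symm, h₂.trans_eq hz'.symm⟩,
        hslit z (Metric.sphere_subset_closedBall hz)⟩, (hsph z hz).1⟩)
    (fun z hz => (hVφ z hz).differentiableWithinAt) (fun z hz => (hsph z hz).2.1)
  have hFi : CircleIntegrable (fun z => periodF w₁ w₂ σ l₀ l₁ (t, z)) 0 ρ :=
    ContinuousOn.circleIntegrable hρ.le fun z hz => by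
      have hz' : ‖z‖ = ρ := by simpa using hz
      exact (hF z hz'.ge (by linarith)).continuousAt.continuousWithinAt
  have hgi : CircleIntegrable g 0 ρ :=
    ContinuousOn.circleIntegrable hρ.le fun z hz => by
      have hz' : ‖z‖ = ρ := by simpa using hz
      exact (hgd z hz'.le).continuousAt.continuousWithinAt
  calc (∮ z in C(0, 1), periodF w₁ w₂ σ l₀ l₁ (t, z))
      = ∮ z in C(0, ρ), periodF w₁ w₂ σ l₀ l₁ (t, z) :=
        circleIntegral_eq_of_annulus hρ (by linarith) hF
    _ = (∮ z in C(0, ρ), periodF w₁ w₂ σ l₀ l₁ (t, z)) - ∮ z in C(0, ρ), g z := by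
        rw [hg0, sub_zero]
    _ = ∮ z in C(0, ρ), (periodF w₁ w₂ σ l₀ l₁ (t, z) - g z) :=
        (circleIntegral.integral_sub hFi hgi).symm
    _ = ∮ z in C(0, ρ), periodH w₁ w₂ q r σ l₀ l₁ (t, φ z) * deriv φ z :=
        circleIntegral.integral_congr hρ.le hid
    _ = ∮ z in C(0, 2 * ρ), periodH w₁ w₂ q r σ l₀ l₁ (t, z) := hhom
    _ = ∮ z in C(0, 1), periodH w₁ w₂ q r σ l₀ l₁ (t, z) :=
        (circleIntegral_eq_of_annulus (by linarith) (by linarith)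
          fun z hz hz1 => hH z (by linarith) hz1).symm

theorem differentiableOn_circleIntegral_period {F : ℂ × ℂ → ℂ} {R : ℝ}
    (h : ∀ t z : ℂ, ‖t‖ < R → ‖z‖ = 1 → DifferentiableAt ℂ F (t, z)) :
    DifferentiableOn ℂ (fun t => ∮ z in C(0, 1), F (t, z)) (Metric.ball 0 R) := by
  intro t ht
  refine (hasDerivAt_circleIntegral (F := fun t z => F (t, z)) Metric.isOpen_ball zero_le_one
    ?_ ?_ ht).differentiableAt.differentiableWithinAt
  · rintro ⟨t, z⟩ hx
    exact (h t z (by simpa using hx.1) (by simpa using hx.2)).continuousAt.continuousWithinAt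
  · intro z hz t ht
    exact ((h t z (by simpa using ht) (by simpa using hz)).comp t
      (differentiableAt_id.prodMk (differentiableAt_const z))).differentiableWithinAt

/-- The periods of `f` and `H` over the unit circle agree, for the branches `√f` and
`√f / √(f / H)`: both are holomorphic functions of the parameter `t` that scales the zeros of `f`
inside the circle. -/
theorem period_eq {q r : BinQuad} (h : IsOuterPair q r) {σ : ℂ → ℂ}
    (hσ : ∀ z, ‖z‖ ≤ 1 → DifferentiableAt ℂ σ z)
    (hσ2 : ∀ z, ‖z‖ ≤ 1 → σ z ^ 2 = q.eval z 1 * r.eval z 1) {w₁ w₂ : ℂ} (h₁ : ‖w₁‖ < 1)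
    (h₂ : ‖w₂‖ < 1) (l₀ l₁ : ℂ) :
    (∮ z in C(0, 1), periodF w₁ w₂ σ l₀ l₁ (1, z))
      = ∮ z in C(0, 1), periodH w₁ w₂ q r σ l₀ l₁ (1, z) := by
  have hσ0 : ∀ z, ‖z‖ ≤ 1 → σ z ≠ 0 := fun z hz h0 => by
    have := hσ2 z hz
    rw [h0] at this
    exact mul_ne_zero (h.left_ne_zero z hz) (h.right_ne_zero z hz) (by simpa using this.symm)
  set M := max ‖w₁‖ ‖w₂‖ with hM
  have hM0 : 0 ≤ M := (norm_nonneg _).trans (le_max_left _ _)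
  have hM1 : M < 1 := max_lt h₁ h₂
  set R : ℝ := 2 / (M + 1) with hR
  have hR1 : 1 < R := by rw [hR, lt_div_iff₀ (by linarith)]; linarith
  have hRM : R * M < 1 := by
    rw [hR, div_mul_eq_mul_div, div_lt_iff₀ (by linarith)]; linarith
  have hsm : ∀ t w : ℂ, ‖t‖ < R → ‖w‖ ≤ M → ‖t * w‖ < 1 := by
    intro t w ht hw
    rw [norm_mul]
    nlinarith [norm_nonneg t, norm_nonneg w]
  have hF := differentiableOn_circleIntegral_period (F := periodF w₁ w₂ σ l₀ l₁) (R := R)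
    fun t z ht hz => differentiableAt_periodF (hσ z hz.le) (hσ0 z hz.le)
      ((hsm t w₁ ht (le_max_left _ _)).trans_eq hz.symm)
      ((hsm t w₂ ht (le_max_right _ _)).trans_eq hz.symm) l₀ l₁
  have hH := differentiableOn_circleIntegral_period (F := periodH w₁ w₂ q r σ l₀ l₁) (R := R)
    fun t z ht hz => differentiableAt_periodH h (hσ z hz.le) (hσ0 z hz.le)
      ((hsm t w₁ ht (le_max_left _ _)).trans_eq hz.symm)
      ((hsm t w₂ ht (le_max_right _ _)).trans_eq hz.symm) hz.le l₀ l₁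
  exact (hF.analyticOnNhd Metric.isOpen_ball).eqOn_of_preconnected_of_eventuallyEq
    (hH.analyticOnNhd Metric.isOpen_ball) (convex_ball _ _).isPreconnected
    (z₀ := 0) (by simp; linarith) (eventually_period_eq h hσ hσ2 w₁ w₂ l₀ l₁)
    (by simpa using hR1)

end BinQuad

/-! ### Polynomials as binary forms -/

/-- The binary form of a polynomial of degree at most `2`. -/
def toQuad (p : ℂ[X]) : BinQuad := ⟨p.coeff 2, p.coeff 1, p.coeff 0⟩

theorem eq_quadratic {p : ℂ[X]} (hp : p.natDegree ≤ 2) :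
    p = Polynomial.C (p.coeff 2) * Polynomial.X ^ 2 + Polynomial.C (p.coeff 1) * Polynomial.X
      + Polynomial.C (p.coeff 0) :=
  Polynomial.eq_quadratic_of_degree_le_two (Polynomial.natDegree_le_iff_degree_le.mp hp)

theorem eval_eq_toQuad {p : ℂ[X]} (hp : p.natDegree ≤ 2) (x : ℂ) :
    p.eval x = (toQuad p).eval x 1 := by
  conv_lhs => rw [eq_quadratic hp]
  simp [toQuad, BinQuad.eval]

theorem eval_bracket {p q : ℂ[X]} (hp : p.natDegree ≤ 2) (hq : q.natDegree ≤ 2) (x : ℂ) :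
    (bracket p q).eval x = (BinQuad.jac (toQuad p) (toQuad q)).eval x 1 := by
  conv_lhs => rw [bracket, eq_quadratic hp, eq_quadratic hq]
  simp [toQuad, BinQuad.eval, BinQuad.jac]
  ring

theorem delta_eq_det (p q r : ℂ[X]) :
    delta p q r = BinQuad.det (toQuad p) (toQuad q) (toQuad r) := by
  simp [delta, BinQuad.det, toQuad, Matrix.det_fin_three]
  ring

theorem eval_richelot {p q r : ℂ[X]} (hp : p.natDegree ≤ 2) (hq : q.natDegree ≤ 2)
    (hr : r.natDegree ≤ 2) (x : ℂ) :
    (richelot p q r).eval x = 1 / (4 * BinQuad.det (toQuad p) (toQuad q) (toQuad r)) *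
      ((BinQuad.jac (toQuad q) (toQuad r)).eval x 1 * (BinQuad.jac (toQuad r) (toQuad p)).eval x 1 *
        (BinQuad.jac (toQuad p) (toQuad q)).eval x 1) := by
  simp only [richelot, Polynomial.eval_mul, Polynomial.eval_C, eval_bracket hq hr,
    eval_bracket hr hp, eval_bracket hp hq, delta_eq_det]

/-! ### The image of the unit disc under a Möbius transformation -/

/-- The point `[x : y]` of the Riemann sphere. -/
def toPoint (x y : ℂ) : OnePoint ℂ := if y = 0 then ∞ else ((x / y : ℂ) : OnePoint ℂ)

theorem toPoint_one (x : ℂ) : toPoint x 1 = (x : OnePoint ℂ) := by simp [toPoint]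

theorem smul_coe_eq_toPoint (g : GL (Fin 2) ℂ) (z : ℂ) :
    g • (z : OnePoint ℂ) = toPoint (g 0 0 * z + g 0 1) (g 1 0 * z + g 1 1) := by
  rw [OnePoint.smul_some_eq_ite]; rfl

theorem toPoint_smul {k : ℂ} (hk : k ≠ 0) (x y : ℂ) : toPoint (k * x) (k * y) = toPoint x y := by
  simp only [toPoint, mul_eq_zero, hk, false_or]
  split_ifs with h
  · rfl
  · rw [mul_div_mul_left _ _ hk]

theorem cross_eq_zero_of_toPoint_eq {x y x' y' : ℂ} (h : toPoint x y = toPoint x' y') :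
    x * y' - x' * y = 0 := by
  simp only [toPoint] at h
  split_ifs at h with h1 h2 h2
  · simp [h1, h2]
  · exact absurd h (OnePoint.infty_ne_coe _)
  · exact absurd h (OnePoint.coe_ne_infty _)
  · rw [OnePoint.coe_eq_coe, div_eq_div_iff h1 h2] at h
    linear_combination h

theorem det_ne_zero' (g : GL (Fin 2) ℂ) : g 0 0 * g 1 1 - g 0 1 * g 1 0 ≠ 0 := by
  have h := g.det_ne_zero
  rwa [Matrix.det_fin_two] at h

theorem vec_ne_zero (g : GL (Fin 2) ℂ) {x y : ℂ} (h : x ≠ 0 ∨ y ≠ 0) :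
    g 0 0 * x + g 0 1 * y ≠ 0 ∨ g 1 0 * x + g 1 1 * y ≠ 0 := by
  by_contra! hcon
  obtain ⟨h1, h2⟩ := hcon
  have hd := det_ne_zero' g
  rcases h with h | h
  · exact mul_ne_zero hd h (by linear_combination g 1 1 * h1 - g 0 1 * h2)
  · exact mul_ne_zero hd h (by linear_combination g 0 0 * h2 - g 1 0 * h1)

theorem exists_vec (g : GL (Fin 2) ℂ) (X Y : ℂ) :
    ∃ x y : ℂ, X = g 0 0 * x + g 0 1 * y ∧ Y = g 1 0 * x + g 1 1 * y := by
  have hd := det_ne_zero' g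
  refine ⟨(g 1 1 * X - g 0 1 * Y) / (g 0 0 * g 1 1 - g 0 1 * g 1 0),
    (g 0 0 * Y - g 1 0 * X) / (g 0 0 * g 1 1 - g 0 1 * g 1 0), ?_, ?_⟩ <;>
    rw [mul_div_assoc', mul_div_assoc', ← add_div, eq_div_iff hd] <;> ring

/-- The matrix of the Hermitian form that is negative on the image of the disc of radius `ρ`
under `g`. -/
def discMatrix (g : GL (Fin 2) ℂ) (ρ : ℝ) : Matrix (Fin 2) (Fin 2) ℂ :=
  !![g 1 1, -g 0 1; -(ρ * g 1 0), ρ * g 0 0]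

theorem hform_discMatrix (g : GL (Fin 2) ℂ) (ρ : ℝ) (x y : ℂ) :
    hform (discMatrix g ρ) (g 0 0 * x + g 0 1 * y) (g 1 0 * x + g 1 1 * y)
      = ‖g 0 0 * g 1 1 - g 0 1 * g 1 0‖ ^ 2 * (‖x‖ ^ 2 - ρ ^ 2 * ‖y‖ ^ 2) := by
  simp only [hform, discMatrix, Matrix.of_apply, Matrix.cons_val]
  rw [show g 1 1 * (g 0 0 * x + g 0 1 * y) + -g 0 1 * (g 1 0 * x + g 1 1 * y)
      = (g 0 0 * g 1 1 - g 0 1 * g 1 0) * x by ring,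
    show -(ρ * g 1 0) * (g 0 0 * x + g 0 1 * y) + ρ * g 0 0 * (g 1 0 * x + g 1 1 * y)
      = (g 0 0 * g 1 1 - g 0 1 * g 1 0) * (ρ * y) by ring]
  simp only [norm_mul, Complex.norm_real, mul_pow, Real.norm_eq_abs, sq_abs]
  ring

theorem hform_discMatrix_neg_iff (g : GL (Fin 2) ℂ) (ρ : ℝ) (x y : ℂ) :
    hform (discMatrix g ρ) (g 0 0 * x + g 0 1 * y) (g 1 0 * x + g 1 1 * y) < 0 ↔
      ‖x‖ ^ 2 < ρ ^ 2 * ‖y‖ ^ 2 := by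
  rw [hform_discMatrix, ← sub_neg (a := ‖x‖ ^ 2)]
  have : 0 < ‖g 0 0 * g 1 1 - g 0 1 * g 1 0‖ ^ 2 := pow_pos (norm_pos_iff.mpr (det_ne_zero' g)) 2
  constructor
  · intro h
    by_contra! h'
    exact absurd (mul_nonneg this.le h') (not_le.mpr h)
  · exact fun h => mul_neg_of_pos_of_neg this h

theorem hform_discMatrix_nonneg_iff (g : GL (Fin 2) ℂ) (ρ : ℝ) (x y : ℂ) :
    0 ≤ hform (discMatrix g ρ) (g 0 0 * x + g 0 1 * y) (g 1 0 * x + g 1 1 * y) ↔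
      ρ ^ 2 * ‖y‖ ^ 2 ≤ ‖x‖ ^ 2 := by
  rw [← not_lt, hform_discMatrix_neg_iff, not_lt]

theorem hform_discMatrix_anti (g : GL (Fin 2) ℂ) {ρ : ℝ} (h0 : 0 ≤ ρ) (h1 : ρ ≤ 1) (X Y : ℂ) :
    hform (discMatrix g 1) X Y ≤ hform (discMatrix g ρ) X Y := by
  obtain ⟨x, y, rfl, rfl⟩ := exists_vec g X Y
  rw [hform_discMatrix, hform_discMatrix]
  have : ρ ^ 2 ≤ 1 := pow_le_one₀ h0 h1
  gcongr

theorem ne_zero_of_hform_neg {m : Matrix (Fin 2) (Fin 2) ℂ} {x y : ℂ} (h : hform m x y < 0) :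
    x ≠ 0 ∨ y ≠ 0 := by
  by_contra! h0
  rw [h0.1, h0.2, hform_zero] at h
  exact lt_irrefl _ h

theorem toPoint_mem_mobiusDisc_iff (g : GL (Fin 2) ℂ) {X Y : ℂ} (h : X ≠ 0 ∨ Y ≠ 0) :
    toPoint X Y ∈ mobiusDisc g ↔ hform (discMatrix g 1) X Y < 0 := by
  constructor
  · rintro ⟨w, hw, hwe⟩
    simp only at hwe
    rw [smul_coe_eq_toPoint] at hwe
    obtain ⟨k, hk1, hk2⟩ := exists_smul_of_cross_eq_zero
      (cross_eq_zero_of_toPoint_eq hwe.symm) (by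
        simpa using vec_ne_zero g (x := w) (y := 1) (Or.inr one_ne_zero))
    have hk : k ≠ 0 := by
      rintro rfl
      simp [hk1, hk2] at h
    have hkpos : 0 < ‖k‖ ^ 2 := by positivity
    have := (hform_discMatrix_neg_iff g 1 w 1).mpr (by
      have : ‖w‖ < 1 := by simpa using hw
      have := norm_nonneg w
      simp only [norm_one]; nlinarith)
    rw [hk1, hk2, hform_smul]
    rw [mul_one, mul_one] at this
    exact mul_neg_of_pos_of_neg hkpos this
  · intro hneg
    obtain ⟨x, y, rfl, rfl⟩ := exists_vec g X Y
    rw [hform_discMatrix_neg_iff] at hneg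
    have hy : y ≠ 0 := by
      rintro rfl
      simp only [norm_zero] at hneg
      nlinarith [sq_nonneg ‖x‖]
    refine ⟨x / y, ?_, ?_⟩
    · rw [mem_ball_zero_iff, norm_div, div_lt_one (norm_pos_iff.mpr hy)]
      exact lt_of_pow_lt_pow_left₀ 2 (norm_nonneg _) (by simpa using hneg)
    · simp only
      rw [smul_coe_eq_toPoint, ← toPoint_smul hy]
      congr 1 <;> field_simp

theorem hform_nonneg_of_disjoint {g g' : GL (Fin 2) ℂ}
    (h : Disjoint (mobiusDisc g) (mobiusDisc g')) {x y : ℂ} (hx : hform (discMatrix g 1) x y < 0) :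
    0 ≤ hform (discMatrix g' 1) x y := by
  have hne := ne_zero_of_hform_neg hx
  by_contra! h'
  exact Set.disjoint_left.mp h ((toPoint_mem_mobiusDisc_iff g hne).mpr hx)
    ((toPoint_mem_mobiusDisc_iff g' hne).mpr h')

/-- The closure of a disc does not meet an open disc that is disjoint from the first one. -/
theorem hform_nonneg_of_disjoint_of_nonpos {g g' : GL (Fin 2) ℂ}
    (h : Disjoint (mobiusDisc g) (mobiusDisc g')) {X Y : ℂ} (hX : hform (discMatrix g 1) X Y ≤ 0) :
    0 ≤ hform (discMatrix g' 1) X Y := by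
  obtain ⟨x, y, rfl, rfl⟩ := exists_vec g X Y
  have hxy : ‖x‖ ^ 2 ≤ ‖y‖ ^ 2 := by
    by_contra! hcon
    rw [hform_discMatrix] at hX
    have : 0 < ‖g 0 0 * g 1 1 - g 0 1 * g 1 0‖ ^ 2 := pow_pos (norm_pos_iff.mpr (det_ne_zero' g)) 2
    nlinarith
  by_cases hy : y = 0
  · have hx : x = 0 := by
      have : ‖x‖ ^ 2 = 0 := le_antisymm (by simpa [hy] using hxy) (sq_nonneg _)
      simpa using this
    simp [hx, hy, hform_zero]
  · have hc : Continuous fun s : ℝ => hform (discMatrix g' 1) (g 0 0 * (s * x) + g 0 1 * y)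
        (g 1 0 * (s * x) + g 1 1 * y) :=
      (continuous_hform (discMatrix g' 1)).comp (f := fun s : ℝ =>
        (g 0 0 * (s * x) + g 0 1 * y, g 1 0 * (s * x) + g 1 1 * y)) (by fun_prop)
    have hlim := (hc.tendsto 1).mono_left (nhdsWithin_le_nhds (s := Set.Iio 1))
    have hev : ∀ᶠ s : ℝ in nhdsWithin (1 : ℝ) (Set.Iio 1), 0 ≤ hform (discMatrix g' 1)
        (g 0 0 * (s * x) + g 0 1 * y) (g 1 0 * (s * x) + g 1 1 * y) := by
      filter_upwards [Ioo_mem_nhdsLT (show (0 : ℝ) < 1 by norm_num)] with s hs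
      refine hform_nonneg_of_disjoint h ((hform_discMatrix_neg_iff g 1 _ _).mpr ?_)
      rw [norm_mul, Complex.norm_real, Real.norm_eq_abs, abs_of_pos hs.1, mul_pow, one_pow, one_mul]
      have : 0 < ‖y‖ ^ 2 := by positivity
      have hs2 : s ^ 2 < 1 := by nlinarith [hs.1, hs.2]
      have := sq_nonneg ‖x‖
      rcases this.eq_or_lt with h0 | h0
      · rw [← h0]; simpa using ‹0 < ‖y‖ ^ 2›
      · nlinarith
    simpa using ge_of_tendsto hlim hev

/-- A polynomial of degree at most `2` with both roots in a disc, where a root at `∞` is a zero of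
its binary form like any other one. -/
theorem exists_toQuad_eq {p : ℂ[X]} {g : GL (Fin 2) ℂ} (h0 : p ≠ 0) (h2 : p.natDegree ≤ 2)
    (hr : rootCount 2 p (mobiusDisc g) = 2) :
    ∃ k w w' : ℂ, k ≠ 0 ∧ ‖w‖ < 1 ∧ ‖w'‖ < 1 ∧
      toQuad p = BinQuad.scale k (BinQuad.ofRoots (g 0 0 * w + g 0 1) (g 1 0 * w + g 1 1)
        (g 0 0 * w' + g 0 1) (g 1 0 * w' + g 1 1)) := by
  classical
  have hcard : p.roots.card = p.natDegree := (IsAlgClosed.splits p).natDegree_eq_card_roots.symm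
  have hle := Multiset.card_le_card
    (Multiset.filter_le (fun a : ℂ => (a : OnePoint ℂ) ∈ mobiusDisc g) p.roots)
  rw [rootCount] at hr
  have hinf : p.natDegree < 2 → ∞ ∈ mobiusDisc g := by
    intro h
    by_contra hcon
    rw [if_neg hcon] at hr
    omega
  have hall : ∀ a ∈ p.roots, (a : OnePoint ℂ) ∈ mobiusDisc g := by
    have : p.roots.filter (fun a : ℂ => (a : OnePoint ℂ) ∈ mobiusDisc g) = p.roots :=
      Multiset.eq_of_le_of_card_le (Multiset.filter_le _ _) (by split_ifs at hr <;> omega)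
    exact Multiset.filter_eq_self.mp this
  -- A finite point of the disc.
  have hfin : ∀ a : ℂ, (a : OnePoint ℂ) ∈ mobiusDisc g → ∃ w c : ℂ, ‖w‖ < 1 ∧ c ≠ 0 ∧
      g 0 0 * w + g 0 1 = c * a ∧ g 1 0 * w + g 1 1 = c := by
    rintro a ⟨w, hw, hwe⟩
    simp only at hwe
    rw [smul_coe_eq_toPoint, ← toPoint_one] at hwe
    have hcr := cross_eq_zero_of_toPoint_eq hwe
    obtain ⟨c, hc1, hc2⟩ := exists_smul_of_cross_eq_zero hcr (Or.inr one_ne_zero)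
    rw [mul_one] at hc2
    refine ⟨w, c, by simpa using hw, ?_, hc1, hc2⟩
    rintro rfl
    have := vec_ne_zero g (x := w) (y := 1) (Or.inr one_ne_zero)
    simp [hc1, hc2] at this
  have hinf' : ∞ ∈ mobiusDisc g → ∃ w c : ℂ, ‖w‖ < 1 ∧ c ≠ 0 ∧
      g 0 0 * w + g 0 1 = c ∧ g 1 0 * w + g 1 1 = 0 := by
    rintro ⟨w, hw, hwe⟩
    simp only at hwe
    rw [smul_coe_eq_toPoint, show (∞ : OnePoint ℂ) = toPoint 1 0 by simp [toPoint]] at hwe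
    have hcr := cross_eq_zero_of_toPoint_eq hwe
    have h1 : g 1 0 * w + g 1 1 = 0 := by linear_combination -hcr
    refine ⟨w, _, by simpa using hw, ?_, rfl, h1⟩
    have := vec_ne_zero g (x := w) (y := 1) (Or.inr one_ne_zero)
    simpa [h1] using this
  have hfac := (IsAlgClosed.splits p).eq_prod_roots
  have hlc : p.leadingCoeff ≠ 0 := Polynomial.leadingCoeff_ne_zero.mpr h0
  set l := p.leadingCoeff with hl
  have hquad : ∀ A B C : ℂ, p = Polynomial.C A * Polynomial.X ^ 2 + Polynomial.C B * Polynomial.X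
      + Polynomial.C C → toQuad p = ⟨A, B, C⟩ := by
    rintro A B C rfl
    ext <;> simp [toQuad, Polynomial.coeff_X, Polynomial.coeff_C]
  obtain hd | hd | hd : p.natDegree = 0 ∨ p.natDegree = 1 ∨ p.natDegree = 2 := by omega
  · obtain ⟨w, c, hw, hc, e1, e2⟩ := hinf' (hinf (by omega))
    rw [hd, Multiset.card_eq_zero] at hcard
    rw [hcard] at hfac
    refine ⟨l / c ^ 2, w, w, div_ne_zero hlc (pow_ne_zero 2 hc), hw, hw, ?_⟩
    rw [hquad 0 0 l (by rw [hfac]; simp), e1, e2]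
    ext <;> simp [BinQuad.scale, BinQuad.ofRoots]
    field_simp
  · obtain ⟨w, c, hw, hc, e1, e2⟩ := hinf' (hinf (by omega))
    rw [hd, Multiset.card_eq_one] at hcard
    obtain ⟨a, ha⟩ := hcard
    obtain ⟨w', c', hw', hc', e1', e2'⟩ := hfin a (hall a (by simp [ha]))
    rw [ha] at hfac
    refine ⟨-l / (c * c'), w, w', by simp [hc, hc', hlc], hw, hw', ?_⟩
    rw [hquad 0 l (-(l * a)) (by rw [hfac]; simp; ring), e1, e2, e1', e2']
    ext <;> simp [BinQuad.scale, BinQuad.ofRoots] <;> field_simp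
  · rw [hd, Multiset.card_eq_two] at hcard
    obtain ⟨a, b, hab⟩ := hcard
    obtain ⟨w, c, hw, hc, e1, e2⟩ := hfin a (hall a (by simp [hab]))
    obtain ⟨w', c', hw', hc', e1', e2'⟩ := hfin b (hall b (by simp [hab]))
    rw [hab] at hfac
    refine ⟨l / (c * c'), w, w', by simp [hc, hc', hlc], hw, hw', ?_⟩
    rw [hquad l (-(l * (a + b))) (l * (a * b)) (by rw [hfac]; simp; ring), e1, e2, e1', e2']
    ext <;> simp [BinQuad.scale, BinQuad.ofRoots] <;> field_simp
    ring

namespace BinQuad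

/-! ### Forms with zeros in given discs -/

theorem scale_one (p : BinQuad) : scale 1 p = p := by
  ext <;> simp [scale]

theorem jac_scale_left (k : ℂ) (p q : BinQuad) : jac (scale k p) q = scale k (jac p q) := by
  simpa [scale_one] using jac_scale k 1 p q

theorem jac_scale_right (k : ℂ) (p q : BinQuad) : jac p (scale k q) = scale k (jac p q) := by
  simpa [scale_one] using jac_scale 1 k p q

theorem det_scale_left (k : ℂ) (p q r : BinQuad) : det (scale k p) q r = k * det p q r := by
  simpa [scale_one] using det_scale k 1 1 p q r

theorem ratio_scale_left {k : ℂ} (hk : k ≠ 0) (p q r : BinQuad) (x y : ℂ) :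
    ratio (scale k p) q r x y = ratio p q r x y := by
  simpa [scale_one] using ratio_scale hk one_ne_zero one_ne_zero p q r x y

/-- The discriminant of a quadratic form. -/
def disc (p : BinQuad) : ℂ := p.b ^ 2 - 4 * (p.a * p.c)

theorem disc_scale (k : ℂ) (p : BinQuad) : disc (scale k p) = k ^ 2 * disc p := by
  simp only [disc, scale]; ring

theorem disc_comp (p : BinQuad) (m : Matrix (Fin 2) (Fin 2) ℂ) :
    disc (p.comp m) = (m 0 0 * m 1 1 - m 0 1 * m 1 0) ^ 2 * disc p := by
  simp only [disc, comp]; ring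

/-- The discriminant of the bracket is the resultant. -/
theorem disc_jac_ofRoots (x y x' y' u v u' v' : ℂ) :
    disc (jac (ofRoots x y x' y') (ofRoots u v u' v')) =
      4 * ((x * v - u * y) * (x * v' - u' * y) * ((x' * v - u * y') * (x' * v' - u' * y'))) := by
  simp only [disc, jac, ofRoots]; ring

/-- The form whose zeros are the images of `w` and `w'` under `g`. -/
def ofImages (g : GL (Fin 2) ℂ) (w w' : ℂ) : BinQuad :=
  ofRoots (g 0 0 * w + g 0 1) (g 1 0 * w + g 1 1) (g 0 0 * w' + g 0 1) (g 1 0 * w' + g 1 1)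

theorem ofImages_comp (g : GL (Fin 2) ℂ) (w w' : ℂ) :
    (ofImages g w w').comp g.1 =
      scale ((g 0 0 * g 1 1 - g 0 1 * g 1 0) ^ 2) (ofRoots w 1 w' 1) := by
  have := comp_ofRoots g.1 w 1 w' 1
  simpa only [mul_one, ofImages] using this

end BinQuad

theorem hform_discMatrix_coe_neg (g : GL (Fin 2) ℂ) {ρ : ℝ} {w : ℂ} (h : ‖w‖ < ρ) :
    hform (discMatrix g ρ) (g 0 0 * w + g 0 1) (g 1 0 * w + g 1 1) < 0 := by
  have := (hform_discMatrix_neg_iff g ρ w 1).mpr (by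
    simp only [norm_one, one_pow, mul_one]
    exact pow_lt_pow_left₀ h (norm_nonneg _) two_ne_zero)
  simpa only [mul_one] using this

theorem hform_discMatrix_coe_nonneg (g : GL (Fin 2) ℂ) {ρ : ℝ} (hρ : 0 ≤ ρ) {w : ℂ} (h : ρ ≤ ‖w‖) :
    0 ≤ hform (discMatrix g ρ) (g 0 0 * w + g 0 1) (g 1 0 * w + g 1 1) := by
  have := (hform_discMatrix_nonneg_iff g ρ w 1).mpr (by
    simp only [norm_one, one_pow, mul_one]
    exact pow_le_pow_left₀ hρ h 2)
  simpa only [mul_one] using this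

theorem hform_discMatrix_coe_nonpos (g : GL (Fin 2) ℂ) {w : ℂ} (h : ‖w‖ ≤ 1) :
    hform (discMatrix g 1) (g 0 0 * w + g 0 1) (g 1 0 * w + g 1 1) ≤ 0 := by
  have := hform_discMatrix g 1 w 1
  rw [mul_one, mul_one] at this
  rw [this]
  refine mul_nonpos_of_nonneg_of_nonpos (sq_nonneg _) ?_
  simp only [norm_one, one_pow, mul_one]
  have := norm_nonneg w
  nlinarith

theorem coe_vec_ne_zero (g : GL (Fin 2) ℂ) (z : ℂ) :
    g 0 0 * z + g 0 1 ≠ 0 ∨ g 1 0 * z + g 1 1 ≠ 0 := by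
  simpa using vec_ne_zero g (x := z) (y := 1) (Or.inr one_ne_zero)

/-- The concentric discs of radii `ρ i ≤ 1` in disjoint discs are disjoint. -/
theorem hform_nonneg_of_shrunk {g : Fin 3 → GL (Fin 2) ℂ}
    (hg : Pairwise fun i j => Disjoint (mobiusDisc (g i)) (mobiusDisc (g j))) {ρ : Fin 3 → ℝ}
    (h0 : ∀ i, 0 ≤ ρ i) (h1 : ∀ i, ρ i ≤ 1) (i j : Fin 3) (hij : i ≠ j) (x y : ℂ)
    (h : hform (discMatrix (g i) (ρ i)) x y < 0) : 0 ≤ hform (discMatrix (g j) (ρ j)) x y :=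
  (hform_nonneg_of_disjoint (hg hij)
    ((hform_discMatrix_anti (g i) (h0 i) (h1 i) x y).trans_lt h)).trans
      (hform_discMatrix_anti (g j) (h0 j) (h1 j) x y)

namespace BinQuad

theorem eval_ofImages_ne_zero {g : GL (Fin 2) ℂ} {w w' X Y : ℂ} (hw : ‖w‖ < 1) (hw' : ‖w'‖ < 1)
    (hXY : X ≠ 0 ∨ Y ≠ 0) (h : 0 ≤ hform (discMatrix g 1) X Y) :
    (ofImages g w w').eval X Y ≠ 0 := by
  rw [ofImages, eval_ofRoots]
  exact mul_ne_zero (cross_ne_zero_of_hform (hform_discMatrix_coe_neg g hw) h hXY)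
    (cross_ne_zero_of_hform (hform_discMatrix_coe_neg g hw') h hXY)

/-- In the coordinate of the first disc, the other two forms satisfy the conditions under which the
periods are compared. -/
theorem isOuterPair_comp {g : Fin 3 → GL (Fin 2) ℂ}
    (hg : Pairwise fun i j => Disjoint (mobiusDisc (g i)) (mobiusDisc (g j))) {w w' : Fin 3 → ℂ}
    (hw : ∀ i, ‖w i‖ < 1) (hw' : ∀ i, ‖w' i‖ < 1) :
    IsOuterPair ((ofImages (g 1) (w 1) (w' 1)).comp (g 0).1)
      ((ofImages (g 2) (w 2) (w' 2)).comp (g 0).1) := by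
  have hD := det_ne_zero' (g 0)
  have hne : ∀ j, (0 : Fin 3) ≠ j → ∀ z : ℂ, ‖z‖ ≤ 1 →
      ((ofImages (g j) (w j) (w' j)).comp (g 0).1).eval z 1 ≠ 0 := by
    intro j hj z hz
    rw [eval_comp]
    simp only [mul_one]
    exact eval_ofImages_ne_zero (hw j) (hw' j) (coe_vec_ne_zero _ _)
      (hform_nonneg_of_disjoint_of_nonpos (hg hj) (hform_discMatrix_coe_nonpos _ hz))
  refine ⟨hne 1 (by decide), hne 2 (by decide), ?_, ?_⟩
  · intro v₁ v₂ z h₁ h₂ hz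
    -- The disc of radius `‖z‖` replaces the first of the three discs.
    set ρ : Fin 3 → ℝ := ![‖z‖, 1, 1] with hρ
    set a : Fin 3 → ℂ := ![v₁, w 1, w 2] with ha
    set b : Fin 3 → ℂ := ![v₂, w' 1, w' 2] with hb
    have hρ0 : ∀ i, 0 ≤ ρ i := by intro i; fin_cases i <;> simp [hρ]
    have hρ1 : ∀ i, ρ i ≤ 1 := by intro i; fin_cases i <;> simp [hρ, hz]
    have haρ : ∀ i, ‖a i‖ < ρ i := by intro i; fin_cases i <;> simp [hρ, ha, h₁, hw]
    have hbρ : ∀ i, ‖b i‖ < ρ i := by intro i; fin_cases i <;> simp [hρ, hb, h₂, hw']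
    have hX : ∀ i, 0 ≤ hform (discMatrix (g i) (ρ i)) (g 0 0 0 * z + g 0 0 1)
        (g 0 1 0 * z + g 0 1 1) := by
      intro i
      by_cases hi : i = 0
      · subst hi
        exact hform_discMatrix_coe_nonneg _ (hρ0 0) le_rfl
      · exact (hform_nonneg_of_disjoint_of_nonpos (hg (Ne.symm hi))
          (hform_discMatrix_coe_nonpos _ hz)).trans (hform_discMatrix_anti _ (hρ0 i) (hρ1 i) _ _)
    obtain ⟨-, j1, j2, j3, hd, hr⟩ := ratio_mem_slitPlane (m := fun i => discMatrix (g i) (ρ i))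
      (hform_nonneg_of_shrunk hg hρ0 hρ1)
      (fun i => hform_discMatrix_coe_neg (g i) (haρ i))
      (fun i => hform_discMatrix_coe_neg (g i) (hbρ i)) (coe_vec_ne_zero (g 0) z) hX
      (P := fun i => ofImages (g i) (a i) (b i)) (k := fun _ => 1) (fun _ => one_ne_zero)
      (fun i => by rw [scale_one]; rfl)
    have hP0 := ofImages_comp (g 0) v₁ v₂
    have ha0 : a 0 = v₁ := rfl
    have ha1 : a 1 = w 1 := rfl
    have ha2 : a 2 = w 2 := rfl
    have hb0 : b 0 = v₂ := rfl
    have hb1 : b 1 = w' 1 := rfl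
    have hb2 : b 2 = w' 2 := rfl
    simp only [ha0, ha1, ha2, hb0, hb1, hb2] at j1 j2 j3 hd hr
    have hjac : ∀ p q : BinQuad, (jac p q).eval (g 0 0 0 * z + g 0 0 1)
        (g 0 1 0 * z + g 0 1 1) ≠ 0 → (jac (p.comp (g 0).1) (q.comp (g 0).1)).eval z 1 ≠ 0 := by
      intro p q h
      rw [jac_comp, eval_scale, eval_comp]
      simp only [mul_one]
      exact mul_ne_zero hD h
    have k2 := hjac _ _ j2
    have k3 := hjac _ _ j3
    rw [hP0, jac_scale_right, eval_scale] at k2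
    rw [hP0, jac_scale_left, eval_scale] at k3
    refine ⟨hjac _ _ j1, right_ne_zero_of_mul k2, right_ne_zero_of_mul k3, ?_, ?_⟩
    · have := det_comp (ofImages (g 0) v₁ v₂) (ofImages (g 1) (w 1) (w' 1))
        (ofImages (g 2) (w 2) (w' 2)) (g 0).1
      rw [hP0, det_scale_left] at this
      exact right_ne_zero_of_mul (this ▸ mul_ne_zero (pow_ne_zero 3 hD) hd)
    · have := ratio_comp hD (ofImages (g 0) v₁ v₂) (ofImages (g 1) (w 1) (w' 1))
        (ofImages (g 2) (w 2) (w' 2)) z 1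
      rw [hP0, ratio_scale_left (pow_ne_zero 2 hD)] at this
      simp only [mul_one] at this
      rw [this]
      exact hr
  · change disc _ ≠ 0
    rw [jac_comp, disc_scale, disc_comp, ofImages, ofImages, disc_jac_ofRoots]
    have hc : ∀ u v : ℂ, ‖u‖ < 1 → ‖v‖ < 1 →
        (g 1 0 0 * u + g 1 0 1) * (g 2 1 0 * v + g 2 1 1) -
          (g 2 0 0 * v + g 2 0 1) * (g 1 1 0 * u + g 1 1 1) ≠ 0 := fun u v hu hv =>
      cross_ne_zero_of_hform (hform_discMatrix_coe_neg _ hu)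
        (hform_nonneg_of_disjoint (hg (by decide : (2 : Fin 3) ≠ 1))
          (hform_discMatrix_coe_neg _ hv)) (coe_vec_ne_zero _ _)
    exact mul_ne_zero (pow_ne_zero 2 hD) (mul_ne_zero (pow_ne_zero 2 hD) (mul_ne_zero (by norm_num)
      (mul_ne_zero (mul_ne_zero (hc _ _ (hw 1) (hw 2)) (hc _ _ (hw 1) (hw' 2)))
        (mul_ne_zero (hc _ _ (hw' 1) (hw 2)) (hc _ _ (hw' 1) (hw' 2))))))

/-- A quadratic form without zeros in the closed unit disc has a square root there. -/
theorem exists_sqrt_of_ne_zero {q : BinQuad} (h : ∀ z : ℂ, ‖z‖ ≤ 1 → q.eval z 1 ≠ 0) :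
    ∃ σ : ℂ → ℂ, ∀ z : ℂ, ‖z‖ ≤ 1 → DifferentiableAt ℂ σ z ∧ σ z ^ 2 = q.eval z 1 := by
  have hc : q.c ≠ 0 := by simpa [eval] using h 0 (by simp)
  obtain ⟨d, hd⟩ := IsAlgClosed.exists_pow_nat_eq (q.b ^ 2 - 4 * (q.a * q.c)) two_pos
  set κ := (-q.b + d) / (2 * q.c) with hκ
  set κ' := (-q.b - d) / (2 * q.c) with hκ'
  have hfac : ∀ z, q.eval z 1 = q.c * ((1 - κ * z) * (1 - κ' * z)) := by
    intro z
    rw [hκ, hκ', eval]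
    field_simp
    linear_combination z ^ 2 * hd
  have key : ∀ k : ℂ, (∀ z : ℂ, ‖z‖ ≤ 1 → 1 - k * z ≠ 0) → ∀ z : ℂ, ‖z‖ ≤ 1 →
      1 - k * z ∈ Complex.slitPlane := by
    intro k hk z hz
    have hk1 : ‖k‖ < 1 := by
      by_contra! hcon
      have hk0 : k ≠ 0 := norm_pos_iff.mp (by linarith)
      refine hk k⁻¹ ?_ (by rw [mul_inv_cancel₀ hk0, sub_self])
      rw [norm_inv]
      exact inv_le_one_of_one_le₀ hcon
    have : ‖k * z‖ < 1 := by
      rw [norm_mul]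
      nlinarith [norm_nonneg k, norm_nonneg z]
    have := one_sub_div_mem_slitPlane (w := k * z) (z := 1) (by simpa using this)
    simpa using this
  have h1 := key κ fun z hz h0 => h z hz (by rw [hfac, h0]; ring)
  have h2 := key κ' fun z hz h0 => h z hz (by rw [hfac, h0]; ring)
  refine ⟨fun z => csqrt q.c * (csqrt (1 - κ * z) * csqrt (1 - κ' * z)), fun z hz => ⟨?_, ?_⟩⟩
  · have e1 : DifferentiableAt ℂ (fun z => csqrt (1 - κ * z)) z :=
      (differentiableAt_csqrt (h1 z hz)).comp (f := fun z => 1 - κ * z) z (by fun_prop)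
    have e2 : DifferentiableAt ℂ (fun z => csqrt (1 - κ' * z)) z :=
      (differentiableAt_csqrt (h2 z hz)).comp (f := fun z => 1 - κ' * z) z (by fun_prop)
    exact (e1.mul e2).const_mul _
  · rw [mul_pow, mul_pow, csqrt_sq, csqrt_sq, csqrt_sq, hfac]

/-- The periods of `f` and `H` over the boundary of the first disc agree, for a branch `S` of `√f`
and the branch `S / √(f / H)` of `√H`, in the coordinate `z` of the disc. -/
theorem circleIntegral_eq_of_sq_eq {g : Fin 3 → GL (Fin 2) ℂ}
    (hg : Pairwise fun i j => Disjoint (mobiusDisc (g i)) (mobiusDisc (g j))) {w w' : Fin 3 → ℂ}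
    (hw : ∀ i, ‖w i‖ < 1) (hw' : ∀ i, ‖w' i‖ < 1) {P : Fin 3 → BinQuad} {k : Fin 3 → ℂ}
    (hk : ∀ i, k i ≠ 0) (hP : ∀ i, P i = scale (k i) (ofImages (g i) (w i) (w' i))) {S : ℂ → ℂ}
    (hS : ContinuousOn S (Metric.sphere 0 1))
    (hS2 : ∀ z ∈ Metric.sphere (0 : ℂ) 1, S z ^ 2 =
      ((P 0).comp (g 0).1).eval z 1 * ((P 1).comp (g 0).1).eval z 1 *
        ((P 2).comp (g 0).1).eval z 1) (l₀ l₁ : ℂ) :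
    (∮ z in C(0, 1), (l₀ + l₁ * z) / S z) = ∮ z in C(0, 1), (l₀ + l₁ * z) / S z *
      csqrt (ratio (P 0) (P 1) (P 2) (g 0 0 0 * z + g 0 0 1) (g 0 1 0 * z + g 0 1 1)) := by
  have hD := det_ne_zero' (g 0)
  have hout := isOuterPair_comp hg hw hw'
  set q := (ofImages (g 1) (w 1) (w' 1)).comp (g 0).1 with hq
  set r := (ofImages (g 2) (w 2) (w' 2)).comp (g 0).1 with hr
  obtain ⟨σ₁, hσ₁⟩ := exists_sqrt_of_ne_zero hout.left_ne_zero
  obtain ⟨σ₂, hσ₂⟩ := exists_sqrt_of_ne_zero hout.right_ne_zero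
  set κ : ℂ := k 0 * k 1 * k 2 * (g 0 0 0 * g 0 1 1 - g 0 0 1 * g 0 1 0) ^ 2 with hκ
  have hκ0 : κ ≠ 0 := mul_ne_zero (mul_ne_zero (mul_ne_zero (hk 0) (hk 1)) (hk 2))
    (pow_ne_zero 2 hD)
  set c := csqrt κ with hc
  have hc0 : c ≠ 0 := csqrt_ne_zero hκ0
  have hc2 : c ^ 2 = κ := csqrt_sq κ
  set σ : ℂ → ℂ := fun z => σ₁ z * σ₂ z with hσ
  have hσd : ∀ z, ‖z‖ ≤ 1 → DifferentiableAt ℂ σ z := fun z hz => (hσ₁ z hz).1.mul (hσ₂ z hz).1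
  have hσ2 : ∀ z, ‖z‖ ≤ 1 → σ z ^ 2 = q.eval z 1 * r.eval z 1 := fun z hz => by
    rw [hσ, mul_pow, (hσ₁ z hz).2, (hσ₂ z hz).2]
  have hσ0 : ∀ z, ‖z‖ ≤ 1 → σ z ≠ 0 := fun z hz h0 =>
    mul_ne_zero (hout.left_ne_zero z hz) (hout.right_ne_zero z hz) (by rw [← hσ2 z hz, h0]; simp)
  have hcomp : ∀ (k : ℂ) (p : BinQuad) (m : Matrix (Fin 2) (Fin 2) ℂ),
      (scale k p).comp m = scale k (p.comp m) := by
    intro k p m; ext <;> simp only [scale, comp] <;> ring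
  set T : ℂ → ℂ := fun z => c * (shrunkRoot (w 0) (w' 0) (1, z) * σ z) with hT
  have hn : ∀ z ∈ Metric.sphere (0 : ℂ) 1, ‖z‖ = 1 := fun z hz => by simpa using hz
  have hroot0 : ∀ z ∈ Metric.sphere (0 : ℂ) 1, shrunkRoot (w 0) (w' 0) (1, z) ≠ 0 := fun z hz =>
    rootBranch_ne_zero (by simpa [hn z hz] using hw 0) (by simpa [hn z hz] using hw' 0)
  have hT0 : ∀ z ∈ Metric.sphere (0 : ℂ) 1, T z ≠ 0 := fun z hz =>
    mul_ne_zero hc0 (mul_ne_zero (hroot0 z hz) (hσ0 z (hn z hz).le))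
  have hTc : ContinuousOn T (Metric.sphere 0 1) := by
    intro z hz
    refine (((DifferentiableAt.mul ?_ (hσd z (hn z hz).le)).const_mul c).continuousAt
      ).continuousWithinAt
    exact differentiableAt_slice (F := shrunkRoot (w 0) (w' 0)) (differentiableAt_rootBranch
      (by simpa [hn z hz] using hw 0) (by simpa [hn z hz] using hw' 0))
  have hST : Set.EqOn (S ^ 2) (T ^ 2) (Metric.sphere 0 1) := by
    intro z hz
    have hz0 : z ≠ 0 := norm_pos_iff.mp (by rw [hn z hz]; norm_num)
    simp only [Pi.pow_apply, hS2 z hz, hT, mul_pow, hc2, hσ2 z (hn z hz).le]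
    rw [hP 0, hP 1, hP 2, hcomp, hcomp, hcomp, ofImages_comp, ← hq, ← hr, shrunkRoot,
      rootBranch_sq hz0]
    simp only [eval_scale, eval_ofRoots, hκ]
    ring
  have hratio : ∀ z, ratio (P 0) (P 1) (P 2) (g 0 0 0 * z + g 0 0 1) (g 0 1 0 * z + g 0 1 1)
      = shrunkRatio (w 0) (w' 0) q r (1, z) := by
    intro z
    have := ratio_comp hD (ofImages (g 0) (w 0) (w' 0)) (ofImages (g 1) (w 1) (w' 1))
        (ofImages (g 2) (w 2) (w' 2)) z 1
    rw [ofImages_comp, ratio_scale_left (pow_ne_zero 2 hD)] at this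
    simp only [mul_one] at this
    rw [hP 0, hP 1, hP 2, ratio_scale (hk 0) (hk 1) (hk 2), ← this, shrunkRatio, shrunk]
    simp only [one_mul]
    rfl
  obtain ⟨e, he⟩ : ∃ e : ℂ, ∀ z ∈ Metric.sphere (0 : ℂ) 1, S z = e * T z := by
    have hsph := isPreconnected_sphere (by simp [Complex.rank_real_complex]) (0 : ℂ) 1
    rcases hsph.eq_or_eq_neg_of_sq_eq hS hTc hST (hT0 _) with h | h
    · exact ⟨1, fun z hz => by rw [h hz, one_mul]⟩
    · exact ⟨-1, fun z hz => by rw [h hz, Pi.neg_apply, neg_one_mul]⟩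
  have hmain := period_eq hout hσd hσ2 (hw 0) (hw' 0) (l₀ / (e * c)) (l₁ / (e * c))
  have hF : ∀ z ∈ Metric.sphere (0 : ℂ) 1, (l₀ + l₁ * z) / S z =
      periodF (w 0) (w' 0) σ (l₀ / (e * c)) (l₁ / (e * c)) (1, z) := by
    intro z hz
    rw [he z hz, periodF, hT]
    simp only
    rw [div_mul_eq_mul_div, ← add_div, div_div, mul_assoc e c]
  rw [circleIntegral.integral_congr zero_le_one (fun z hz => hF z hz), hmain]
  refine circleIntegral.integral_congr zero_le_one fun z hz => ?_
  simp only [periodH]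
  rw [hF z hz, hratio]


/-- The periods of `f` and `H` over the boundary of any of the three discs agree, for a branch `S`
of `√f` and the branch `S / √(f / H)` of `√H`, in the coordinate `z` of the disc. -/
theorem circleIntegral_eq_of_sq_eq' {g : Fin 3 → GL (Fin 2) ℂ}
    (hg : Pairwise fun i j => Disjoint (mobiusDisc (g i)) (mobiusDisc (g j))) {w w' : Fin 3 → ℂ}
    (hw : ∀ i, ‖w i‖ < 1) (hw' : ∀ i, ‖w' i‖ < 1) {P : Fin 3 → BinQuad} {k : Fin 3 → ℂ}
    (hk : ∀ i, k i ≠ 0) (hP : ∀ i, P i = scale (k i) (ofImages (g i) (w i) (w' i))) {S : ℂ → ℂ}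
    (hS : ContinuousOn S (Metric.sphere 0 1)) (j : Fin 3)
    (hS2 : ∀ z ∈ Metric.sphere (0 : ℂ) 1, S z ^ 2 =
      ∏ i, (P i).eval (g j 0 0 * z + g j 0 1) (g j 1 0 * z + g j 1 1)) (l₀ l₁ : ℂ) :
    (∮ z in C(0, 1), (l₀ + l₁ * z) / S z) = ∮ z in C(0, 1), (l₀ + l₁ * z) / S z *
      csqrt (ratio (P 0) (P 1) (P 2) (g j 0 0 * z + g j 0 1) (g j 1 0 * z + g j 1 1)) := by
  have hg' : Pairwise fun a b => Disjoint (mobiusDisc (g (a + j))) (mobiusDisc (g (b + j))) :=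
    fun a b hab => hg fun h => hab (add_right_cancel h)
  have key := circleIntegral_eq_of_sq_eq (g := fun i => g (i + j)) hg' (fun i => hw (i + j))
    (fun i => hw' (i + j)) (fun i => hk (i + j)) (fun i => hP (i + j)) hS
    (by
      intro z hz
      rw [hS2 z hz, Fin.prod_univ_three]
      simp only [eval_comp, mul_one]
      fin_cases j <;> simp <;> ring) l₀ l₁
  rw [key]
  refine circleIntegral.integral_congr zero_le_one fun z _ => ?_
  congr 2
  fin_cases j
  · rfl
  · exact ratio_rotate _ _ _ _ _
  · exact (ratio_rotate (P 2) (P 0) (P 1) _ _).symm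

end BinQuad

/-! ### Existence of the branches -/

theorem hform_pos_of_nonneg (g : GL (Fin 2) ℂ) {ρ : ℝ} (h0 : 0 < ρ) (h1 : ρ < 1) {X Y : ℂ}
    (hXY : X ≠ 0 ∨ Y ≠ 0) (h : 0 ≤ hform (discMatrix g 1) X Y) :
    0 < hform (discMatrix g ρ) X Y := by
  obtain ⟨x, y, rfl, rfl⟩ := exists_vec g X Y
  have hx : x ≠ 0 ∨ y ≠ 0 := by
    by_contra! hcon
    simp [hcon] at hXY
  rw [hform_discMatrix_nonneg_iff, one_pow, one_mul] at h
  rw [hform_discMatrix]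
  refine mul_pos (pow_pos (norm_pos_iff.mpr (det_ne_zero' g)) 2) ?_
  have hρ : ρ ^ 2 < 1 := by nlinarith
  have hxp : 0 < ‖x‖ := by
    rw [norm_pos_iff]
    rintro rfl
    rcases hx with hx | hx
    · exact hx rfl
    · have : 0 < ‖y‖ ^ 2 := by positivity
      simp only [norm_zero] at h
      linarith
  nlinarith [sq_nonneg ‖y‖, mul_le_mul_of_nonneg_left h (sq_nonneg ρ), pow_pos hxp 2]

/-- The points of the Riemann sphere at which the Hermitian form is positive. -/
def posRegion (m : Matrix (Fin 2) (Fin 2) ℂ) : Set (OnePoint ℂ) :=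
  {p | ∀ x y : ℂ, (x ≠ 0 ∨ y ≠ 0) → p = toPoint x y → 0 < hform m x y}

theorem toPoint_mem_posRegion {m : Matrix (Fin 2) (Fin 2) ℂ} {x y : ℂ} (h : x ≠ 0 ∨ y ≠ 0) :
    toPoint x y ∈ posRegion m ↔ 0 < hform m x y := by
  refine ⟨fun hp => hp x y h rfl, fun hp x' y' h' he => ?_⟩
  obtain ⟨k, rfl, rfl⟩ := exists_smul_of_cross_eq_zero (cross_eq_zero_of_toPoint_eq he) h'
  rw [hform_smul] at hp
  exact pos_of_mul_pos_right hp (sq_nonneg _)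

theorem coe_mem_posRegion {m : Matrix (Fin 2) (Fin 2) ℂ} {x : ℂ} :
    (x : OnePoint ℂ) ∈ posRegion m ↔ 0 < hform m x 1 := by
  rw [← toPoint_one, toPoint_mem_posRegion (Or.inr one_ne_zero)]

theorem isOpen_posRegion (m : Matrix (Fin 2) (Fin 2) ℂ) : IsOpen (posRegion m) := by
  have hpre : ((↑) ⁻¹' posRegion m : Set ℂ) = {x : ℂ | 0 < hform m x 1} :=
    Set.ext fun x => coe_mem_posRegion
  have hc : Continuous fun x : ℂ => hform m x 1 :=
    (continuous_hform m).comp (f := fun x : ℂ => (x, (1 : ℂ))) (by fun_prop)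
  have ho : IsOpen {x : ℂ | 0 < hform m x 1} := isOpen_lt continuous_const hc
  rw [OnePoint.isOpen_def, hpre]
  refine ⟨fun hinf => ?_, ho⟩
  rw [show (∞ : OnePoint ℂ) = toPoint 1 0 by simp [toPoint],
    toPoint_mem_posRegion (Or.inl one_ne_zero)] at hinf
  refine Metric.isCompact_of_isClosed_isBounded ho.isClosed_compl ?_
  have hc' : Continuous fun y : ℂ => hform m 1 y :=
    (continuous_hform m).comp (f := fun y : ℂ => ((1 : ℂ), y)) (by fun_prop)
  obtain ⟨ε, hε, hball⟩ := Metric.isOpen_iff.mp (isOpen_lt continuous_const hc') 0 hinf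
  refine (Metric.isBounded_closedBall (x := (0 : ℂ)) (r := ε⁻¹)).subset fun x hx => ?_
  rw [mem_closedBall_zero_iff]
  by_contra! hcon
  have hx0 : 0 < ‖x‖ := lt_trans (inv_pos.mpr hε) hcon
  refine hx ?_
  have h1 : 0 < hform m 1 x⁻¹ := hball (by
    rw [mem_ball_zero_iff, norm_inv]
    exact inv_lt_of_inv_lt₀ hε hcon)
  have := hform_smul m x 1 x⁻¹
  rw [mul_one, mul_inv_cancel₀ (norm_pos_iff.mp hx0)] at this
  rw [Set.mem_ofPred_eq, this]
  positivity

theorem exists_toPoint_eq (p : OnePoint ℂ) : ∃ x y : ℂ, (x ≠ 0 ∨ y ≠ 0) ∧ p = toPoint x y := by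
  induction p using OnePoint.rec with
  | infty => exact ⟨1, 0, Or.inl one_ne_zero, by simp [toPoint]⟩
  | coe x => exact ⟨x, 1, Or.inr one_ne_zero, (toPoint_one x).symm⟩

theorem exists_radius {w w' : Fin 3 → ℂ} (hw : ∀ i, ‖w i‖ < 1) (hw' : ∀ i, ‖w' i‖ < 1) :
    ∃ ρ : ℝ, 0 < ρ ∧ ρ < 1 ∧ ∀ i, ‖w i‖ < ρ ∧ ‖w' i‖ < ρ := by
  have h1 : ∀ᶠ ρ : ℝ in nhdsWithin (1 : ℝ) (Set.Iio 1), ∀ i, ‖w i‖ < ρ ∧ ‖w' i‖ < ρ := by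
    refine Filter.eventually_all.mpr fun i => ?_
    filter_upwards [Ioo_mem_nhdsLT (hw i), Ioo_mem_nhdsLT (hw' i)] with ρ h h'
    exact ⟨h.1, h'.1⟩
  obtain ⟨ρ, h, h'⟩ := (h1.and (Ioo_mem_nhdsLT (show (0 : ℝ) < 1 by norm_num))).exists
  exact ⟨ρ, h'.1, h'.2, h⟩

namespace BinQuad

/-- Branches of `√f` and `√H` outside of slightly smaller closed discs: `√f` is a product of square
roots of linear factors, taken in pairs, and `√H` is its quotient by the principal `√(f / H)`. -/
theorem exists_branches {g : Fin 3 → GL (Fin 2) ℂ}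
    (hg : Pairwise fun i j => Disjoint (mobiusDisc (g i)) (mobiusDisc (g j))) {w w' : Fin 3 → ℂ}
    (hw : ∀ i, ‖w i‖ < 1) (hw' : ∀ i, ‖w' i‖ < 1) {P : Fin 3 → BinQuad} {k : Fin 3 → ℂ}
    (hk : ∀ i, k i ≠ 0) (hP : ∀ i, P i = scale (k i) (ofImages (g i) (w i) (w' i))) :
    ∃ (U : Set (OnePoint ℂ)) (s t : ℂ → ℂ), IsOpen U ∧ (⋃ j, mobiusDisc (g j))ᶜ ⊆ U ∧
      ∀ x : ℂ, (x : OnePoint ℂ) ∈ U → DifferentiableAt ℂ s x ∧ DifferentiableAt ℂ t x ∧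
        s x ^ 2 = (P 0).eval x 1 * (P 1).eval x 1 * (P 2).eval x 1 ∧
        t x ^ 2 * (4 * det (P 0) (P 1) (P 2)) = (jac (P 1) (P 2)).eval x 1 *
          (jac (P 2) (P 0)).eval x 1 * (jac (P 0) (P 1)).eval x 1 := by
  obtain ⟨ρ, hρ0, hρ1, hρ⟩ := exists_radius hw hw'
  set A : Fin 3 → ℂ → ℂ := fun i x => g i 1 1 * x - g i 0 1 with hA
  set B : Fin 3 → ℂ → ℂ := fun i x => g i 0 0 - g i 1 0 * x with hB
  set R : Fin 3 → ℂ → ℂ := fun i x => rootBranch (w i * B i x) (w' i * B i x) (A i x) with hR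
  set s : ℂ → ℂ := fun x => csqrt (k 0 * k 1 * k 2) * (R 0 x * R 1 x * R 2 x) with hs
  refine ⟨⋂ i, posRegion (discMatrix (g i) ρ), s,
    fun x => s x / csqrt (ratio (P 0) (P 1) (P 2) x 1),
    isOpen_iInter_of_finite fun i => isOpen_posRegion _, ?_, ?_⟩
  · intro p hp
    obtain ⟨x, y, hxy, rfl⟩ := exists_toPoint_eq p
    simp only [Set.mem_compl_iff, Set.mem_iUnion, not_exists, toPoint_mem_mobiusDisc_iff _ hxy,
      not_lt] at hp
    simp only [Set.mem_iInter, toPoint_mem_posRegion hxy]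
    exact fun i => hform_pos_of_nonneg (g i) hρ0 hρ1 hxy (hp i)
  · intro x hx
    simp only [Set.mem_iInter, coe_mem_posRegion] at hx
    have hAB : ∀ i, ρ * ‖B i x‖ < ‖A i x‖ := by
      intro i
      have h := hx i
      simp only [hform, discMatrix, Matrix.of_apply, Matrix.cons_val, mul_one] at h
      rw [show g i 1 1 * x + -g i 0 1 = A i x by simp only [hA]; ring,
        show -(ρ * g i 1 0) * x + ρ * g i 0 0 = ρ * B i x by simp only [hB]; ring, norm_mul,
        Complex.norm_real, Real.norm_eq_abs, abs_of_pos hρ0, sub_pos] at h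
      exact lt_of_pow_lt_pow_left₀ 2 (norm_nonneg _) h
    have hsm : ∀ i v, ‖v‖ < ρ → ‖v * B i x‖ < ‖A i x‖ := by
      intro i v hv
      rw [norm_mul]
      exact (mul_le_mul_of_nonneg_right hv.le (norm_nonneg _)).trans_lt (hAB i)
    have hA0 : ∀ i, A i x ≠ 0 := fun i =>
      norm_pos_iff.mp ((norm_nonneg _).trans_lt (hsm i _ (hρ i).1))
    have hRd : ∀ i, DifferentiableAt ℂ (R i) x := by
      intro i
      have hAd : DifferentiableAt ℂ (A i) x := by simp only [hA]; fun_prop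
      have hBd : DifferentiableAt ℂ (B i) x := by simp only [hB]; fun_prop
      have key : ∀ v, ‖v‖ < ρ → DifferentiableAt ℂ (fun x => csqrt (1 - v * B i x / A i x)) x := by
        intro v hv
        exact (differentiableAt_csqrt (one_sub_div_mem_slitPlane (hsm i v hv))).comp
          (f := fun x => 1 - v * B i x / A i x) x
          (((hBd.const_mul v).div hAd (hA0 i)).const_sub 1)
      exact hAd.mul ((key _ (hρ i).1).mul (key _ (hρ i).2))
    have hR2 : ∀ i, R i x ^ 2 = (ofImages (g i) (w i) (w' i)).eval x 1 := by
      intro i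
      rw [hR, rootBranch_sq (hA0 i), ofImages, eval_ofRoots]
      simp only [hA, hB]
      ring
    have hsd : DifferentiableAt ℂ s x := (((hRd 0).mul (hRd 1)).mul (hRd 2)).const_mul _
    have hs2 : s x ^ 2 = (P 0).eval x 1 * (P 1).eval x 1 * (P 2).eval x 1 := by
      rw [hs, mul_pow, mul_pow, mul_pow, csqrt_sq, hR2, hR2, hR2, hP 0, hP 1, hP 2, eval_scale,
        eval_scale, eval_scale]
      ring
    obtain ⟨hP0, j1, j2, j3, hd, hr⟩ := ratio_mem_slitPlane
      (m := fun i => discMatrix (g i) ρ)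
      (hform_nonneg_of_shrunk hg (fun _ => hρ0.le) (fun _ => hρ1.le))
      (fun i => hform_discMatrix_coe_neg (g i) (hρ i).1)
      (fun i => hform_discMatrix_coe_neg (g i) (hρ i).2) (X := x) (Y := 1) (Or.inr one_ne_zero)
      (fun i => (hx i).le) hk hP
    have hrd : DifferentiableAt ℂ (fun x => ratio (P 0) (P 1) (P 2) x 1) x := by
      unfold ratio
      refine DifferentiableAt.div ?_ ?_ (mul_ne_zero (mul_ne_zero j1 j2) j3)
      · simp only [eval]; fun_prop
      · simp only [eval]; fun_prop
    have hcs : DifferentiableAt ℂ (fun x => csqrt (ratio (P 0) (P 1) (P 2) x 1)) x :=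
      (differentiableAt_csqrt hr).comp (f := fun x => ratio (P 0) (P 1) (P 2) x 1) x hrd
    refine ⟨hsd, hsd.div hcs
      (csqrt_ne_zero (Complex.slitPlane_ne_zero hr)), hs2, ?_⟩
    rw [div_pow, csqrt_sq, hs2, ratio]
    have := hP0 0
    have := hP0 1
    have := hP0 2
    field_simp

end BinQuad

/-! ### Branches in Möbius coordinates -/

theorem continuousAt_toPoint {v : ℂ × ℂ} (hv : v.1 ≠ 0 ∨ v.2 ≠ 0) :
    ContinuousAt (fun v : ℂ × ℂ => toPoint v.1 v.2) v := by
  by_cases h2 : v.2 = 0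
  · have h1 : v.1 ≠ 0 := hv.resolve_right (not_not.mpr h2)
    rw [ContinuousAt, show toPoint v.1 v.2 = ∞ by simp [toPoint, h2], tendsto_nhds]
    intro U hU hinf
    obtain ⟨-, hK⟩ := (OnePoint.isOpen_iff_of_mem hinf).mp hU
    obtain ⟨R, hR⟩ := hK.isBounded.subset_closedBall (0 : ℂ)
    have hc : ContinuousAt (fun v : ℂ × ℂ => ‖v.1‖ - R * ‖v.2‖) v := by fun_prop
    have hpos : 0 < ‖v.1‖ - R * ‖v.2‖ := by simpa [h2] using h1
    filter_upwards [hc.eventually (lt_mem_nhds hpos)] with u hu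
    rw [Set.mem_preimage]
    by_cases hu2 : u.2 = 0
    · simpa [toPoint, hu2] using hinf
    · simp only [toPoint, if_neg hu2]
      by_contra hcon
      have := hR (show u.1 / u.2 ∈ ((↑) ⁻¹' Uᶜ : Set ℂ) from hcon)
      rw [mem_closedBall_zero_iff, norm_div, div_le_iff₀ (norm_pos_iff.mpr hu2)] at this
      linarith
  · have hc : ContinuousAt (fun v : ℂ × ℂ => ((v.1 / v.2 : ℂ) : OnePoint ℂ)) v :=
      OnePoint.continuous_coe.continuousAt.comp (f := fun v : ℂ × ℂ => v.1 / v.2)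
        (ContinuousAt.div (by fun_prop) (by fun_prop) h2)
    refine hc.congr ?_
    have : ContinuousAt (fun v : ℂ × ℂ => v.2) v := by fun_prop
    filter_upwards [this.eventually_ne h2] with u hu
    simp [toPoint, hu]

theorem continuous_smul_coe (g : GL (Fin 2) ℂ) :
    Continuous fun z : ℂ => g • (z : OnePoint ℂ) := by
  simp only [smul_coe_eq_toPoint]
  refine continuous_iff_continuousAt.mpr fun z => ?_
  exact (continuousAt_toPoint (v := (g 0 0 * z + g 0 1, g 1 0 * z + g 1 1))
    (coe_vec_ne_zero g z)).comp (f := fun z : ℂ => (g 0 0 * z + g 0 1, g 1 0 * z + g 1 1))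
    (by fun_prop)

/-- A branch of the square root of a binary sextic form, transformed to the coordinate `ζ` with
`x = h ζ`, is continuous also at the pole of `h`: its square is a polynomial, so the singularity at
the pole is removable. -/
theorem exists_pullback {U : Set (OnePoint ℂ)} (hU : IsOpen U) {s : ℂ → ℂ}
    (hs : DifferentiableOn ℂ s {x : ℂ | (x : OnePoint ℂ) ∈ U}) {Q : Fin 3 → BinQuad}
    (hs2 : ∀ x : ℂ, (x : OnePoint ℂ) ∈ U → s x ^ 2 = ∏ i, (Q i).eval x 1) (h : GL (Fin 2) ℂ) :
    ∃ s' : ℂ → ℂ, ContinuousOn s' {ζ : ℂ | h • (ζ : OnePoint ℂ) ∈ U} ∧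
      (∀ ζ : ℂ, h • (ζ : OnePoint ℂ) ∈ U →
        s' ζ ^ 2 = ∏ i, (Q i).eval (h 0 0 * ζ + h 0 1) (h 1 0 * ζ + h 1 1)) ∧
      ∀ ζ : ℂ, h 1 0 * ζ + h 1 1 ≠ 0 → s' ζ = (h 1 0 * ζ + h 1 1) ^ 3 * s (mobius h ζ) := by
  set V : Set ℂ := {ζ : ℂ | h • (ζ : OnePoint ℂ) ∈ U} with hV
  have hVo : IsOpen V := hU.preimage (continuous_smul_coe h)
  have hUo : IsOpen {x : ℂ | (x : OnePoint ℂ) ∈ U} := hU.preimage OnePoint.continuous_coe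
  set s₁ : ℂ → ℂ := fun ζ => (h 1 0 * ζ + h 1 1) ^ 3 * s (mobius h ζ) with hs₁
  set F : ℂ → ℂ := fun ζ => ∏ i, (Q i).eval (h 0 0 * ζ + h 0 1) (h 1 0 * ζ + h 1 1) with hF
  have hFc : Continuous F := by simp only [hF, BinQuad.eval]; fun_prop
  have hd : ∀ ζ ∈ V, h 1 0 * ζ + h 1 1 ≠ 0 → DifferentiableAt ℂ s₁ ζ := by
    intro ζ hζ h0
    have hm : DifferentiableAt ℂ (mobius h) ζ := by
      unfold mobius
      exact DifferentiableAt.div (by fun_prop) (by fun_prop) h0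
    have hmem : mobius h ζ ∈ {x : ℂ | (x : OnePoint ℂ) ∈ U} := by
      change ((mobius h ζ : ℂ) : OnePoint ℂ) ∈ U
      rw [coe_mobius h ζ h0]; exact hζ
    have := ((hs.differentiableAt (hUo.mem_nhds hmem)).comp ζ hm)
    exact DifferentiableAt.mul (by fun_prop) this
  have hsq : ∀ ζ ∈ V, h 1 0 * ζ + h 1 1 ≠ 0 → s₁ ζ ^ 2 = F ζ := by
    intro ζ hζ h0
    have hmem : ((mobius h ζ : ℂ) : OnePoint ℂ) ∈ U := by
      rw [coe_mobius h ζ h0]; exact hζ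
    have hev : ∀ i, (Q i).eval (h 0 0 * ζ + h 0 1) (h 1 0 * ζ + h 1 1)
        = (h 1 0 * ζ + h 1 1) ^ 2 * (Q i).eval (mobius h ζ) 1 := by
      intro i
      rw [← BinQuad.eval_smul_smul, mobius, mul_one, mul_div_cancel₀ _ h0]
    simp only [hs₁, hF, hev, mul_pow, hs2 _ hmem, Fin.prod_univ_three]
    ring
  by_cases hp : ∃ ζ₀ ∈ V, h 1 0 * ζ₀ + h 1 1 = 0
  · obtain ⟨ζ₀, hζ₀, hz⟩ := hp
    have hc : h 1 0 ≠ 0 := by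
      intro h0
      have := det_ne_zero' h
      have h1 : h 1 1 = 0 := by simpa [h0] using hz
      simp [h0, h1] at this
    have hpole : ∀ ζ, ζ ≠ ζ₀ → h 1 0 * ζ + h 1 1 ≠ 0 := by
      intro ζ hne h0
      exact hne (mul_left_cancel₀ hc (by linear_combination h0 - hz))
    set s' : ℂ → ℂ := Function.update s₁ ζ₀ (Filter.limUnder (nhdsWithin ζ₀ {ζ₀}ᶜ) s₁) with hs'
    set N : Set ℂ := V ∩ {ζ | ‖F ζ‖ < ‖F ζ₀‖ + 1} with hN
    have hNn : N ∈ nhds ζ₀ := Filter.inter_mem (hVo.mem_nhds hζ₀)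
      ((isOpen_lt hFc.norm continuous_const).mem_nhds (by simp))
    have hdN : DifferentiableOn ℂ s' N := by
      refine Complex.differentiableOn_update_limUnder_of_bddAbove hNn ?_ ?_
      · intro ζ hζ
        exact (hd ζ hζ.1.1 (hpole ζ hζ.2)).differentiableWithinAt
      · refine ⟨‖F ζ₀‖ + 2, ?_⟩
        rintro _ ⟨ζ, hζ, rfl⟩
        have h1 : ‖s₁ ζ‖ ^ 2 = ‖F ζ‖ := by
          rw [← norm_pow, hsq ζ hζ.1.1 (hpole ζ hζ.2)]
        have h2 : ‖F ζ‖ < ‖F ζ₀‖ + 1 := hζ.1.2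
        simp only [Function.comp_apply]
        nlinarith [sq_nonneg (‖s₁ ζ‖ - 1)]
    have hc0 : ContinuousAt s' ζ₀ := (hdN.differentiableAt hNn).continuousAt
    have heq : ∀ ζ, ζ ≠ ζ₀ → s' ζ = s₁ ζ := fun ζ hζ => Function.update_of_ne hζ _ _
    refine ⟨s', ?_, ?_, ?_⟩
    · intro ζ hζ
      by_cases hne : ζ = ζ₀
      · subst hne; exact hc0.continuousWithinAt
      · refine ContinuousAt.continuousWithinAt ?_
        refine (hd ζ hζ (hpole ζ hne)).continuousAt.congr ?_
        filter_upwards [isOpen_ne.mem_nhds hne] with u hu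
        exact (heq u hu).symm
    · intro ζ hζ
      by_cases hne : ζ = ζ₀
      · subst hne
        have t1 : Filter.Tendsto (fun u => s' u ^ 2) (nhdsWithin ζ {ζ}ᶜ) (nhds (s' ζ ^ 2)) :=
          (hc0.pow 2).tendsto.mono_left nhdsWithin_le_nhds
        have t2 : Filter.Tendsto F (nhdsWithin ζ {ζ}ᶜ) (nhds (F ζ)) :=
          hFc.continuousAt.tendsto.mono_left nhdsWithin_le_nhds
        refine tendsto_nhds_unique (t1.congr' ?_) t2
        filter_upwards [nhdsWithin_le_nhds (hVo.mem_nhds hζ), self_mem_nhdsWithin] with u hu hu'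
        rw [heq u hu', hsq u hu (hpole u hu')]
      · rw [heq ζ hne]; exact hsq ζ hζ (hpole ζ hne)
    · intro ζ h0
      exact heq ζ (by rintro rfl; exact h0 hz)
  · push Not at hp
    exact ⟨s₁, fun ζ hζ => (hd ζ hζ (hp ζ hζ)).continuousAt.continuousWithinAt,
      fun ζ hζ => hsq ζ hζ (hp ζ hζ), fun ζ _ => rfl⟩

/-! ### Connectedness of the boundary circles -/

/-- A circle in the unit disc is joined to the unit circle by a segment that avoids another disc:
the segment points away from the centre of the other disc. -/
theorem exists_isPreconnected_of_disc {c₁ c₂ : ℂ} {r₁ r₂ : ℝ} (h₁ : 0 < r₁) (h₂ : 0 < r₂)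
    (hb₁ : Metric.ball c₁ r₁ ⊆ Metric.closedBall 0 1)
    (hb₂ : Metric.ball c₂ r₂ ⊆ Metric.closedBall 0 1) (hd : r₁ + r₂ ≤ dist c₁ c₂) :
    ∃ W : Set ℂ, IsPreconnected W ∧ Metric.sphere 0 1 ⊆ W ∧ Metric.sphere c₁ r₁ ⊆ W ∧
      ∀ ζ ∈ W, ‖ζ‖ ≤ 1 ∧ r₁ ≤ dist ζ c₁ ∧ r₂ ≤ dist ζ c₂ := by
  have hrank : 1 < Module.rank ℝ ℂ := by simp [Complex.rank_real_complex]
  have hcl : Metric.closedBall c₁ r₁ ⊆ Metric.closedBall 0 1 := by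
    rw [← closure_ball c₁ h₁.ne']
    exact closure_minimal hb₁ Metric.isClosed_closedBall
  have hint : ∀ (c : ℂ) (r : ℝ), Metric.ball c r ⊆ Metric.closedBall 0 1 →
      ∀ ζ : ℂ, ‖ζ‖ = 1 → r ≤ dist ζ c := by
    intro c r hb ζ hζ
    by_contra! hcon
    have := interior_maximal hb Metric.isOpen_ball (Metric.mem_ball.mpr hcon)
    rw [interior_closedBall (0 : ℂ) one_ne_zero, mem_ball_zero_iff] at this
    linarith
  have hd0 : 0 < ‖c₁ - c₂‖ := by rw [← dist_eq_norm]; linarith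
  set u : ℂ := (c₁ - c₂) / ‖c₁ - c₂‖ with hu
  have hun : ‖u‖ = 1 := by
    rw [hu, norm_div, Complex.norm_real, norm_norm, div_self hd0.ne']
  have hu2 : c₁ - c₂ = (‖c₁ - c₂‖ : ℂ) * u := by
    have : (‖c₁ - c₂‖ : ℂ) ≠ 0 := by exact_mod_cast hd0.ne'
    rw [hu]; field_simp
  set p : ℝ → ℂ := fun τ => c₁ + τ * u with hp
  have hpc : Continuous p := by simp only [hp]; fun_prop
  have hp1 : ∀ τ : ℝ, 0 ≤ τ → dist (p τ) c₁ = τ := by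
    intro τ hτ
    rw [dist_eq_norm, hp]
    simp [hun, abs_of_nonneg hτ]
  have hp2 : ∀ τ : ℝ, 0 ≤ τ → dist (p τ) c₂ = ‖c₁ - c₂‖ + τ := by
    intro τ hτ
    rw [dist_eq_norm, show p τ - c₂ = ((‖c₁ - c₂‖ + τ : ℝ) : ℂ) * u by
      simp only [hp]; push_cast; linear_combination hu2, norm_mul, hun, Complex.norm_real, mul_one,
      Real.norm_of_nonneg (by linarith)]
  have hstart : ‖p r₁‖ ≤ 1 := by
    have : p r₁ ∈ Metric.closedBall c₁ r₁ := by rw [Metric.mem_closedBall, hp1 r₁ h₁.le]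
    simpa using hcl this
  obtain ⟨τ₁, hτ₁, hend⟩ : ∃ τ₁, r₁ ≤ τ₁ ∧ ‖p τ₁‖ = 1 := by
    set T : ℝ := r₁ + 1 + ‖c₁‖ with hT
    have hT1 : r₁ ≤ T := by have := norm_nonneg c₁; linarith
    have hbig : 1 ≤ ‖p T‖ := by
      have h3 := dist_triangle (p T) 0 c₁
      rw [hp1 T (h₁.le.trans hT1), dist_zero_right, dist_zero_left] at h3
      linarith
    obtain ⟨τ, hτ, hτe⟩ := intermediate_value_Icc hT1 (hpc.norm.continuousOn) ⟨hstart, hbig⟩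
    exact ⟨τ, hτ.1, hτe⟩
  refine ⟨Metric.sphere c₁ r₁ ∪ p '' Set.Icc r₁ τ₁ ∪ Metric.sphere 0 1, ?_,
    Set.subset_union_right, Set.subset_union_left.trans Set.subset_union_left, ?_⟩
  · refine IsPreconnected.union (p τ₁) (Or.inr ⟨τ₁, ⟨hτ₁, le_rfl⟩, rfl⟩) (by simpa using hend) ?_
      (isPreconnected_sphere hrank 0 1)
    refine IsPreconnected.union (p r₁) (by rw [Metric.mem_sphere, hp1 r₁ h₁.le])
      ⟨r₁, ⟨le_rfl, hτ₁⟩, rfl⟩ (isPreconnected_sphere hrank c₁ r₁) ?_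
    exact isPreconnected_Icc.image p hpc.continuousOn
  · rintro ζ ((hζ | ⟨τ, hτ, rfl⟩) | hζ)
    · rw [Metric.mem_sphere] at hζ
      refine ⟨by simpa using hcl (Metric.mem_closedBall.mpr hζ.le), hζ.ge, ?_⟩
      have := dist_triangle c₁ ζ c₂
      rw [dist_comm c₁ ζ, hζ] at this
      linarith
    · have hτ0 : 0 ≤ τ := h₁.le.trans hτ.1
      refine ⟨?_, by rw [hp1 τ hτ0]; exact hτ.1, ?_⟩
      · have hseg : p τ ∈ segment ℝ (p r₁) (p τ₁) := by
          have : τ ∈ segment ℝ r₁ τ₁ := by rw [segment_eq_Icc hτ₁]; exact hτ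
          obtain ⟨a, b, ha, hb, hab, rfl⟩ := this
          refine ⟨a, b, ha, hb, hab, ?_⟩
          have hab' : (a : ℂ) + b = 1 := by exact_mod_cast hab
          simp only [hp, Complex.real_smul, smul_eq_mul]
          push_cast
          linear_combination c₁ * hab'
        have := (convex_closedBall (0 : ℂ) 1).segment_subset
          (by simpa using hstart) (by simpa using hend.le) hseg
        simpa using this
      · rw [hp2 τ hτ0, ← dist_eq_norm]; linarith
    · have hn : ‖ζ‖ = 1 := by simpa using hζ
      exact ⟨hn.le, hint c₁ r₁ hb₁ ζ hn, hint c₂ r₂ hb₂ ζ hn⟩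

theorem exists_isPreconnected_of_discs {c₁ c₂ : ℂ} {r₁ r₂ : ℝ} (h₁ : 0 < r₁) (h₂ : 0 < r₂)
    (hb₁ : Metric.ball c₁ r₁ ⊆ Metric.closedBall 0 1)
    (hb₂ : Metric.ball c₂ r₂ ⊆ Metric.closedBall 0 1) (hd : r₁ + r₂ ≤ dist c₁ c₂) :
    ∃ W : Set ℂ, IsPreconnected W ∧ Metric.sphere 0 1 ⊆ W ∧ Metric.sphere c₁ r₁ ⊆ W ∧
      Metric.sphere c₂ r₂ ⊆ W ∧ ∀ ζ ∈ W, ‖ζ‖ ≤ 1 ∧ r₁ ≤ dist ζ c₁ ∧ r₂ ≤ dist ζ c₂ := by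
  obtain ⟨W, hW, h0, hs, hi⟩ := exists_isPreconnected_of_disc h₁ h₂ hb₁ hb₂ hd
  obtain ⟨W', hW', h0', hs', hi'⟩ := exists_isPreconnected_of_disc h₂ h₁ hb₂ hb₁
    (by rw [dist_comm]; linarith)
  refine ⟨W ∪ W', hW.union 1 (h0 (by simp)) (h0' (by simp)) hW', h0.trans Set.subset_union_left,
    hs.trans Set.subset_union_left, hs'.trans Set.subset_union_right, ?_⟩
  rintro ζ (hζ | hζ)
  · exact hi ζ hζ
  · exact ⟨(hi' ζ hζ).1, (hi' ζ hζ).2.2, (hi' ζ hζ).2.1⟩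

/-- In an affine coordinate, a disc whose closure does not contain `∞` is a round disc. -/
theorem exists_hform_eq {m : Matrix (Fin 2) (Fin 2) ℂ} (hA : 0 < hform m 1 0)
    (hm : m 0 0 * m 1 1 - m 0 1 * m 1 0 ≠ 0) : ∃ (c : ℂ) (r : ℝ), 0 < r ∧
      ∀ ζ : ℂ, hform m ζ 1 = hform m 1 0 * (dist ζ c ^ 2 - r ^ 2) := by
  set A := hform m 1 0 with hAd
  set β : ℂ := m 0 1 * star (m 0 0) - m 1 1 * star (m 1 0) with hβ
  refine ⟨-β / A, ‖m 0 0 * m 1 1 - m 0 1 * m 1 0‖ / A, div_pos (norm_pos_iff.mpr hm) hA, ?_⟩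
  intro ζ
  have hAc : (A : ℂ) ≠ 0 := by exact_mod_cast hA.ne'
  have hdist : dist ζ (-β / A) = ‖A * ζ + β‖ / A := by
    rw [dist_eq_norm, show ζ - -β / A = (A * ζ + β) / A by field_simp; ring, norm_div,
      Complex.norm_real, Real.norm_of_nonneg hA.le]
  rw [hdist]
  field_simp
  have hA' : A = ‖m 0 0‖ ^ 2 - ‖m 1 0‖ ^ 2 := by simp [hAd, hform]
  rw [hform, hβ]
  simp only [← Complex.normSq_eq_norm_sq, Complex.normSq_apply] at hA' ⊢
  simp
  rw [hA']
  ring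

theorem coe_notMem_iUnion_iff {g : Fin 3 → GL (Fin 2) ℂ} {p : OnePoint ℂ} {X Y : ℂ}
    (hp : p = toPoint X Y) (h : X ≠ 0 ∨ Y ≠ 0) :
    p ∈ (⋃ j, mobiusDisc (g j))ᶜ ↔ ∀ i, 0 ≤ hform (discMatrix (g i) 1) X Y := by
  simp only [hp, Set.mem_compl_iff, Set.mem_iUnion, not_exists, toPoint_mem_mobiusDisc_iff _ h,
    not_lt]

namespace BinQuad

theorem continuousAt_csqrt_ratio {p q r : BinQuad} {X Y : ℂ} (h₁ : (jac q r).eval X Y ≠ 0)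
    (h₂ : (jac r p).eval X Y ≠ 0) (h₃ : (jac p q).eval X Y ≠ 0)
    (h : ratio p q r X Y ∈ Complex.slitPlane) :
    ContinuousAt (fun v : ℂ × ℂ => csqrt (ratio p q r v.1 v.2)) (X, Y) := by
  have hr : ContinuousAt (fun v : ℂ × ℂ => ratio p q r v.1 v.2) (X, Y) := by
    unfold ratio
    refine ContinuousAt.div ?_ ?_ (mul_ne_zero (mul_ne_zero h₁ h₂) h₃)
    · simp only [eval]; fun_prop
    · simp only [eval]; fun_prop
  have hc : ContinuousAt csqrt (ratio p q r X Y) := (differentiableAt_csqrt h).continuousAt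
  exact ContinuousAt.comp_of_eq hc hr rfl

/-- The factors of the Richelot transform, the first one with the constant factor. -/
def richelotFactor (P : Fin 3 → BinQuad) : Fin 3 → BinQuad :=
  ![scale (1 / (4 * det (P 0) (P 1) (P 2))) (jac (P 1) (P 2)), jac (P 2) (P 0), jac (P 0) (P 1)]

theorem prod_richelotFactor_mul_ratio {P : Fin 3 → BinQuad} {X Y : ℂ}
    (h₁ : (jac (P 1) (P 2)).eval X Y ≠ 0) (h₂ : (jac (P 2) (P 0)).eval X Y ≠ 0)
    (h₃ : (jac (P 0) (P 1)).eval X Y ≠ 0) (hd : det (P 0) (P 1) (P 2) ≠ 0) :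
    (∏ i, (richelotFactor P i).eval X Y) * ratio (P 0) (P 1) (P 2) X Y
      = ∏ i, (P i).eval X Y := by
  simp only [Fin.prod_univ_three, richelotFactor, Matrix.cons_val, eval_scale, ratio]
  field_simp

/-- Arbitrary branches `s` of `√f` and `t` of `√H` satisfy `s = ± t √(f / H)` with one sign on the
three boundary circles, which lie in a connected subset of the complement of the discs. -/
theorem exists_sign {g : Fin 3 → GL (Fin 2) ℂ}
    (hg : Pairwise fun i j => Disjoint (mobiusDisc (g i)) (mobiusDisc (g j))) {w w' : Fin 3 → ℂ}
    (hw : ∀ i, ‖w i‖ < 1) (hw' : ∀ i, ‖w' i‖ < 1) {P : Fin 3 → BinQuad} {k : Fin 3 → ℂ}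
    (hk : ∀ i, k i ≠ 0) (hP : ∀ i, P i = scale (k i) (ofImages (g i) (w i) (w' i)))
    {U U' : Set (OnePoint ℂ)} (hU : IsOpen U) (hU' : IsOpen U')
    (hKU : (⋃ j, mobiusDisc (g j))ᶜ ⊆ U) (hKU' : (⋃ j, mobiusDisc (g j))ᶜ ⊆ U') {s t : ℂ → ℂ}
    (hs : DifferentiableOn ℂ s {x : ℂ | (x : OnePoint ℂ) ∈ U})
    (ht : DifferentiableOn ℂ t {x : ℂ | (x : OnePoint ℂ) ∈ U'})
    (hs2 : ∀ x : ℂ, (x : OnePoint ℂ) ∈ U → s x ^ 2 = ∏ i, (P i).eval x 1)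
    (ht2 : ∀ x : ℂ, (x : OnePoint ℂ) ∈ U' → t x ^ 2 = ∏ i, (richelotFactor P i).eval x 1) :
    ∃ η : ℂ, (η = 1 ∨ η = -1) ∧ ∀ j (x : ℂ), hform (discMatrix (g j) 1) x 1 = 0 →
      s x = η * (t x * csqrt (ratio (P 0) (P 1) (P 2) x 1)) := by
  have hD := det_ne_zero' (g 0)
  -- The coordinate `ζ` in which the first disc is the exterior of the unit circle.
  obtain ⟨h, h00, h01, h10, h11⟩ : ∃ h : GL (Fin 2) ℂ, h 0 0 = g 0 0 1 ∧ h 0 1 = g 0 0 0 ∧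
      h 1 0 = g 0 1 1 ∧ h 1 1 = g 0 1 0 := by
    refine ⟨Matrix.GeneralLinearGroup.mkOfDetNeZero !![g 0 0 1, g 0 0 0; g 0 1 1, g 0 1 0] ?_,
      rfl, rfl, rfl, rfl⟩
    rw [Matrix.det_fin_two_of]
    exact fun h0 => hD (by linear_combination -h0)
  set X : ℂ → ℂ := fun ζ => h 0 0 * ζ + h 0 1 with hX
  set Y : ℂ → ℂ := fun ζ => h 1 0 * ζ + h 1 1 with hY
  have hXY : ∀ ζ, X ζ ≠ 0 ∨ Y ζ ≠ 0 := fun ζ => coe_vec_ne_zero h ζ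
  have hform0 : ∀ ζ, 0 ≤ hform (discMatrix (g 0) 1) (X ζ) (Y ζ) ↔ ‖ζ‖ ≤ 1 := by
    intro ζ
    have := hform_discMatrix_nonneg_iff (g 0) 1 1 ζ
    rw [show g 0 0 0 * 1 + g 0 0 1 * ζ = X ζ by simp only [hX, h00, h01]; ring,
      show g 0 1 0 * 1 + g 0 1 1 * ζ = Y ζ by simp only [hY, h10, h11]; ring] at this
    rw [this]
    simp only [one_pow, norm_one, one_mul, sq_le_one_iff_abs_le_one, abs_norm]
  have hround : ∀ i, i ≠ 0 → ∃ (c : ℂ) (r A : ℝ), 0 < r ∧ 0 < A ∧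
      ∀ ζ, hform (discMatrix (g i) 1) (X ζ) (Y ζ) = A * (dist ζ c ^ 2 - r ^ 2) := by
    intro i hi
    have e0 := hform_discMatrix_coe_neg (g 0) (ρ := 1) (w := 0) (by simp)
    simp only [mul_zero, zero_add] at e0
    have e1 : 0 < hform (discMatrix (g i) 1 * h.1) 1 0 := by
      rw [hform_mul_matrix]
      simp only [mul_one, mul_zero, add_zero, h00, h10]
      by_contra! hcon
      exact absurd e0 (not_lt.mpr (hform_nonneg_of_disjoint_of_nonpos (hg hi) hcon))
    obtain ⟨c, r, hr, hc⟩ := exists_hform_eq e1 (by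
      have e2 : (discMatrix (g i) 1 * h.1).det ≠ 0 := by
        rw [Matrix.det_mul]
        refine mul_ne_zero ?_ h.det_ne_zero
        rw [discMatrix, Matrix.det_fin_two_of]
        have := det_ne_zero' (g i)
        intro h0
        apply this
        push_cast at h0
        linear_combination h0
      rwa [Matrix.det_fin_two] at e2)
    refine ⟨c, r, _, hr, e1, fun ζ => ?_⟩
    rw [← hc, hform_mul_matrix]
    simp only [mul_one, hX, hY]
  obtain ⟨c₁, r₁, A₁, hr₁, hA₁, hc₁⟩ := hround 1 (by decide)
  obtain ⟨c₂, r₂, A₂, hr₂, hA₂, hc₂⟩ := hround 2 (by decide)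
  have hneg : ∀ {A r : ℝ} {c ζ : ℂ}, 0 < A → ζ ∈ Metric.ball c r →
      A * (dist ζ c ^ 2 - r ^ 2) < 0 := by
    intro A r c ζ hA hζ
    have := Metric.mem_ball.mp hζ
    have := dist_nonneg (x := ζ) (y := c)
    exact mul_neg_of_pos_of_neg hA (by nlinarith)
  have hball : ∀ i, i ≠ 0 → ∀ {A r : ℝ} {c : ℂ}, 0 < A →
      (∀ ζ, hform (discMatrix (g i) 1) (X ζ) (Y ζ) = A * (dist ζ c ^ 2 - r ^ 2)) →
      Metric.ball c r ⊆ Metric.closedBall 0 1 := by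
    intro i hi A r c hA hc ζ hζ
    rw [mem_closedBall_zero_iff, ← hform0]
    exact hform_nonneg_of_disjoint (hg hi) ((hc ζ).trans_lt (hneg hA hζ))
  have hdist : r₁ + r₂ ≤ dist c₁ c₂ := by
    rw [← disjoint_ball_ball_iff hr₁ hr₂, Set.disjoint_left]
    intro ζ h1 h2
    exact absurd (hform_nonneg_of_disjoint (hg (by decide : (1 : Fin 3) ≠ 2))
      ((hc₁ ζ).trans_lt (hneg hA₁ h1))) (not_le.mpr ((hc₂ ζ).trans_lt (hneg hA₂ h2)))
  obtain ⟨W, hWc, hW0, hW1, hW2, hWi⟩ := exists_isPreconnected_of_discs hr₁ hr₂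
    (hball 1 (by decide) hA₁ hc₁) (hball 2 (by decide) hA₂ hc₂) hdist
  have hnn : ∀ ζ ∈ W, ∀ i, 0 ≤ hform (discMatrix (g i) 1) (X ζ) (Y ζ) := by
    intro ζ hζ i
    obtain ⟨k0, k1, k2⟩ := hWi ζ hζ
    fin_cases i
    · exact (hform0 ζ).mpr k0
    · refine (mul_nonneg hA₁.le ?_).trans_eq (hc₁ ζ).symm
      nlinarith
    · refine (mul_nonneg hA₂.le ?_).trans_eq (hc₂ ζ).symm
      nlinarith
  have hWK : ∀ ζ ∈ W, h • (ζ : OnePoint ℂ) ∈ (⋃ j, mobiusDisc (g j))ᶜ := fun ζ hζ =>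
    (coe_notMem_iUnion_iff (smul_coe_eq_toPoint h ζ) (hXY ζ)).mpr (hnn ζ hζ)
  have hratio := fun ζ (hζ : ζ ∈ W) => ratio_mem_slitPlane (m := fun i => discMatrix (g i) 1)
    (hform_nonneg_of_shrunk hg (ρ := fun _ => 1) (fun _ => zero_le_one) (fun _ => le_rfl))
    (fun i => hform_discMatrix_coe_neg (g i) (hw i))
    (fun i => hform_discMatrix_coe_neg (g i) (hw' i)) (hXY ζ) (hnn ζ hζ) hk hP
  obtain ⟨s', hsc, hs2', hsm⟩ := exists_pullback hU hs hs2 h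
  obtain ⟨t', htc, ht2', htm⟩ := exists_pullback hU' ht ht2 h
  set T : ℂ → ℂ := fun ζ => t' ζ * csqrt (ratio (P 0) (P 1) (P 2) (X ζ) (Y ζ)) with hT
  have hTc : ContinuousOn T W := by
    refine (htc.mono fun ζ hζ => hKU' (hWK ζ hζ)).mul fun ζ hζ => ?_
    obtain ⟨-, j1, j2, j3, -, hr⟩ := hratio ζ hζ
    exact (ContinuousAt.comp (f := fun ζ => (X ζ, Y ζ)) (continuousAt_csqrt_ratio j1 j2 j3 hr)
      (by simp only [hX, hY]; fun_prop)).continuousWithinAt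
  have hT2 : ∀ ζ ∈ W, T ζ ^ 2 = ∏ i, (P i).eval (X ζ) (Y ζ) := by
    intro ζ hζ
    obtain ⟨-, j1, j2, j3, hd, -⟩ := hratio ζ hζ
    rw [hT, mul_pow, csqrt_sq, ht2' ζ (hKU' (hWK ζ hζ)), prod_richelotFactor_mul_ratio j1 j2 j3 hd]
  have hT0 : ∀ ζ ∈ W, T ζ ≠ 0 := by
    intro ζ hζ h0
    have := hT2 ζ hζ
    rw [h0, zero_pow two_ne_zero] at this
    exact Finset.prod_ne_zero_iff.mpr (fun i _ => (hratio ζ hζ).1 i) this.symm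
  obtain ⟨η, hη, hST⟩ : ∃ η : ℂ, (η = 1 ∨ η = -1) ∧ ∀ ζ ∈ W, s' ζ = η * T ζ := by
    rcases hWc.eq_or_eq_neg_of_sq_eq (hsc.mono fun ζ hζ => hKU (hWK ζ hζ)) hTc
      (fun ζ hζ => by
        simp only [Pi.pow_apply]
        rw [hT2 ζ hζ, hs2' ζ (hKU (hWK ζ hζ))]) (hT0 _) with he | he
    · exact ⟨1, Or.inl rfl, fun z hz => by rw [he hz, one_mul]⟩
    · exact ⟨-1, Or.inr rfl, fun z hz => by rw [he hz, Pi.neg_apply, neg_one_mul]⟩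
  refine ⟨η, hη, fun j x hx => ?_⟩
  obtain ⟨y₁, y₂, hx1, hx2⟩ := exists_vec (g 0) x 1
  have hy : y₁ ≠ 0 := by
    rintro rfl
    have h0 : 0 ≤ hform (discMatrix (g 0) 1) x 1 := by
      by_cases hj : j = 0
      · exact hj ▸ hx.ge
      · exact hform_nonneg_of_disjoint_of_nonpos (hg hj) hx.le
    rw [hx1, hx2, hform_discMatrix_nonneg_iff] at h0
    have hy2 : ‖y₂‖ ^ 2 ≤ 0 := by simpa using h0
    have hy2' : y₂ = 0 := by
      have := le_antisymm hy2 (sq_nonneg _)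
      simpa using this
    simp [hy2'] at hx2
  set ζ := y₂ / y₁ with hζ
  have hXζ : X ζ = y₁⁻¹ * x := by
    simp only [hX, h00, h01, hζ, hx1]; field_simp; ring
  have hYζ : Y ζ = y₁⁻¹ * 1 := by
    rw [hx2]; simp only [hY, h10, h11, hζ]; field_simp; ring
  have hz0 : hform (discMatrix (g j) 1) (X ζ) (Y ζ) = 0 := by
    rw [hXζ, hYζ, hform_smul, hx, mul_zero]
  have hsph : ∀ {A r : ℝ} {c : ℂ}, 0 < A → 0 < r → 0 = A * (dist ζ c ^ 2 - r ^ 2) →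
      ζ ∈ Metric.sphere c r := by
    intro A r c hA hr h0
    have h1 := (mul_eq_zero.mp h0.symm).resolve_left hA.ne'
    exact (pow_left_inj₀ dist_nonneg hr.le two_ne_zero).mp (by linarith)
  have hζW : ζ ∈ W := by
    obtain rfl | rfl | rfl : j = 0 ∨ j = 1 ∨ j = 2 := by fin_cases j <;> simp
    · refine hW0 ?_
      rw [hx1, hx2, hform_discMatrix] at hx
      have h1 := (mul_eq_zero.mp hx).resolve_left
        (pow_ne_zero 2 (norm_ne_zero_iff.mpr hD))
      have h2 : ‖y₁‖ = ‖y₂‖ :=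
        (pow_left_inj₀ (norm_nonneg _) (norm_nonneg _) two_ne_zero).mp (by linarith)
      rw [mem_sphere_zero_iff_norm, hζ, norm_div, h2, div_self]
      rw [← h2]; exact norm_ne_zero_iff.mpr hy
    · exact hW1 (hsph hA₁ hr₁ (hz0 ▸ hc₁ ζ))
    · exact hW2 (hsph hA₂ hr₂ (hz0 ▸ hc₂ ζ))
  have hYne : h 1 0 * ζ + h 1 1 ≠ 0 := by
    change Y ζ ≠ 0
    rw [hYζ]; simpa using hy
  have hmob : mobius h ζ = x := by
    change X ζ / Y ζ = x
    rw [hXζ, hYζ]; field_simp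
  have hfin := hST ζ hζW
  simp only [hT] at hfin
  rw [hsm ζ hYne, htm ζ hYne, hmob, hXζ, hYζ, ratio_smul_smul (inv_ne_zero hy)] at hfin
  refine mul_left_cancel₀ (pow_ne_zero 3 hYne) ?_
  linear_combination hfin

end BinQuad

/-! ### The period matrices -/

theorem deriv_mobius (g : GL (Fin 2) ℂ) {z : ℂ} (h : g 1 0 * z + g 1 1 ≠ 0) :
    deriv (mobius g) z = (g 0 0 * g 1 1 - g 0 1 * g 1 0) / (g 1 0 * z + g 1 1) ^ 2 := by
  have hlin : ∀ a b : ℂ, HasDerivAt (fun z => a * z + b) a z := fun a b => by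
    simpa using ((hasDerivAt_id z).const_mul a).add_const b
  have := ((hlin (g 0 0) (g 0 1)).div (hlin (g 1 0) (g 1 1)) h).deriv
  rw [show mobius g = (fun z => g 0 0 * z + g 0 1) / fun z => g 1 0 * z + g 1 1 from rfl, this]
  congr 1
  ring

/-- The pole of the parametrization does not contribute to the integral. -/
theorem boundaryIntegral_eq (g : GL (Fin 2) ℂ) {F G : ℂ → ℂ}
    (h : ∀ z : ℂ, ‖z‖ = 1 → g 1 0 * z + g 1 1 ≠ 0 →
      F (mobius g z) * ((g 0 0 * g 1 1 - g 0 1 * g 1 0) / (g 1 0 * z + g 1 1) ^ 2) = G z) :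
    boundaryIntegral g F = ∮ z in C(0, 1), G z := by
  refine circleIntegral.circleIntegral_congr_codiscreteWithin ?_ one_ne_zero
  have hfin : {z : ℂ | g 1 0 * z + g 1 1 = 0}.Finite := by
    refine Set.Subsingleton.finite fun u hu v hv => ?_
    rw [Set.mem_ofPred_eq] at hu hv
    have hc : g 1 0 ≠ 0 := by
      intro h0
      have := det_ne_zero' g
      have h1 : g 1 1 = 0 := by simpa [h0] using hu
      simp [h0, h1] at this
    exact mul_left_cancel₀ hc (by linear_combination hu - hv)
  filter_upwards [compl_finite_mem_codiscreteWithin hfin,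
    Filter.self_mem_codiscreteWithin _] with z hz hz1
  rw [deriv_mobius g hz]
  exact h z (by simpa using hz1) hz

theorem hform_mobius (g : GL (Fin 2) ℂ) {z : ℂ} (hz : ‖z‖ = 1) (h : g 1 0 * z + g 1 1 ≠ 0) :
    hform (discMatrix g 1) (mobius g z) 1 = 0 := by
  have h1 := hform_discMatrix g 1 z 1
  rw [mul_one, mul_one, hz] at h1
  have h2 := hform_smul (discMatrix g 1) (g 1 0 * z + g 1 1) (mobius g z) 1
  rw [mobius, mul_div_cancel₀ _ h, mul_one, h1] at h2
  have h3 : ‖g 1 0 * z + g 1 1‖ ^ 2 ≠ 0 := pow_ne_zero 2 (norm_ne_zero_iff.mpr h)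
  refine (mul_eq_zero.mp (h2.symm.trans ?_)).resolve_left h3
  simp

/-- If `s = ± t √(f / H)` on the boundary circles, then the period matrices agree up to this
sign. -/
theorem periodMatrix_eq_smul {g : Fin 3 → GL (Fin 2) ℂ}
    (hg : Pairwise fun i j => Disjoint (mobiusDisc (g i)) (mobiusDisc (g j))) {w w' : Fin 3 → ℂ}
    (hw : ∀ i, ‖w i‖ < 1) (hw' : ∀ i, ‖w' i‖ < 1) {P : Fin 3 → BinQuad} {k : Fin 3 → ℂ}
    (hk : ∀ i, k i ≠ 0)
    (hP : ∀ i, P i = BinQuad.scale (k i) (BinQuad.ofImages (g i) (w i) (w' i)))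
    {U : Set (OnePoint ℂ)} (hU : IsOpen U) (hKU : (⋃ j, mobiusDisc (g j))ᶜ ⊆ U) {s t : ℂ → ℂ}
    (hs : DifferentiableOn ℂ s {x : ℂ | (x : OnePoint ℂ) ∈ U})
    (hs2 : ∀ x : ℂ, (x : OnePoint ℂ) ∈ U → s x ^ 2 = ∏ i, (P i).eval x 1) {η : ℂ}
    (hη : η = 1 ∨ η = -1) (hst : ∀ j (x : ℂ), hform (discMatrix (g j) 1) x 1 = 0 →
      s x = η * (t x * csqrt (BinQuad.ratio (P 0) (P 1) (P 2) x 1))) :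
    periodMatrix g t = η • periodMatrix g s := by
  ext n j
  obtain ⟨S, hSc, hS2, hSm⟩ := exists_pullback hU hs hs2 (g j)
  have hK : ∀ z ∈ Metric.sphere (0 : ℂ) 1,
      g j • (z : OnePoint ℂ) ∈ (⋃ j, mobiusDisc (g j))ᶜ ∧
        ∀ i, 0 ≤ hform (discMatrix (g i) 1) (g j 0 0 * z + g j 0 1) (g j 1 0 * z + g j 1 1) := by
    intro z hz
    have hz1 : ‖z‖ = 1 := by simpa using hz
    have hnn : ∀ i, 0 ≤ hform (discMatrix (g i) 1) (g j 0 0 * z + g j 0 1)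
        (g j 1 0 * z + g j 1 1) := by
      intro i
      by_cases hi : i = j
      · subst hi; exact hform_discMatrix_coe_nonneg _ zero_le_one hz1.ge
      · exact hform_nonneg_of_disjoint_of_nonpos (hg (Ne.symm hi))
          (hform_discMatrix_coe_nonpos _ hz1.le)
    exact ⟨(coe_notMem_iUnion_iff (smul_coe_eq_toPoint _ z) (coe_vec_ne_zero _ z)).mpr hnn, hnn⟩
  have hmain := BinQuad.circleIntegral_eq_of_sq_eq' hg hw hw' hk hP (S := S)
    (hSc.mono fun z hz => hKU (hK z hz).1) j fun z hz => hS2 z (hKU (hK z hz).1)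
  set δ := g j 0 0 * g j 1 1 - g j 0 1 * g j 1 0 with hδ
  -- In the coordinate `z`, the forms `dx` and `x dx` become linear functions divided by a cube.
  obtain ⟨l₀, l₁, hl⟩ : ∃ l₀ l₁ : ℂ, ∀ z : ℂ, g j 1 0 * z + g j 1 1 ≠ 0 →
      mobius (g j) z ^ (n : ℕ) * (δ / (g j 1 0 * z + g j 1 1) ^ 2) * (g j 1 0 * z + g j 1 1) ^ 3
        = l₀ + l₁ * z := by
    have hcube : ∀ M E : ℂ, E ≠ 0 → M * (δ / E ^ 2) * E ^ 3 = M * E * δ := by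
      intro M E hE
      field_simp
    fin_cases n
    · refine ⟨δ * g j 1 1, δ * g j 1 0, fun z hz => ?_⟩
      rw [hcube _ _ hz]
      simp only [pow_zero]
      ring
    · refine ⟨δ * g j 0 1, δ * g j 0 0, fun z hz => ?_⟩
      rw [hcube _ _ hz]
      simp only [pow_one, mobius, div_mul_cancel₀ _ hz]
      ring
  have hints : boundaryIntegral (g j) (fun x => x ^ (n : ℕ) / s x)
      = ∮ z in C(0, 1), (l₀ + l₁ * z) / S z := by
    refine boundaryIntegral_eq (g j) fun z hz h0 => ?_
    rw [← hl z h0, hSm z h0, mul_comm ((g j 1 0 * z + g j 1 1) ^ 3) (s _),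
      mul_div_mul_right _ _ (pow_ne_zero 3 h0), div_mul_eq_mul_div]
  have hintt : boundaryIntegral (g j) (fun x => x ^ (n : ℕ) / t x)
      = ∮ z in C(0, 1), η * ((l₀ + l₁ * z) / S z * csqrt (BinQuad.ratio (P 0) (P 1) (P 2)
        (g j 0 0 * z + g j 0 1) (g j 1 0 * z + g j 1 1))) := by
    refine boundaryIntegral_eq (g j) fun z hz h0 => ?_
    have hr := (BinQuad.ratio_mem_slitPlane (m := fun i => discMatrix (g i) 1)
      (hform_nonneg_of_shrunk hg (ρ := fun _ => 1) (fun _ => zero_le_one) (fun _ => le_rfl))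
      (fun i => hform_discMatrix_coe_neg (g i) (hw i))
      (fun i => hform_discMatrix_coe_neg (g i) (hw' i)) (coe_vec_ne_zero (g j) z)
      (hK z (by simpa using hz)).2 hk hP).2.2.2.2.2
    have hc := csqrt_ne_zero (Complex.slitPlane_ne_zero hr)
    have hrat : BinQuad.ratio (P 0) (P 1) (P 2) (g j 0 0 * z + g j 0 1) (g j 1 0 * z + g j 1 1)
        = BinQuad.ratio (P 0) (P 1) (P 2) (mobius (g j) z) 1 := by
      rw [← BinQuad.ratio_smul_smul h0 _ _ _ (mobius (g j) z), mobius, mul_div_cancel₀ _ h0,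
        mul_one]
    have hsx := hst j (mobius (g j) z) (hform_mobius (g j) hz h0)
    rw [hrat] at hc ⊢
    rw [← hl z h0, hSm z h0, mul_comm ((g j 1 0 * z + g j 1 1) ^ 3) (s _),
      mul_div_mul_right _ _ (pow_ne_zero 3 h0), hsx]
    have hcancel : ∀ A T C : ℂ, C ≠ 0 → A / (T * C) * C = A / T := by
      intro A T C hC
      rw [div_mul_eq_mul_div, mul_div_mul_right _ _ hC]
    rcases hη with rfl | rfl
    · rw [one_mul, one_mul, hcancel _ _ _ hc, div_mul_eq_mul_div]
    · rw [neg_one_mul, neg_one_mul, div_neg, neg_mul, neg_neg, hcancel _ _ _ hc,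
        div_mul_eq_mul_div]
  simp only [periodMatrix, Matrix.of_apply, Matrix.smul_apply, smul_eq_mul]
  rw [hints, hintt, circleIntegral.integral_const_mul, hmain l₀ l₁]

theorem BinQuad.det_ne_zero_of_disjoint {g : Fin 3 → GL (Fin 2) ℂ}
    (hg : Pairwise fun i j => Disjoint (mobiusDisc (g i)) (mobiusDisc (g j))) {w w' : Fin 3 → ℂ}
    (hw : ∀ i, ‖w i‖ < 1) (hw' : ∀ i, ‖w' i‖ < 1) {P : Fin 3 → BinQuad} {k : Fin 3 → ℂ}
    (hk : ∀ i, k i ≠ 0) (hP : ∀ i, P i = scale (k i) (ofImages (g i) (w i) (w' i))) :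
    det (P 0) (P 1) (P 2) ≠ 0 := by
  have key := det_ofRoots_ne_zero (m := fun i => discMatrix (g i) 1)
    (hform_nonneg_of_shrunk hg (ρ := fun _ => 1) (fun _ => zero_le_one) (fun _ => le_rfl))
    (fun i => hform_discMatrix_coe_neg (g i) (hw i))
    (fun i => hform_discMatrix_coe_neg (g i) (hw' i))
  rw [hP 0, hP 1, hP 2, det_scale]
  exact mul_ne_zero (mul_ne_zero (mul_ne_zero (hk 0) (hk 1)) (hk 2)) key

/-- A decomposition of a polynomial and its Richelot transform in terms of binary forms with zeros
in the discs. -/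
theorem exists_forms {g : Fin 3 → GL (Fin 2) ℂ} {f : ℂ[X]} {p : Fin 3 → ℂ[X]}
    (hp : IsDecomposition (fun j => mobiusDisc (g j)) f p) :
    ∃ (P : Fin 3 → BinQuad) (k w w' : Fin 3 → ℂ), (∀ i, k i ≠ 0) ∧ (∀ i, ‖w i‖ < 1) ∧
      (∀ i, ‖w' i‖ < 1) ∧
      (∀ i, P i = BinQuad.scale (k i) (BinQuad.ofImages (g i) (w i) (w' i))) ∧
      (∀ x, f.eval x = ∏ i, (P i).eval x 1) ∧
      ∀ x, (richelot (p 0) (p 1) (p 2)).eval x = ∏ i, (BinQuad.richelotFactor P i).eval x 1 := by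
  obtain ⟨rfl, h⟩ := hp
  choose k w w' hk hw hw' hP using fun i => exists_toQuad_eq (h i).1 (h i).2.1 (h i).2.2
  refine ⟨fun i => toQuad (p i), k, w, w', hk, hw, hw', hP, fun x => ?_, fun x => ?_⟩
  · simp only [Polynomial.eval_mul, Fin.prod_univ_three, eval_eq_toQuad (h _).2.1]
  · rw [eval_richelot (h 0).2.1 (h 1).2.1 (h 2).2.1]
    simp only [BinQuad.richelotFactor, Fin.prod_univ_three, Matrix.cons_val, BinQuad.eval_scale]
    ring

end Richelot

end

theorem proposition3p5 (D : Fin 3 → Set (OnePoint ℂ))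
    (hDisj : Pairwise fun i j => Disjoint (D i) (D j))
    (g : Fin 3 → GL (Fin 2) ℂ) (hD : ∀ j, D j = Richelot.mobiusDisc (g j))
    (f : ℂ[X]) (hf : Richelot.IsAdmissible f) (hfD : Richelot.IsSubordinate D f) :
    (∃ s, Richelot.IsSqrtBranch D f s) ∧
    (∃ t, Richelot.IsSqrtBranch D (Richelot.richelotStep D f) t) ∧
    ∀ s t : ℂ → ℂ, Richelot.IsSqrtBranch D f s →
      Richelot.IsSqrtBranch D (Richelot.richelotStep D f) t →
      Richelot.periodMatrix g s = Richelot.periodMatrix g t ∨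
        Richelot.periodMatrix g s = -Richelot.periodMatrix g t := by
  obtain rfl : D = fun j => Richelot.mobiusDisc (g j) := funext hD
  have hdec := Richelot.isDecomposition_discFactor hDisj hfD
  rw [Richelot.richelotStep_eq hDisj hdec]
  generalize (![Polynomial.C f.leadingCoeff * Richelot.discFactor f (Richelot.mobiusDisc (g 0)),
    Richelot.discFactor f (Richelot.mobiusDisc (g 1)),
    Richelot.discFactor f (Richelot.mobiusDisc (g 2))] : Fin 3 → ℂ[X]) = p at hdec ⊢
  obtain ⟨P, k, w, w', hk, hw, hw', hP, hfe, hHe⟩ := Richelot.exists_forms hdec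
  obtain ⟨U, s₀, t₀, hU, hKU, hU2⟩ := Richelot.BinQuad.exists_branches hDisj hw hw' hk hP
  refine ⟨⟨s₀, U, hU, hKU, fun x hx => (hU2 x hx).1.differentiableWithinAt, fun x hx => ?_⟩,
    ⟨t₀, U, hU, hKU, fun x hx => (hU2 x hx).2.1.differentiableWithinAt, fun x hx => ?_⟩, ?_⟩
  · rw [(hU2 x hx).2.2.1, hfe, Fin.prod_univ_three]
  · have hd := Richelot.BinQuad.det_ne_zero_of_disjoint hDisj hw hw' hk hP
    rw [hHe, Fin.prod_univ_three]
    simp only [Richelot.BinQuad.richelotFactor, Matrix.cons_val, Richelot.BinQuad.eval_scale]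
    have h4 := (hU2 x hx).2.2.2
    field_simp
    linear_combination h4
  · rintro s t ⟨V, hV, hKV, hs, hs2⟩ ⟨V', hV', hKV', ht, ht2⟩
    have hs2' := fun x hx => (hs2 x hx).trans (hfe x)
    obtain ⟨η, hη, hst⟩ := Richelot.BinQuad.exists_sign hDisj hw hw' hk hP hV hV' hKV hKV' hs ht
      hs2' fun x hx => (ht2 x hx).trans (hHe x)
    have hmat := Richelot.periodMatrix_eq_smul hDisj hw hw' hk hP hV hKV hs hs2' hη hst
    rcases hη with rfl | rfl
    · left; rw [hmat, one_smul]
    · right; rw [hmat, neg_one_smul, neg_neg]
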